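/- Let $r\ge 2$ and let $a_1,\dots,a_r,z_1,\dots,z_r\in\mathbb{C}$ satisfy $\Re(a_1+\cdots+a_j)>0$ and $z_j\notin(1,\infty)$ for $j=1,\dots,r$. Let $Q=\{j: z_j=1\}$. For $\Re(s_j)>1$ and $0<|w_j|\le 1$ $(1\le j\le r)$ put $$\zeta(s_1,\dots,s_r;a_1,\dots,a_r;w_1,\dots,w_r)=\sum_{m_1,\dots,m_r\ge 0}\ \prod_{j=1}^r\frac{w_j^{m_j}}{(m_1+\cdots+m_j+a_1+\cdots+a_j)^{s_j}}$$ (principal powers). With $w_j=1$ fixed for $j\in Q$, this function of $(s_1,\dots,s_r)$ and of the $w_j$ with $j\notin Q$ has a meromorphic continuation to $\mathbb{C}^r\times(\mathbb{C}\setminus[1,\infty))^{r-|Q|}$, again denoted by $\zeta$; it takes its holomorphic value at every removable singularity. Define the Apostol--Bernoulli polynomials by $\dfrac{xe^{ax}}{ze^x-1}=\sum_{n\ge0}B_n(a;z)\dfrac{x^n}{n!}$. For a vector $v=(v_1,\dots,v_r)$ write $v(i,r)=v_i+\cdots+v_r$. Let $l=(l_1,\dots,l_r)\in\mathbb{Z}_{\ge0}^r$.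 For $d=(d_1,\dots,d_{r-1})\in\{0,1\}^{r-1}$ let $S^{(d)}$ be the set of all $n=(n_1,\dots,n_r)\in\mathbb{Z}_{\ge0}^r$ with $n(1,r)=l(1,r)+r$ such that, for every $j=1,\dots,r-1$, $$n(j+1,r)\le l(j+1,r)+(r-j)\ \text{ if } d_j=0,\qquad n(j+1,r)>l(j,r)+(r-j)\ \text{ if } d_j=1.$$ For $n\in S^{(d)}$ and $\epsilon\in\mathbb{C}^r$ put $h^{(d)}(n)=(-1)^{l_r}\,l_r!\,\prod_{j=1}^{r-1}h_j^{(d_j)}(n)$, where $$h_j^{(0)}(n)=\frac{(-1)^{l_j}\,\bigl(l(j,r)+(r-j)-n(j+1,r)\bigr)!}{\bigl(l(j+1,r)+(r-j)-n(j+1,r)\bigr)!},\qquad h_j^{(1)}(n)=\frac{\epsilon(j+1,r)}{\epsilon(j,r)}\cdot\frac{\bigl(n(j+1,r)-l(j+1,r)-(r-j)-1\bigr)!}{\bigl(n(j+1,r)-l(j,r)-(r-j)-1\bigr)!}.$$ Then for every $K$ there are $C$ and $\delta>0$ (depending only on $r,a,z,l,K$) such that, for all $\epsilon_1,\dots,\epsilon_r\in\mathbb{C}$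 with $|\epsilon_j|<\delta$, $\epsilon_j\ne0$, $\epsilon(j,r)\neq0$ and $|\epsilon_k/\epsilon(j,r)|\le K$ for all $1\le j\le k\le r$, the function $\zeta$ is holomorphic at the point $(-l_1+\epsilon_1,\dots,-l_r+\epsilon_r;z_1,\dots,z_r)$ and $$\Bigl|\zeta(-l_1+\epsilon_1,\dots,-l_r+\epsilon_r;a_1,\dots,a_r;z_1,\dots,z_r)-(-1)^{l(1,r)+r}\sum_{d\in\{0,1\}^{r-1}}\ \sum_{n\in S^{(d)}}\Bigl(\prod_{j=1}^r\frac{B_{n_j}(a_j;z_j)}{n_j!}\Bigr)h^{(d)}(n)\Bigr|\le C\sum_{j=1}^r|\epsilon_j|.$$ -/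

import Mathlib

open Filter Topology
open scoped Nat

noncomputable section

namespace HurwitzLerch

/-- `tail v j = v j + v (j+1) + ⋯` up to the last index. -/
def tail {r : ℕ} {M : Type*} [AddCommMonoid M] (v : Fin r → M) (j : Fin r) : M :=
  ∑ i ∈ Finset.Ici j, v i

/-- The formal power series `exp (a X)`. -/
def expSeries (a : ℂ) : PowerSeries ℂ :=
  PowerSeries.rescale a (PowerSeries.exp ℂ)

/-- The Apostol-Bernoulli polynomial `B_n(a; z)`: `n!` times the coefficient of `X ^ n` in
`X exp (a X) / (z exp X - 1)`. The quotient is taken in the field of formal Laurent series; it has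
no negative powers of `X`, also for `z = 1`. -/
def apostolBernoulli (n : ℕ) (a z : ℂ) : ℂ :=
  (n ! : ℂ) *
    HahnSeries.coeff
      (((PowerSeries.X * expSeries a : PowerSeries ℂ) : LaurentSeries ℂ) /
        ((PowerSeries.C z * PowerSeries.exp ℂ - 1 : PowerSeries ℂ) : LaurentSeries ℂ)) (n : ℤ)

/-! ### Meromorphic functions of several complex variables -/

section Meromorphic

variable {E : Type*} [NormedAddCommGroup E] [NormedSpace ℂ E]

/-- `f` and `g` agree near `x` outside the zero set of a holomorphic function whose germ at `x`
is not zero. -/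
def GenericallyEqAt (f g : E → ℂ) (x : E) : Prop :=
  ∃ q : E → ℂ, AnalyticAt ℂ q x ∧ (∃ᶠ y in 𝓝 x, q y ≠ 0) ∧ ∀ᶠ y in 𝓝 x, q y ≠ 0 → f y = g y

/-- `f` is, near `x`, a quotient `p / q` of holomorphic functions, the germ of `q` at `x` being
nonzero; the values of `f` are prescribed only where `q` does not vanish. -/
def IsMeromorphicAt (f : E → ℂ) (x : E) : Prop :=
  ∃ p q : E → ℂ, AnalyticAt ℂ p x ∧ AnalyticAt ℂ q x ∧ (∃ᶠ y in 𝓝 x, q y ≠ 0) ∧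
    ∀ᶠ y in 𝓝 x, q y ≠ 0 → f y = p y / q y

/-- `f` is meromorphic on `U` and takes the correct value at each point of `U` at which its
singularity (if any) is removable. -/
structure IsMeromorphicOn (f : E → ℂ) (U : Set E) : Prop where
  meromorphicAt : ∀ x ∈ U, IsMeromorphicAt f x
  value_eq : ∀ x ∈ U, ∀ g : E → ℂ, AnalyticAt ℂ g x → GenericallyEqAt f g x → f x = g x

end Meromorphic

/-! ### The Hurwitz-Lerch multiple zeta function -/

section Zeta

variable {r : ℕ}

/-- The term `∏_j z_j ^ m_j / (m_1 + ⋯ + m_j + a_1 + ⋯ + a_j) ^ s_j` of the multiple series;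
the powers are the principal ones, with argument in `(-π, π]`. -/
def zetaTerm (s a z : Fin r → ℂ) (m : Fin r → ℕ) : ℂ :=
  ∏ j, z j ^ m j / (∑ i ∈ Finset.Iic j, ((m i : ℂ) + a i)) ^ s j

/-- The indices `j` with `z_j = 1`. -/
def oneSet (z : Fin r → ℂ) : Finset (Fin r) :=
  Finset.univ.filter fun j => z j = 1

/-- The variables `(s, w)`: all `s_1, …, s_r`, and those `z_j` that are not fixed to be `1`. -/
abbrev Vars (Q : Finset (Fin r)) : Type :=
  (Fin r → ℂ) × ({j : Fin r // j ∉ Q} → ℂ)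

/-- The vector `z` with `z_j = 1` for `j ∈ Q` and `z_j = w_j` for the other `j`. -/
def fillOne (Q : Finset (Fin r)) (w : {j : Fin r // j ∉ Q} → ℂ) : Fin r → ℂ :=
  fun j => if h : j ∈ Q then 1 else w ⟨j, h⟩

/-- All `s` in `ℂ ^ r`, and each free `z_j` in `ℂ ∖ [1, ∞)`. -/
def contDomain (Q : Finset (Fin r)) : Set (Vars Q) :=
  {x | ∀ j, x.2 j ∉ Complex.ofReal '' Set.Ici 1}

/-- `Z` is the meromorphic continuation of the Hurwitz-Lerch multiple zeta function with shift
parameters `a` and with `z_j = 1` for `j ∈ Q`, as a function of `s` and of the `z_j`, `j ∉ Q`: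
it is meromorphic on `ℂ ^ r × (ℂ ∖ [1, ∞)) ^ (r - |Q|)`, and it is the sum of the multiple series
where `Re s_j > 1` and `0 < |z_j| ≤ 1` for all `j`. -/
structure IsZetaContinuation (a : Fin r → ℂ) (Q : Finset (Fin r)) (Z : Vars Q → ℂ) : Prop where
  meromorphic : IsMeromorphicOn Z (contDomain Q)
  hasSum : ∀ x ∈ contDomain Q, (∀ j, 1 < (x.1 j).re) → (∀ j, x.2 j ≠ 0 ∧ ‖x.2 j‖ ≤ 1) →
    HasSum (zetaTerm x.1 a (fillOne Q x.2)) (Z x)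

end Zeta

/-! ### The main term. The depth is `r = q + 1`; indices start at `0`, so for `j : Fin q` the
sums `v(j, r)` and `v(j+1, r)` are `tail v j.castSucc` and `tail v j.succ`, and the number `r - j`
of indices after the `j`-th is `q - j`. -/

section MainTerm

variable {q : ℕ}

/-- The finite index set `S^{(d)}(l)`. -/
def indexSet (l : Fin (q + 1) → ℕ) (d : Fin q → Fin 2) : Finset (Fin (q + 1) → ℕ) :=
  (Finset.piAntidiag Finset.univ ((∑ i, l i) + (q + 1))).filter fun n =>
    ∀ j : Fin q,
      if d j = 0 then tail n j.succ ≤ tail l j.succ + (q - j)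
      else tail l j.castSucc + (q - j) < tail n j.succ

/-- The factor `h_j^{(d_j)}`. For `n` in the index set none of the subtractions truncates. -/
def hFactor (l n : Fin (q + 1) → ℕ) (ε : Fin (q + 1) → ℂ) (j : Fin q) (dj : Fin 2) : ℂ :=
  if dj = 0 then
    (-1) ^ l j.castSucc *
      ((tail l j.castSucc + (q - j) - tail n j.succ)! : ℂ) /
      ((tail l j.succ + (q - j) - tail n j.succ)! : ℂ)
  else
    tail ε j.succ / tail ε j.castSucc *
      (((tail n j.succ - (tail l j.succ + (q - j)) - 1)! : ℂ) /
        ((tail n j.succ - (tail l j.castSucc + (q - j)) - 1)! : ℂ))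

/-- The weight `h^{(d)}(n; l; ε)`. -/
def hWeight (l n : Fin (q + 1) → ℕ) (ε : Fin (q + 1) → ℂ) (d : Fin q → Fin 2) : ℂ :=
  (-1) ^ l (Fin.last q) * ((l (Fin.last q))! : ℂ) * ∏ j, hFactor l n ε j (d j)

/-- The explicit finite sum in the asymptotic formula. -/
def mainTerm (a z : Fin (q + 1) → ℂ) (l : Fin (q + 1) → ℕ) (ε : Fin (q + 1) → ℂ) : ℂ :=
  (-1) ^ ((∑ i, l i) + (q + 1)) *
    ∑ d : Fin q → Fin 2, ∑ n ∈ indexSet l d,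
      (∏ j, apostolBernoulli (n j) (a j) (z j) / ((n j)! : ℂ)) * hWeight l n ε d

end MainTerm

end HurwitzLerch

end

noncomputable section

namespace HurwitzLerch

/-! ### Analyticity in several complex variables -/

section Osgood

open Metric MeasureTheory Set

/-! Put b_j = s_j + ⋯ + s_r - (r - j + 1). Writing each power as a Laplace integral and merging
these integrals one at a time turns the series into Γ(s_r)⁻¹ ∏ Γ(b_j) times the regularized Mellin
transform, at exponent b_1, of an iterated kernel (`hasSum_zetaTerm`). That kernel is built from t
exp(-a t) / (1 - w exp(-t)) by alternating multiplication with Beta operators of exponents (s_j,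
b_{j+1}), each divided by its own Gamma factors. Integration by parts makes the normalized Beta
operator entire in both exponents (`analyticAt_betaOp`), and positivity of the Re(a_1 + ⋯ + a_j)
gives exponential decay (`tameAt_iterKer`). Hence all poles sit in the explicit factors Γ(b_j). This
gives the continuation, and the identity theorem for meromorphic functions identifies it with any
other one (`IsZetaContinuation.eventuallyEq`).

At s = -l + ε one has b_j = -L_j + ε(j, r) with natural numbers L_j. If the outer Mellin exponent is
frozen at -L_1, the transform is ± the L_1-th derivative of the iterated kernel at 0. The Beta
operator is diagonal on Taylor coefficients (`iteratedDeriv_betaOp_zero`), so this is a finite sum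
of products of Apostol-Bernoulli values and Gamma quotients (`regMellin_main`). For k = n(j+1, r)
these quotients compare Γ(b_{j+1} + k) with Γ(b_j + 1 + k). According to the position of k relative
to L_{j+1} and l_j + L_{j+1}, they tend to h_j^{(0)}, tend to 0, or are asymptotic to h_j^{(1)}
(`approx_gamma_ratio`).

It remains to bound the effect of freezing b_1, which is multiplied by r - 1 uncancelled poles
1/ε(j, r). The error is analytic in r independent blocks of perturbations: that of b_1, and the
pairs for (s_j, b_{j+1}). It vanishes as soon as one block vanishes, because the Beta operator is
zero when both exponents are nonpositive integers (`betaOp_neg_nat`). A Schwarz lemma in blocks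
(`isBigO_prod_of_eq_zero`) bounds it by the product of all block norms. Bounded quotients ε_k/ε(j,
r) let r - 1 blocks absorb the poles, and the remaining block |ε(1, r)| is the claimed O(∑|ε_j|). -/

theorem torusMap_mem_closedBall {n : ℕ} (c : Fin n → ℂ) {R : ℝ} (hR : 0 < R) (θ : Fin n → ℝ) :
    torusMap c (fun _ => R) θ ∈ closedBall c R := by
  rw [mem_closedBall, dist_pi_le_iff hR.le]
  intro i
  simp [torusMap, dist_eq_norm, Complex.norm_exp_ofReal_mul_I, abs_of_pos hR]

theorem torusMap_sub_ne_zero {n : ℕ} (c z : Fin n → ℂ) {R : ℝ} (hR : 0 < R)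
    (hz : z ∈ ball c R) (θ : Fin n → ℝ) (i : Fin n) :
    torusMap c (fun _ => R) θ i - z i ≠ 0 := by
  intro h
  have h1 : dist (z i) (c i) < R := (dist_pi_lt_iff hR).1 (mem_ball.1 hz) i
  rw [← sub_eq_zero.1 h] at h1
  simp [torusMap, dist_eq_norm, Complex.norm_exp_ofReal_mul_I, abs_of_pos hR] at h1

theorem continuous_torusMap {n : ℕ} (c : Fin n → ℂ) (R : Fin n → ℝ) :
    Continuous (torusMap c R) := by
  unfold torusMap
  fun_prop

theorem continuous_torusMap_apply {n : ℕ} (c : Fin n → ℂ) (R : Fin n → ℝ) (i : Fin n) :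
    Continuous fun θ => torusMap c R θ i := by
  unfold torusMap
  fun_prop

/-- The Cauchy integral formula on a polydisc. -/
theorem torusIntegral_cauchy {n : ℕ} (f : (Fin n → ℂ) → ℂ) (c z : Fin n → ℂ) {R : ℝ}
    (hR : 0 < R) (hf : ContinuousOn f (closedBall c R))
    (hd : ∀ x ∈ closedBall c R, ∀ i,
      DifferentiableAt ℂ (fun u => f (Function.update x i u)) (x i))
    (hz : z ∈ ball c R) :
    torusIntegral (fun ζ => (∏ i, (ζ i - z i)⁻¹) * f ζ) c (fun _ => R)
      = (2 * Real.pi * Complex.I) ^ n * f z := by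
  induction n with
  | zero => simp [Subsingleton.elim c z]
  | succ n ih =>
    have hcons : ∀ x ∈ closedBall (c 0) R, ∀ y ∈ closedBall (fun i => c (Fin.succ i)) R,
        (Fin.cons x y : Fin (n + 1) → ℂ) ∈ closedBall c R := by
      intro x hx y hy
      rw [mem_closedBall, dist_pi_le_iff hR.le] at hy ⊢
      intro i
      refine Fin.cases ?_ (fun j => ?_) i
      · simpa using hx
      · simpa using hy j
    have hz0 : z 0 ∈ ball (c 0) R := (dist_pi_lt_iff hR).1 (mem_ball.1 hz) 0
    have hzs : (fun i => z (Fin.succ i)) ∈ ball (fun i => c (Fin.succ i)) R := by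
      rw [mem_ball, dist_pi_lt_iff hR]
      exact fun i => (dist_pi_lt_iff hR).1 (mem_ball.1 hz) i.succ
    have hzcons : (Fin.cons (z 0) (fun i => z (Fin.succ i)) : Fin (n + 1) → ℂ) = z :=
      Fin.cons_self_tail z
    rw [torusIntegral_succ]
    · have key : ∀ x ∈ sphere (c 0) R,
          torusIntegral (fun y : Fin n → ℂ => (∏ i, ((Fin.cons x y : Fin (n + 1) → ℂ) i - z i)⁻¹) *
            f (Fin.cons x y)) (c ∘ Fin.succ) ((fun _ => R) ∘ Fin.succ)
          = (x - z 0)⁻¹ • ((2 * Real.pi * Complex.I) ^ n * f (Fin.cons x fun i => z i.succ)) := by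
        intro x hx
        have hx' := sphere_subset_closedBall hx
        have := ih (fun y => f (Fin.cons x y)) (fun i => c (Fin.succ i)) (fun i => z i.succ)
          (hf.comp (by fun_prop) (fun y hy => hcons x hx' y hy)) (fun y hy i => by
            have := hd _ (hcons x hx' y hy) i.succ
            simpa [Fin.cons_update] using this) hzs
        rw [← this, smul_eq_mul, ← torusIntegral_const_mul]
        simp only [Fin.prod_univ_succ, Fin.cons_zero, Fin.cons_succ, mul_assoc]
        rfl
      rw [circleIntegral.integral_congr hR.le key]
      have hc : ContinuousOn (fun x => (2 * Real.pi * Complex.I) ^ n *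
          f (Fin.cons x fun i => z i.succ)) (closedBall (c 0) R) := by
        refine continuousOn_const.mul (hf.comp (by fun_prop) fun x hx => ?_)
        exact hcons x hx _ (ball_subset_closedBall hzs)
      rw [Complex.circleIntegral_sub_inv_smul_of_differentiable_on_off_countable countable_empty
        hz0 hc]
      · rw [hzcons, smul_eq_mul, pow_succ]; ring
      · intro x hx
        have := hd _ (hcons x (ball_subset_closedBall hx.1) _ (ball_subset_closedBall hzs)) 0
        exact (differentiableAt_const _).mul (by simpa using this)
    · refine ContinuousOn.integrableOn_compact isCompact_Icc (Continuous.continuousOn ?_)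
      refine Continuous.mul (continuous_finsetProd _ fun i _ => ?_) ?_
      · refine Continuous.inv₀ ?_ fun θ => torusMap_sub_ne_zero c z hR hz θ i
        exact (continuous_torusMap_apply c _ i).sub continuous_const
      · exact hf.comp_continuous (continuous_torusMap c _) fun θ => torusMap_mem_closedBall c hR θ

/-- **Osgood's lemma** on `ℂⁿ`. -/
theorem analyticAt_of_separately {n : ℕ} (f : (Fin n → ℂ) → ℂ) (c : Fin n → ℂ) {R : ℝ}
    (hR : 0 < R) (hf : ContinuousOn f (closedBall c R))
    (hd : ∀ x ∈ closedBall c R, ∀ i,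
      DifferentiableAt ℂ (fun u => f (Function.update x i u)) (x i)) :
    AnalyticAt ℂ f c := by
  -- Cauchy's formula near `c` is read as a continuous linear functional on the Banach algebra `C(K,
  -- ℂ)`, applied to the inverses of `ev i - z i` times a fixed element `G`. Inversion in a Banach
  -- algebra is analytic, so no power series has to be expanded by hand.
  let K : Set (Fin n → ℝ) := Icc (0 : Fin n → ℝ) fun _ => 2 * Real.pi
  have : CompactSpace K := isCompact_iff_compactSpace.1 isCompact_Icc
  let μ : Measure K := Measure.comap Subtype.val volume
  have : IsFiniteMeasure μ := by
    refine ⟨?_⟩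
    rw [Measure.comap_apply _ Subtype.val_injective
      (fun s hs => (MeasurableEmbedding.subtype_coe measurableSet_Icc).measurableSet_image.2 hs)
      _ MeasurableSet.univ]
    rw [Set.image_univ, Subtype.range_coe]
    exact measure_Icc_lt_top
  let Λ : C(K, ℂ) →L[ℂ] ℂ := (L1.integralCLM' ℂ).comp (ContinuousMap.toLp 1 μ ℂ)
  have hΛ : ∀ ψ : C(K, ℂ), Λ ψ = ∫ θ, ψ θ ∂μ := by
    intro ψ
    have : Λ ψ = L1.integral (ContinuousMap.toLp (E := ℂ) 1 μ ℂ ψ) := (L1.integral_eq' (𝕜 := ℂ) _).symm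
    rw [this, L1.integral_eq_integral]
    exact integral_congr_ae (ContinuousMap.coeFn_toLp μ ψ)
  let ev : Fin n → C(K, ℂ) := fun i =>
    ⟨fun θ => torusMap c (fun _ => R) θ i,
      (continuous_torusMap_apply c (fun _ => R) i).comp continuous_subtype_val⟩
  let G : C(K, ℂ) :=
    ⟨fun θ => (∏ i : Fin n, ((R : ℂ) * Complex.exp (θ.1 i * Complex.I) * Complex.I)) *
        f (torusMap c (fun _ => R) θ), by
      refine Continuous.mul (continuous_finsetProd _ fun i _ => ?_) ?_
      · have h1 : Continuous fun θ : K => θ.1 i :=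
          (continuous_apply (A := fun _ : Fin n => ℝ) i).comp continuous_subtype_val
        have h2 : Continuous fun u : ℝ => (R : ℂ) * Complex.exp (u * Complex.I) * Complex.I := by
          fun_prop
        exact h2.comp h1
      exact hf.comp_continuous ((continuous_torusMap c _).comp continuous_subtype_val)
        fun θ => torusMap_mem_closedBall c hR θ⟩
  have hunit : ∀ z ∈ ball c R, ∀ i, IsUnit (ev i - algebraMap ℂ C(K, ℂ) (z i)) := by
    intro z hz i
    rw [ContinuousMap.isUnit_iff_forall_ne_zero]
    exact fun θ => torusMap_sub_ne_zero c z hR hz θ i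
  have hcb : c ∈ ball c R := mem_ball_self hR
  have hk : AnalyticAt ℂ (fun z : Fin n → ℂ =>
      ∏ i, Ring.inverse (ev i - algebraMap ℂ C(K, ℂ) (z i))) c := by
    refine Finset.analyticAt_fun_prod _ fun i _ => ?_
    have h1 : AnalyticAt ℂ (fun z : Fin n → ℂ => ev i - algebraMap ℂ C(K, ℂ) (z i)) c := by
      refine analyticAt_const.sub ?_
      exact ((ContinuousLinearMap.comp (Algebra.linearMap ℂ C(K, ℂ)).toContinuousLinearMap
        (ContinuousLinearMap.proj i : (Fin n → ℂ) →L[ℂ] ℂ)).analyticAt c)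
    have h2 := analyticAt_inverse (𝕜 := ℂ) (hunit c hcb i).unit
    exact h2.comp_of_eq h1 rfl
  have hF : AnalyticAt ℂ (fun z : Fin n → ℂ => ((2 * Real.pi * Complex.I) ^ n)⁻¹ *
      Λ ((∏ i, Ring.inverse (ev i - algebraMap ℂ C(K, ℂ) (z i))) * G)) c :=
    analyticAt_const.mul ((Λ.analyticAt _).comp (hk.mul analyticAt_const))
  refine hF.congr ?_
  filter_upwards [isOpen_ball.mem_nhds hcb] with z hz
  have hc := torusIntegral_cauchy f c z hR hf hd hz
  have h2 : ((2 * Real.pi * Complex.I : ℂ) ^ n) ≠ 0 := by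
    simp [Real.pi_ne_zero]
  rw [hΛ, inv_mul_eq_iff_eq_mul₀ h2, ← hc, torusIntegral]
  rw [← integral_subtype_comap measurableSet_Icc]
  refine integral_congr_ae (Eventually.of_forall fun θ => ?_)
  have hinv : ∀ i, (Ring.inverse (ev i - algebraMap ℂ C(K, ℂ) (z i))) θ
      = (torusMap c (fun _ => R) θ i - z i)⁻¹ := by
    intro i
    have h3 := Ring.inverse_mul_cancel _ (hunit z hz i)
    have h4 := congrArg (fun ψ : C(K, ℂ) => ψ θ) h3
    exact eq_inv_of_mul_eq_one_left h4
  simp only [ContinuousMap.mul_apply, ContinuousMap.coe_prod, Finset.prod_apply, hinv, smul_eq_mul]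
  simp only [G, ContinuousMap.coe_mk]
  ring

variable {E : Type*} [NormedAddCommGroup E] [NormedSpace ℂ E] [FiniteDimensional ℂ E]

/-- **Osgood's lemma**: a continuous function which is holomorphic along complex lines is
analytic. -/
theorem analyticAt_of_continuousOn_of_line {f : E → ℂ} {U : Set E} {x : E} (hU : U ∈ 𝓝 x)
    (hf : ContinuousOn f U)
    (hd : ∀ y ∈ U, ∀ h : E, DifferentiableAt ℂ (fun u : ℂ => f (y + u • h)) 0) :
    AnalyticAt ℂ f x := by
  let ψ : E ≃L[ℂ] (Fin (Module.finrank ℂ E) → ℂ) :=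
    (Module.finBasis ℂ E).equivFun.toContinuousLinearEquiv
  have hU' : ψ.symm ⁻¹' U ∈ 𝓝 (ψ x) :=
    ψ.symm.continuous.continuousAt.preimage_mem_nhds (by simpa using hU)
  obtain ⟨R, hR, hRU⟩ := Metric.nhds_basis_closedBall.mem_iff.1 hU'
  have key : AnalyticAt ℂ (f ∘ ψ.symm) (ψ x) := by
    refine analyticAt_of_separately _ _ hR (hf.comp ψ.symm.continuous.continuousOn hRU) ?_
    intro y hy i
    have h1 := hd (ψ.symm y) (hRU hy) (ψ.symm (Pi.single i 1))
    have h2 : (fun u => (f ∘ ψ.symm) (Function.update y i u))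
        = (fun u : ℂ => f (ψ.symm y + u • ψ.symm (Pi.single i 1))) ∘ fun u => u - y i := by
      ext u
      simp only [Function.comp]
      rw [← map_smul, ← map_add]
      congr 2
      ext k
      by_cases hk : k = i
      · subst hk; simp
      · simp [hk]
    rw [h2]
    refine DifferentiableAt.comp _ ?_ (by fun_prop)
    simpa using h1
  have h3 : f = (f ∘ ψ.symm) ∘ ψ := by ext; simp
  rw [h3]
  exact key.comp (ψ.toContinuousLinearMap.analyticAt x)

end Osgood

/-! ### Holomorphic dependence of integrals on parameters. -/

section ParametricIntegral

open Metric MeasureTheory Set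

variable {α : Type*} [MeasurableSpace α] {μ : Measure α}

/-- Differentiation under the integral sign for a dominated family of holomorphic functions. -/
theorem hasDerivAt_integral_of_dominated_holomorphic {F : α → ℂ → ℂ} {z₀ : ℂ} {U : Set ℂ}
    {bound : α → ℝ} (hU : U ∈ 𝓝 z₀) (hm : ∀ z ∈ U, AEStronglyMeasurable (fun a => F a z) μ)
    (hd : ∀ᵐ a ∂μ, DifferentiableOn ℂ (F a) U) (hb : ∀ᵐ a ∂μ, ∀ z ∈ U, ‖F a z‖ ≤ bound a)
    (hi : Integrable bound μ) :
    HasDerivAt (fun z => ∫ a, F a z ∂μ) (∫ a, deriv (F a) z₀ ∂μ) z₀ := by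
  obtain ⟨R, hR, hRU⟩ := Metric.nhds_basis_closedBall.mem_iff.1 hU
  have hR2 : 0 < R / 2 := half_pos hR
  have hz₀ : z₀ ∈ U := mem_of_mem_nhds hU
  have hda : ∀ᵐ a ∂μ, ∀ z ∈ ball z₀ R, DifferentiableAt ℂ (F a) z := by
    filter_upwards [hd] with a ha z hz
    exact ha.differentiableAt (mem_of_superset (isOpen_ball.mem_nhds hz)
      (ball_subset_closedBall.trans hRU))
  -- The bound on the derivative is Cauchy's estimate on circles of radius `R / 2` about points of
  -- the ball of radius `R / 2`; such circles stay in the ball of radius `R`.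
  refine (hasDerivAt_integral_of_dominated_loc_of_deriv_le (μ := μ) (F := fun z a => F a z)
    (F' := fun z a => deriv (F a) z) (bound := fun a => bound a / (R / 2))
    (ball_mem_nhds z₀ hR2) ?_ ?_ ?_ ?_ (hi.div_const _) ?_).2
  · filter_upwards [hU] with z hz using hm z hz
  · exact hi.mono' (hm z₀ hz₀) (hb.mono fun a ha => ha z₀ hz₀)
  -- The derivative is measurable in `a` as a pointwise limit of difference quotients along the
  -- sequence `R / (n + 1)`.
  · let u : ℕ → ℂ := fun n => (R : ℂ) * ((n : ℂ) + 1)⁻¹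
    have hu0 : Tendsto u atTop (𝓝 0) := by
      have := (tendsto_one_div_add_atTop_nhds_zero_nat (𝕜 := ℂ)).const_mul (R : ℂ)
      simpa [u] using this
    have hune : ∀ n, u n ≠ 0 := fun n => by
      refine mul_ne_zero (by exact_mod_cast hR.ne') (inv_ne_zero ?_)
      exact_mod_cast n.succ_ne_zero
    have hmem : ∀ n, z₀ + u n ∈ U := fun n => by
      refine hRU ?_
      rw [mem_closedBall, dist_eq_norm]
      have h1 : ‖((n : ℂ) + 1)‖ = n + 1 := by
        rw [← Nat.cast_succ, Complex.norm_natCast]; simp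
      simp only [u, add_sub_cancel_left, norm_mul, norm_inv, h1, Complex.norm_real, Real.norm_eq_abs,
        abs_of_pos hR]
      exact mul_le_of_le_one_right hR.le (inv_le_one_of_one_le₀ (by linarith [n.cast_nonneg (α := ℝ)]))
    refine aestronglyMeasurable_of_tendsto_ae atTop
      (f := fun n a => (u n)⁻¹ * (F a (z₀ + u n) - F a z₀))
      (fun n => ((hm _ (hmem n)).sub (hm _ hz₀)).const_mul _) ?_
    filter_upwards [hda] with a ha
    have h1 := (ha z₀ (mem_ball_self hR)).hasDerivAt.tendsto_slope_zero
    have h2 : Tendsto u atTop (𝓝[≠] 0) :=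
      tendsto_nhdsWithin_iff.2 ⟨hu0, Eventually.of_forall hune⟩
    exact (h1.comp h2).congr fun n => by simp
  · filter_upwards [hda, hb] with a ha hba z hz
    have hsub : closedBall z (R / 2) ⊆ ball z₀ R := by
      refine closedBall_subset_ball' ?_
      rw [mem_ball] at hz; linarith
    refine Complex.norm_deriv_le_of_forall_mem_sphere_norm_le hR2 ?_ ?_
    · refine DifferentiableOn.diffContOnCl ?_
      intro y hy
      exact (ha y (hsub (closure_ball_subset_closedBall hy))).differentiableWithinAt
    · intro y hy
      exact hba y (hRU (ball_subset_closedBall (hsub (sphere_subset_closedBall hy))))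
  · filter_upwards [hda] with a ha z hz
    exact (ha z (ball_subset_ball (by linarith) hz)).hasDerivAt

variable {E : Type*} [NormedAddCommGroup E] [NormedSpace ℂ E] [FiniteDimensional ℂ E]

/-- A dominated integral of holomorphic functions depends analytically on the parameter. -/
theorem analyticAt_integral {F : α → E → ℂ} {x₀ : E} {U : Set E} {bound : α → ℝ} (hU : U ∈ 𝓝 x₀)
    (hm : ∀ x ∈ U, AEStronglyMeasurable (fun a => F a x) μ)
    (hd : ∀ᵐ a ∂μ, DifferentiableOn ℂ (F a) U) (hb : ∀ᵐ a ∂μ, ∀ x ∈ U, ‖F a x‖ ≤ bound a)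
    (hi : Integrable bound μ) : AnalyticAt ℂ (fun x => ∫ a, F a x ∂μ) x₀ := by
  obtain ⟨V, hVU, hV, hxV⟩ := _root_.mem_nhds_iff.1 hU
  refine analyticAt_of_continuousOn_of_line (hV.mem_nhds hxV) ?_ ?_
  · intro y hy
    refine ContinuousAt.continuousWithinAt ?_
    refine continuousAt_of_dominated (bound := bound) ?_ ?_ hi ?_
    · filter_upwards [hV.mem_nhds hy] with x hx using hm x (hVU hx)
    · filter_upwards [hV.mem_nhds hy] with x hx
      filter_upwards [hb] with a ha using ha x (hVU hx)
    · filter_upwards [hd] with a ha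
      exact ((ha.mono hVU).differentiableAt (hV.mem_nhds hy)).continuousAt
  · intro y hy h
    have hc : Continuous fun u : ℂ => y + u • h := by fun_prop
    have hW : (fun u : ℂ => y + u • h) ⁻¹' V ∈ 𝓝 (0 : ℂ) :=
      hc.continuousAt.preimage_mem_nhds (by simpa using hV.mem_nhds hy)
    refine (hasDerivAt_integral_of_dominated_holomorphic (F := fun a u => F a (y + u • h))
      hW (fun u hu => hm _ (hVU hu)) ?_ ?_ hi).differentiableAt
    · filter_upwards [hd] with a ha
      exact (ha.mono hVU).comp (by fun_prop) fun u hu => hu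
    · filter_upwards [hb] with a ha u hu using ha _ (hVU hu)

end ParametricIntegral

/-! ### Generic equality and meromorphic continuation -/

section Generic

variable {E : Type*} [NormedAddCommGroup E] [NormedSpace ℂ E]

theorem exists_ball_analyticOnNhd {p : E → ℂ} {x : E} (hp : AnalyticAt ℂ p x) :
    ∃ r > 0, AnalyticOnNhd ℂ p (Metric.ball x r) :=
  hp.exists_ball_analyticOnNhd

theorem eqOn_ball_of_eventuallyEq {p q : E → ℂ} {x y : E} {r : ℝ}
    (hp : AnalyticOnNhd ℂ p (Metric.ball x r)) (hq : AnalyticOnNhd ℂ q (Metric.ball x r))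
    (hy : y ∈ Metric.ball x r) (h : p =ᶠ[𝓝 y] q) : Set.EqOn p q (Metric.ball x r) := by
  let _ : NormedSpace ℝ E := NormedSpace.restrictScalars ℝ ℂ E
  exact hp.eqOn_of_preconnected_of_eventuallyEq hq (convex_ball x r).isPreconnected hy h

theorem frequently_ne_zero_of_mem_ball {q : E → ℂ} {x y : E} {r : ℝ}
    (hq : AnalyticOnNhd ℂ q (Metric.ball x r)) (h : ∃ᶠ u in 𝓝 x, q u ≠ 0)
    (hy : y ∈ Metric.ball x r) : ∃ᶠ u in 𝓝 y, q u ≠ 0 := by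
  by_contra hc
  simp only [not_frequently, not_not] at hc
  have h0 := eqOn_ball_of_eventuallyEq hq (analyticOnNhd_const (v := (0 : ℂ))) hy hc
  refine h ?_
  filter_upwards [Metric.isOpen_ball.mem_nhds
    (Metric.mem_ball_self (dist_nonneg.trans_lt (Metric.mem_ball.1 hy)))] with u hu
  simpa using h0 hu

theorem eventually_frequently_ne_zero {q : E → ℂ} {x : E} (hq : AnalyticAt ℂ q x)
    (h : ∃ᶠ u in 𝓝 x, q u ≠ 0) : ∀ᶠ y in 𝓝 x, ∃ᶠ u in 𝓝 y, q u ≠ 0 := by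
  obtain ⟨r, hr, hqr⟩ := exists_ball_analyticOnNhd hq
  filter_upwards [Metric.ball_mem_nhds x hr] with y hy
  exact frequently_ne_zero_of_mem_ball hqr h hy

/-- Germs of holomorphic functions have no zero divisors: close to `x` there is a point where `p` is
nonzero, `p` stays nonzero around it, and the germ of `q` there is still nonzero. -/
theorem frequently_mul_ne_zero {p q : E → ℂ} {x : E} (hp : AnalyticAt ℂ p x)
    (hq : AnalyticAt ℂ q x) (h1 : ∃ᶠ u in 𝓝 x, p u ≠ 0) (h2 : ∃ᶠ u in 𝓝 x, q u ≠ 0) :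
    ∃ᶠ u in 𝓝 x, p u * q u ≠ 0 := by
  rw [← frequently_frequently_nhds]
  refine (h1.and_eventually ((eventually_frequently_ne_zero hq h2).and
    hp.eventually_analyticAt)).mono ?_
  rintro y ⟨hy, hqy, hpy⟩
  have hp' : ∀ᶠ u in 𝓝 y, p u ≠ 0 := hpy.continuousAt.eventually_ne hy
  exact (hqy.and_eventually hp').mono fun u hu => mul_ne_zero hu.2 hu.1

/-- The product of `q` and `g₁ - g₂` vanishes near `x`, and the first germ is nonzero, so the second
is zero. -/
theorem eventuallyEq_of_generic {g₁ g₂ q : E → ℂ} {x : E} (h₁ : AnalyticAt ℂ g₁ x)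
    (h₂ : AnalyticAt ℂ g₂ x) (hq : AnalyticAt ℂ q x) (hq0 : ∃ᶠ u in 𝓝 x, q u ≠ 0)
    (h : ∀ᶠ y in 𝓝 x, q y ≠ 0 → g₁ y = g₂ y) : g₁ =ᶠ[𝓝 x] g₂ := by
  by_contra hc
  have h3 : ∃ᶠ u in 𝓝 x, (g₁ - g₂) u ≠ 0 := by
    intro h4
    refine hc ?_
    filter_upwards [h4] with u hu
    simpa [sub_eq_zero] using hu
  refine frequently_mul_ne_zero hq (h₁.sub h₂) hq0 h3 ?_
  filter_upwards [h] with u hu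
  by_cases hqu : q u = 0
  · simp [hqu]
  · simp [hu hqu]

theorem GenericallyEqAt.symm {f g : E → ℂ} {x : E} (h : GenericallyEqAt f g x) :
    GenericallyEqAt g f x := by
  obtain ⟨q, hq, hq0, hqe⟩ := h
  exact ⟨q, hq, hq0, hqe.mono fun y hy h => (hy h).symm⟩

theorem GenericallyEqAt.trans {f g k : E → ℂ} {x : E} (h₁ : GenericallyEqAt f g x)
    (h₂ : GenericallyEqAt g k x) : GenericallyEqAt f k x := by
  obtain ⟨p, hp, hp0, hpe⟩ := h₁
  obtain ⟨q, hq, hq0, hqe⟩ := h₂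
  refine ⟨fun y => p y * q y, hp.mul hq, frequently_mul_ne_zero hp hq hp0 hq0, ?_⟩
  filter_upwards [hpe, hqe] with y h1 h2 h
  exact (h1 (left_ne_zero_of_mul h)).trans (h2 (right_ne_zero_of_mul h))

theorem genericallyEqAt_of_eventuallyEq {f g : E → ℂ} {x : E} (h : f =ᶠ[𝓝 x] g) :
    GenericallyEqAt f g x :=
  ⟨fun _ => 1, analyticAt_const, (Eventually.of_forall fun _ => one_ne_zero).frequently,
    h.mono fun _ hy _ => hy⟩

theorem GenericallyEqAt.eventually {f g : E → ℂ} {x : E} (h : GenericallyEqAt f g x) :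
    ∀ᶠ y in 𝓝 x, GenericallyEqAt f g y := by
  obtain ⟨q, hq, hq0, hqe⟩ := h
  filter_upwards [hq.eventually_analyticAt, eventually_frequently_ne_zero hq hq0,
    hqe.eventually_nhds] with y h1 h2 h3
  exact ⟨q, h1, h2, h3⟩

theorem GenericallyEqAt.eventuallyEq {f g₁ g₂ : E → ℂ} {x : E} (h₁ : GenericallyEqAt f g₁ x)
    (h₂ : GenericallyEqAt f g₂ x) (a₁ : AnalyticAt ℂ g₁ x) (a₂ : AnalyticAt ℂ g₂ x) :
    g₁ =ᶠ[𝓝 x] g₂ := by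
  obtain ⟨q, hq, hq0, hqe⟩ := h₁.symm.trans h₂
  exact eventuallyEq_of_generic a₁ a₂ hq hq0 hqe

/-- This is the closedness half of the identity theorem. Cross-multiplying makes the claim an
equality `p₁ q₂ = p₂ q₁` of holomorphic functions; it holds near one point of a small ball about
`x`, hence on the whole ball. -/
theorem genericallyEqAt_of_frequently {f g : E → ℂ} {x : E} (hf : IsMeromorphicAt f x)
    (hg : IsMeromorphicAt g x) (h : ∃ᶠ y in 𝓝 x, GenericallyEqAt f g y) :
    GenericallyEqAt f g x := by
  obtain ⟨p₁, q₁, hp₁, hq₁, h₁, e₁⟩ := hf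
  obtain ⟨p₂, q₂, hp₂, hq₂, h₂, e₂⟩ := hg
  have a₁ := hp₁.mul hq₂
  have a₂ := hp₂.mul hq₁
  have hev : ∃ᶠ y in 𝓝 x, (p₁ * q₂) =ᶠ[𝓝 y] (p₂ * q₁) := by
    refine (h.and_eventually (((hq₁.eventually_analyticAt.and hq₂.eventually_analyticAt).and
      (a₁.eventually_analyticAt.and a₂.eventually_analyticAt)).and
      (((eventually_frequently_ne_zero hq₁ h₁).and (eventually_frequently_ne_zero hq₂ h₂)).and
      (e₁.eventually_nhds.and e₂.eventually_nhds)))).mono ?_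
    rintro y ⟨⟨q, hq, hq0, hqe⟩, ⟨⟨b₁, b₂⟩, b₃, b₄⟩, ⟨c₁, c₂⟩, d₁, d₂⟩
    refine eventuallyEq_of_generic b₃ b₄ ((b₁.mul b₂).mul hq)
      (frequently_mul_ne_zero (b₁.mul b₂) hq (frequently_mul_ne_zero b₁ b₂ c₁ c₂) hq0) ?_
    filter_upwards [d₁, d₂, hqe] with u k₁ k₂ k₃ hu
    have hu3 : q u ≠ 0 := right_ne_zero_of_mul hu
    have hu1 : q₁ u ≠ 0 := left_ne_zero_of_mul (left_ne_zero_of_mul hu)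
    have hu2 : q₂ u ≠ 0 := right_ne_zero_of_mul (left_ne_zero_of_mul hu)
    have := (k₁ hu1).symm.trans ((k₃ hu3).trans (k₂ hu2))
    rw [div_eq_div_iff hu1 hu2] at this
    simpa using this
  obtain ⟨r₁, hr₁, s₁⟩ := exists_ball_analyticOnNhd a₁
  obtain ⟨r₂, hr₂, s₂⟩ := exists_ball_analyticOnNhd a₂
  have hr : 0 < min r₁ r₂ := lt_min hr₁ hr₂
  obtain ⟨y, hy, hyb⟩ := (hev.and_eventually (Metric.ball_mem_nhds x hr)).exists
  have heq := eqOn_ball_of_eventuallyEq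
    (s₁.mono (Metric.ball_subset_ball (min_le_left r₁ r₂)))
    (s₂.mono (Metric.ball_subset_ball (min_le_right r₁ r₂))) hyb hy
  refine ⟨fun u => q₁ u * q₂ u, hq₁.mul hq₂, frequently_mul_ne_zero hq₁ hq₂ h₁ h₂, ?_⟩
  filter_upwards [e₁, e₂, Metric.ball_mem_nhds x hr] with u k₁ k₂ hu hne
  have hu1 : q₁ u ≠ 0 := left_ne_zero_of_mul hne
  have hu2 : q₂ u ≠ 0 := right_ne_zero_of_mul hne
  rw [k₁ hu1, k₂ hu2, div_eq_div_iff hu1 hu2]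
  simpa using heq hu

/-- The identity theorem for meromorphic functions. -/
theorem genericallyEqAt_of_isPreconnected {f g : E → ℂ} {U : Set E} (hU : IsPreconnected U)
    (hf : ∀ x ∈ U, IsMeromorphicAt f x) (hg : ∀ x ∈ U, IsMeromorphicAt g x) {x₀ : E}
    (hx₀ : x₀ ∈ U) (h₀ : GenericallyEqAt f g x₀) : ∀ x ∈ U, GenericallyEqAt f g x := by
  -- The locus of generic equality is open, and closed relative to `U`.
  refine hU.subset_of_closure_inter_subset (u := {x | GenericallyEqAt f g x}) ?_ ⟨x₀, hx₀, h₀⟩ ?_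
  · exact isOpen_iff_eventually.2 fun x hx => GenericallyEqAt.eventually hx
  · rintro x ⟨hx, hxU⟩
    exact genericallyEqAt_of_frequently (hf x hxU) (hg x hxU) (mem_closure_iff_frequently.1 hx)

open Classical in
/-- `F` with its values at removable singularities corrected. -/
def corrected (F : E → ℂ) (x : E) : ℂ :=
  if h : ∃ g : E → ℂ, AnalyticAt ℂ g x ∧ GenericallyEqAt F g x then h.choose x else F x

/-- The arbitrary choice in `corrected` is harmless: two analytic functions generically equal to `F`
have the same germ. -/
theorem corrected_eq {F g : E → ℂ} {x : E} (hg : AnalyticAt ℂ g x)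
    (h : GenericallyEqAt F g x) : corrected F x = g x := by
  have hex : ∃ g : E → ℂ, AnalyticAt ℂ g x ∧ GenericallyEqAt F g x := ⟨g, hg, h⟩
  rw [corrected, dif_pos hex]
  exact (hex.choose_spec.2.eventuallyEq h hex.choose_spec.1 hg).eq_of_nhds

theorem corrected_eq_self {F : E → ℂ} {x : E} (hF : AnalyticAt ℂ F x) : corrected F x = F x :=
  corrected_eq hF (genericallyEqAt_of_eventuallyEq EventuallyEq.rfl)

theorem corrected_eq_div {F p q : E → ℂ} {x : E} (hp : AnalyticAt ℂ p x)
    (hq : AnalyticAt ℂ q x) (h : ∀ᶠ y in 𝓝 x, q y ≠ 0 → F y = p y / q y) :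
    ∀ᶠ y in 𝓝 x, q y ≠ 0 → corrected F y = p y / q y := by
  filter_upwards [hp.eventually_analyticAt, hq.eventually_analyticAt, h.eventually_nhds]
    with y h1 h2 h3 hy
  refine corrected_eq (g := fun u => p u / q u) (h1.div h2 hy) ⟨q, h2, ?_, h3⟩
  exact (h2.continuousAt.eventually_ne hy).frequently

theorem isMeromorphicOn_corrected {F : E → ℂ} {U : Set E}
    (hF : ∀ x ∈ U, IsMeromorphicAt F x) : IsMeromorphicOn (corrected F) U where
  meromorphicAt := by
    intro x hx
    obtain ⟨p, q, hp, hq, hq0, h⟩ := hF x hx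
    exact ⟨p, q, hp, hq, hq0, corrected_eq_div hp hq h⟩
  value_eq := by
    intro x hx g hg hgx
    obtain ⟨p, q, hp, hq, hq0, h⟩ := hF x hx
    refine corrected_eq hg (GenericallyEqAt.trans ⟨q, hq, hq0, ?_⟩ hgx)
    filter_upwards [h, corrected_eq_div hp hq h] with y h1 h2 hy
    rw [h1 hy, h2 hy]

/-- Generic equality with an analytic `G` persists at nearby points, and `value_eq` upgrades it
there to equality of values, including on the zero set of the exceptional denominator. -/
theorem IsMeromorphicOn.eventuallyEq {Z G : E → ℂ} {U : Set E} (hZ : IsMeromorphicOn Z U)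
    (hU : IsOpen U) {x : E} (hx : x ∈ U) (hG : AnalyticAt ℂ G x) (h : GenericallyEqAt Z G x) :
    Z =ᶠ[𝓝 x] G := by
  filter_upwards [hU.mem_nhds hx, hG.eventually_analyticAt, h.eventually] with y h1 h2 h3
  exact hZ.value_eq y h1 G h2 h3

end Generic

/-! ### The regularized Beta operator -/

section Beta

open MeasureTheory Set

/-- `g` is holomorphic near the segment from `0` to `t`. -/
def AnalyticOnSegment (g : ℂ → ℂ) (t : ℂ) : Prop :=
  ∀ v ∈ Icc (0 : ℝ) 1, AnalyticAt ℂ g (v * t)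

theorem AnalyticOnSegment.deriv {g : ℂ → ℂ} {t : ℂ} (h : AnalyticOnSegment g t) :
    AnalyticOnSegment (deriv g) t := fun v hv => (h v hv).deriv

/-- The unnormalized Beta integral of `g` on the segment from `0` to `t`. -/
def betaInt (s b : ℂ) (g : ℂ → ℂ) (t : ℂ) : ℂ :=
  ∫ v in (0 : ℝ)..1, (1 - v : ℂ) ^ (s - 1) * (v : ℂ) ^ (b - 1) * g (v * t)

theorem intervalIntegrable_betaWeight {s b : ℂ} (hs : 0 < s.re) (hb : 0 < b.re) :
    IntervalIntegrable (fun v : ℝ => (1 - v : ℂ) ^ (s - 1) * (v : ℂ) ^ (b - 1)) volume 0 1 := by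
  refine (Complex.betaIntegral_convergent hb hs).congr ?_
  exact fun v _ => mul_comm _ _

theorem AnalyticOnSegment.continuousOn {g : ℂ → ℂ} {t : ℂ} (h : AnalyticOnSegment g t) :
    ContinuousOn (fun v : ℝ => g (v * t)) (Icc 0 1) := fun v hv =>
  (ContinuousAt.comp (f := fun v : ℝ => (v : ℂ) * t) (h v hv).continuousAt
    (by fun_prop)).continuousWithinAt

theorem intervalIntegrable_betaInt {s b : ℂ} {g : ℂ → ℂ} {t : ℂ} (hs : 0 < s.re)
    (hb : 0 < b.re) (hg : AnalyticOnSegment g t) :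
    IntervalIntegrable (fun v : ℝ => (1 - v : ℂ) ^ (s - 1) * (v : ℂ) ^ (b - 1) * g (v * t))
      volume 0 1 := by
  refine (intervalIntegrable_betaWeight hs hb).mul_continuousOn ?_
  rw [uIcc_of_le zero_le_one]
  exact hg.continuousOn

theorem integral_congr_Ioo {f g : ℝ → ℂ} (h : ∀ v ∈ Ioo (0 : ℝ) 1, f v = g v) :
    ∫ v in (0 : ℝ)..1, f v = ∫ v in (0 : ℝ)..1, g v := by
  rw [intervalIntegral.integral_of_le zero_le_one, intervalIntegral.integral_of_le zero_le_one,
    integral_Ioc_eq_integral_Ioo, integral_Ioc_eq_integral_Ioo]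
  exact setIntegral_congr_fun measurableSet_Ioo h

/-- Insert 1 = (1 - v) + v under the integral. -/
theorem betaInt_split {s b : ℂ} {g : ℂ → ℂ} {t : ℂ} (hs : 0 < s.re)
    (hb : 0 < b.re) (hg : AnalyticOnSegment g t) :
    betaInt s b g t = betaInt (s + 1) b g t + betaInt s (b + 1) g t := by
  have hs' : 0 < (s + 1).re := by simp; linarith
  have hb' : 0 < (b + 1).re := by simp; linarith
  rw [betaInt, betaInt, betaInt, ← intervalIntegral.integral_add
    (intervalIntegrable_betaInt hs' hb hg) (intervalIntegrable_betaInt hs hb' hg)]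
  refine integral_congr_Ioo fun v hv => ?_
  have h1 : (v : ℂ) ≠ 0 := by exact_mod_cast hv.1.ne'
  have h2 : (1 - v : ℂ) ≠ 0 := by exact_mod_cast (sub_pos.2 hv.2).ne'
  have e1 : (1 - v : ℂ) ^ (s + 1 - 1) = (1 - v : ℂ) ^ (s - 1) * (1 - v) := by
    rw [show s + 1 - 1 = (s - 1) + 1 by ring, Complex.cpow_add _ _ h2, Complex.cpow_one]
  have e2 : (v : ℂ) ^ (b + 1 - 1) = (v : ℂ) ^ (b - 1) * v := by
    rw [show b + 1 - 1 = (b - 1) + 1 by ring, Complex.cpow_add _ _ h1, Complex.cpow_one]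
  rw [e1, e2]; ring

theorem hasDerivAt_ofReal_cpow_const' {v : ℝ} (hv : 0 < v) (b : ℂ) :
    HasDerivAt (fun v : ℝ => (v : ℂ) ^ b) (b * (v : ℂ) ^ (b - 1)) v := by
  have h := (Complex.hasStrictDerivAt_cpow_const (x := (v : ℂ)) (c := b)
    (Complex.ofReal_mem_slitPlane.2 hv)).hasDerivAt
  simpa using h.comp_ofReal

theorem hasDerivAt_one_sub_cpow {v : ℝ} (hv : v < 1) (s : ℂ) :
    HasDerivAt (fun v : ℝ => (1 - v : ℂ) ^ s) (-(s * (1 - v : ℂ) ^ (s - 1))) v := by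
  have h := (hasDerivAt_ofReal_cpow_const' (sub_pos.2 hv) s).scomp v
    ((hasDerivAt_id v).const_sub 1)
  refine (h.congr_deriv ?_).congr_of_eventuallyEq (Eventually.of_forall fun u => ?_)
  · simp
  · simp [Function.comp]

theorem continuous_ofReal_cpow_of_re_pos {b : ℂ} (hb : 0 < b.re) :
    Continuous fun v : ℝ => (v : ℂ) ^ b :=
  Complex.continuous_ofReal_cpow_const hb

/-- Integrate the derivative of (1 - v)^s v^b g(v t); both boundary values vanish because the
exponents have positive real part. -/
theorem betaInt_integral_by_parts {s b : ℂ} {g : ℂ → ℂ} {t : ℂ} (hs : 0 < s.re)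
    (hb : 0 < b.re) (hg : AnalyticOnSegment g t) :
    b * betaInt (s + 1) b g t - s * betaInt s (b + 1) g t
      + t * betaInt (s + 1) (b + 1) (deriv g) t = 0 := by
  have hs' : 0 < (s + 1).re := by simp; linarith
  have hb' : 0 < (b + 1).re := by simp; linarith
  have i1 := (intervalIntegrable_betaInt hs' hb hg).const_mul b
  have i2 := (intervalIntegrable_betaInt hs hb' hg).const_mul s
  have i3 := (intervalIntegrable_betaInt hs' hb' hg.deriv).const_mul t
  have hc : Continuous fun v : ℝ => (1 - v : ℂ) ^ s := by
    have := (continuous_ofReal_cpow_of_re_pos hs).comp (continuous_const.sub continuous_id' :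
      Continuous fun v : ℝ => 1 - v)
    simpa [Function.comp_def] using this
  have hftc := intervalIntegral.integral_eq_sub_of_hasDerivAt_of_le zero_le_one
    (f := fun v : ℝ => (1 - v : ℂ) ^ s * (v : ℂ) ^ b * g (v * t))
    (f' := fun v : ℝ => b * ((1 - v : ℂ) ^ (s + 1 - 1) * (v : ℂ) ^ (b - 1) * g (v * t))
      - s * ((1 - v : ℂ) ^ (s - 1) * (v : ℂ) ^ (b + 1 - 1) * g (v * t))
      + t * ((1 - v : ℂ) ^ (s + 1 - 1) * (v : ℂ) ^ (b + 1 - 1) * deriv g (v * t)))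
    ((hc.mul (continuous_ofReal_cpow_of_re_pos hb)).continuousOn.mul hg.continuousOn) ?_
    ((i1.sub i2).add i3)
  · rw [intervalIntegral.integral_add (i1.sub i2) i3, intervalIntegral.integral_sub i1 i2,
      intervalIntegral.integral_const_mul, intervalIntegral.integral_const_mul,
      intervalIntegral.integral_const_mul] at hftc
    have hs0 : s ≠ 0 := fun h => by simp [h] at hs
    have hb0 : b ≠ 0 := fun h => by simp [h] at hb
    simpa [betaInt, Complex.zero_cpow hs0, Complex.zero_cpow hb0] using hftc
  · intro v hv
    have d1 := hasDerivAt_one_sub_cpow hv.2 s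
    have d2 := hasDerivAt_ofReal_cpow_const' hv.1 b
    have d3 : HasDerivAt (fun v : ℝ => g (v * t)) (deriv g (v * t) * t) v := by
      have h1 := (hg v ⟨hv.1.le, hv.2.le⟩).differentiableAt.hasDerivAt
      have h2 : HasDerivAt (fun u : ℂ => u * t) t (v : ℂ) := by
        simpa using (hasDerivAt_id (v : ℂ)).mul_const t
      exact (h1.comp (v : ℂ) h2).comp_ofReal
    refine ((d1.mul d2).mul d3).congr_deriv ?_
    simp only [add_sub_cancel_right, Pi.mul_apply]
    ring

/-- The Beta operator, normalized by Gamma factors, for parameters with positive real part. -/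
def betaBase (s b : ℂ) (g : ℂ → ℂ) (t : ℂ) : ℂ :=
  (Complex.Gamma s)⁻¹ * (Complex.Gamma b)⁻¹ * betaInt s b g t

theorem Gamma_add_one_inv (s : ℂ) :
    (Complex.Gamma s)⁻¹ = s * (Complex.Gamma (s + 1))⁻¹ := by
  simpa using Complex.one_div_Gamma_eq_self_mul_one_div_Gamma_add_one s

theorem betaBase_split {s b : ℂ} {g : ℂ → ℂ} {t : ℂ} (hs : 0 < s.re)
    (hb : 0 < b.re) (hg : AnalyticOnSegment g t) :
    betaBase s b g t = s * betaBase (s + 1) b g t + b * betaBase s (b + 1) g t := by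
  rw [betaBase, betaBase, betaBase, betaInt_split hs hb hg, Gamma_add_one_inv s,
    Gamma_add_one_inv b]
  ring

theorem betaBase_integral_by_parts {s b : ℂ} {g : ℂ → ℂ} {t : ℂ} (hs : 0 < s.re)
    (hb : 0 < b.re) (hg : AnalyticOnSegment g t) :
    betaBase s (b + 1) g t = betaBase (s + 1) b g t + t * betaBase (s + 1) (b + 1) (deriv g) t := by
  rw [betaBase, betaBase, betaBase, Gamma_add_one_inv s, Gamma_add_one_inv b]
  linear_combination -(Complex.Gamma (s + 1))⁻¹ * (Complex.Gamma (b + 1))⁻¹ *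
    betaInt_integral_by_parts hs hb hg

/-- Eliminating one shifted term between the splitting identity and the integration by parts
expresses the operator through larger values of `s` only. The companion identity does the same for
`b`; alternating the two drives the continuation. -/
theorem betaBase_raise_left {s b : ℂ} {g : ℂ → ℂ} {t : ℂ} (hs : 0 < s.re)
    (hb : 0 < b.re) (hg : AnalyticOnSegment g t) :
    betaBase s b g t
      = (s + b) * betaBase (s + 1) b g t + b * (t * betaBase (s + 1) (b + 1) (deriv g) t) := by
  linear_combination betaBase_split hs hb hg + b * betaBase_integral_by_parts hs hb hg

theorem betaBase_raise_right {s b : ℂ} {g : ℂ → ℂ} {t : ℂ} (hs : 0 < s.re)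
    (hb : 0 < b.re) (hg : AnalyticOnSegment g t) :
    betaBase s b g t
      = (s + b) * betaBase s (b + 1) g t - s * (t * betaBase (s + 1) (b + 1) (deriv g) t) := by
  linear_combination betaBase_split hs hb hg - s * betaBase_integral_by_parts hs hb hg

/-- Continuation of `betaBase` to real parts greater than `-N`. -/
def betaLevel : ℕ → ℂ → ℂ → (ℂ → ℂ) → ℂ → ℂ
  | 0, s, b, g, t => betaBase s b g t
  | N + 1, s, b, g, t =>
    -- Raise `s`, then raise `b` in the first resulting term. In every term both exponents have
    -- grown by at least one, so each level extends the domain by a unit.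
    (s + b) * (s + b + 1) * betaLevel N (s + 1) (b + 1) g t
      - (s + b) * (s + 1) * (t * betaLevel N (s + 2) (b + 1) (deriv g) t)
      + b * (t * betaLevel N (s + 1) (b + 1) (deriv g) t)

theorem betaLevel_succ_eq {N : ℕ} {s b : ℂ} {g : ℂ → ℂ} {t : ℂ} (hs : -N < s.re)
    (hb : -N < b.re) (hg : AnalyticOnSegment g t) :
    betaLevel (N + 1) s b g t = betaLevel N s b g t := by
  induction N generalizing s b g with
  | zero =>
    simp only [Nat.cast_zero, neg_zero] at hs hb
    have hs' : 0 < (s + 1).re := by simp; linarith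
    simp only [betaLevel]
    rw [betaBase_raise_left hs hb hg, betaBase_raise_right hs' hb hg]
    ring_nf
  | succ N ih =>
    push_cast at hs hb
    rw [betaLevel, ih (by simp; linarith) (by simp; linarith) hg,
      ih (by simp; linarith) (by simp; linarith) hg.deriv,
      ih (by simp; linarith) (by simp; linarith) hg.deriv]
    rfl

theorem betaLevel_eq_of_le {N M : ℕ} (hNM : N ≤ M) {s b : ℂ} {g : ℂ → ℂ} {t : ℂ}
    (hs : -N < s.re) (hb : -N < b.re) (hg : AnalyticOnSegment g t) :
    betaLevel M s b g t = betaLevel N s b g t := by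
  induction M, hNM using Nat.le_induction with
  | base => rfl
  | succ M hM ih =>
    have : (N : ℝ) ≤ M := by exact_mod_cast hM
    rw [betaLevel_succ_eq (by linarith) (by linarith) hg, ih]

/-- The regularized Beta operator: the continuation of
`(Γ(s) Γ(b))⁻¹ ∫₀¹ (1 - v) ^ (s - 1) v ^ (b - 1) g (v t) dv` to all `s` and `b`. -/
def betaOp (s b : ℂ) (g : ℂ → ℂ) (t : ℂ) : ℂ :=
  betaLevel (⌊max (-s.re) (-b.re)⌋₊ + 1) s b g t

/-- The level in the definition of `betaOp` jumps with the exponents. Since any sufficiently high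
level gives the same value, a single level can be used locally, and analyticity is inherited from
it. -/
theorem betaOp_eq_level {N : ℕ} {s b : ℂ} {g : ℂ → ℂ} {t : ℂ}
    (hs : -N < s.re) (hb : -N < b.re) (hg : AnalyticOnSegment g t) :
    betaOp s b g t = betaLevel N s b g t := by
  have h1 := Nat.lt_floor_add_one (max (-s.re) (-b.re))
  have h2 := (le_max_left (-s.re) (-b.re)).trans_lt h1
  have h3 := (le_max_right (-s.re) (-b.re)).trans_lt h1
  rw [betaOp]
  rcases le_total N (⌊max (-s.re) (-b.re)⌋₊ + 1) with h | h
  · exact betaLevel_eq_of_le h hs hb hg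
  · refine (betaLevel_eq_of_le h ?_ ?_ hg).symm <;> push_cast <;> linarith

theorem betaOp_eq_base {s b : ℂ} {g : ℂ → ℂ} {t : ℂ}
    (hs : 0 < s.re) (hb : 0 < b.re) (hg : AnalyticOnSegment g t) :
    betaOp s b g t = betaBase s b g t := by
  simpa using! betaOp_eq_level (N := 0) (by simpa using hs) (by simpa using hb) hg

end Beta

/-! ### Joint analyticity of the Beta operator in exponents, parameters and argument. -/

section BetaAnalytic

open MeasureTheory Set

variable {P : Type*} [NormedAddCommGroup P] [NormedSpace ℂ P]

theorem AnalyticAt.slice {g : P → ℂ → ℂ} {p : P} {t : ℂ}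
    (h : AnalyticAt ℂ (fun x : P × ℂ => g x.1 x.2) (p, t)) : AnalyticAt ℂ (g p) t :=
  h.comp_of_eq (f := fun u : ℂ => (p, u)) (analyticAt_const.prod analyticAt_id) rfl

/-- The derivative in the last variable is the full derivative in the direction (0, 1). -/
theorem AnalyticAt.deriv_family {g : P → ℂ → ℂ} {p : P} {t : ℂ}
    (h : AnalyticAt ℂ (fun x : P × ℂ => g x.1 x.2) (p, t)) :
    AnalyticAt ℂ (fun x : P × ℂ => deriv (g x.1) x.2) (p, t) := by
  have h1 : AnalyticAt ℂ (fun x : P × ℂ =>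
      fderiv ℂ (fun x : P × ℂ => g x.1 x.2) x ((0 : P), (1 : ℂ))) (p, t) :=
    ((ContinuousLinearMap.apply ℂ ℂ ((0 : P), (1 : ℂ))).analyticAt _).comp h.fderiv
  refine h1.congr ?_
  filter_upwards [h.eventually_analyticAt] with x hx
  have h2 := hx.differentiableAt.hasFDerivAt
  have h3 : HasDerivAt (fun u : ℂ => (x.1, u)) ((0 : P), (1 : ℂ)) x.2 :=
    (hasDerivAt_const _ _).prodMk (hasDerivAt_id _)
  exact (h2.comp_hasDerivAt x.2 h3).deriv.symm

/-- Compactness of [0, 1] turns analyticity at each point of the segment into analyticity with a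
common bound for all nearby segments. -/
theorem eventually_analyticAt_segment {g : P → ℂ → ℂ} {p₀ : P} {t₀ : ℂ}
    (h : ∀ v ∈ Icc (0 : ℝ) 1, AnalyticAt ℂ (fun x : P × ℂ => g x.1 x.2) (p₀, v * t₀)) :
    ∃ C : ℝ, ∀ᶠ x : P × ℂ in 𝓝 (p₀, t₀), ∀ v ∈ Icc (0 : ℝ) 1,
      AnalyticAt ℂ (fun x : P × ℂ => g x.1 x.2) (x.1, v * x.2) ∧ ‖g x.1 (v * x.2)‖ ≤ C := by
  have hc : ContinuousOn (fun v : ℝ => ‖g p₀ (v * t₀)‖) (Icc 0 1) :=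
    (AnalyticOnSegment.continuousOn fun v hv => AnalyticAt.slice (h v hv)).norm
  obtain ⟨C, hC⟩ := isCompact_Icc.bddAbove_image hc
  refine ⟨C + 1, isCompact_Icc.eventually_forall_of_forall_eventually fun v hv => ?_⟩
  have hcont : ContinuousAt (fun y : (P × ℂ) × ℝ => ((y.1.1, (y.2 : ℂ) * y.1.2) : P × ℂ))
      ((p₀, t₀), v) := by fun_prop
  refine (hcont.eventually ((h v hv).eventually_analyticAt)).and ?_
  have h1 := (h v hv).continuousAt.norm.eventually
    (gt_mem_nhds (show ‖g p₀ (v * t₀)‖ < C + 1 from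
      lt_of_le_of_lt (hC ⟨v, hv, rfl⟩) (lt_add_one C)))
  exact (hcont.eventually h1).mono fun y hy => hy.le

theorem integrableOn_betaBound (η C : ℝ) (hη : 0 < η) :
    IntegrableOn (fun v : ℝ => (1 - v) ^ (η - 1) * v ^ (η - 1) * C) (Ioo 0 1) := by
  have h := (intervalIntegrable_betaWeight (s := (η : ℂ)) (b := (η : ℂ)) (by simpa)
    (by simpa)).norm
  rw [intervalIntegrable_iff_integrableOn_Ioo_of_le zero_le_one] at h
  refine IntegrableOn.congr_fun (f := fun v : ℝ =>
    ‖(1 - v : ℂ) ^ ((η : ℂ) - 1) * (v : ℂ) ^ ((η : ℂ) - 1)‖ * C) (h.mul_const C) ?_ measurableSet_Ioo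
  intro v hv
  have h1 : (1 - v : ℂ) = ((1 - v : ℝ) : ℂ) := by push_cast; rfl
  simp only [norm_mul, h1, Complex.norm_cpow_eq_rpow_re_of_pos hv.1,
    Complex.norm_cpow_eq_rpow_re_of_pos (sub_pos.2 hv.2)]
  simp

theorem norm_betaWeight_le {s b : ℂ} {η : ℝ} (hs : η ≤ s.re) (hb : η ≤ b.re) {v : ℝ}
    (hv : v ∈ Ioo (0 : ℝ) 1) :
    ‖(1 - v : ℂ) ^ (s - 1) * (v : ℂ) ^ (b - 1)‖ ≤ (1 - v) ^ (η - 1) * v ^ (η - 1) := by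
  have h1 : (1 - v : ℂ) = ((1 - v : ℝ) : ℂ) := by push_cast; rfl
  rw [norm_mul, h1, Complex.norm_cpow_eq_rpow_re_of_pos hv.1,
    Complex.norm_cpow_eq_rpow_re_of_pos (sub_pos.2 hv.2)]
  have hv0 := hv.1
  have hv1 := sub_pos.2 hv.2
  refine mul_le_mul ?_ ?_ (Real.rpow_nonneg hv0.le _) (Real.rpow_nonneg hv1.le _)
  · exact Real.rpow_le_rpow_of_exponent_ge hv1 (by linarith) (by simpa using hs)
  · exact Real.rpow_le_rpow_of_exponent_ge hv0 hv.2.le (by simpa using hb)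

theorem betaInt_eq_setIntegral (s b : ℂ) (g : ℂ → ℂ) (t : ℂ) :
    betaInt s b g t
      = ∫ v in Ioo (0 : ℝ) 1, (1 - v : ℂ) ^ (s - 1) * (v : ℂ) ^ (b - 1) * g (v * t) := by
  rw [betaInt, intervalIntegral.integral_of_le zero_le_one, integral_Ioc_eq_integral_Ioo]

theorem aestronglyMeasurable_betaIntegrand (s b : ℂ) {g : ℂ → ℂ} {t : ℂ}
    (hg : AnalyticOnSegment g t) :
    AEStronglyMeasurable (fun v : ℝ => (1 - v : ℂ) ^ (s - 1) * (v : ℂ) ^ (b - 1) * g (v * t))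
      (volume.restrict (Ioo 0 1)) := by
  refine ContinuousOn.aestronglyMeasurable ?_ measurableSet_Ioo
  refine ContinuousOn.mul ?_ (hg.continuousOn.mono Ioo_subset_Icc_self)
  exact fun v hv => ((hasDerivAt_one_sub_cpow hv.2 _).continuousAt.mul
    (hasDerivAt_ofReal_cpow_const' hv.1 _).continuousAt).continuousWithinAt

theorem eventually_betaOp_eq_level {N : ℕ} {g : P → ℂ → ℂ} {s b : P → ℂ} {p₀ : P} {t₀ : ℂ}
    (hs : AnalyticAt ℂ s p₀) (hb : AnalyticAt ℂ b p₀) (hs0 : -N < (s p₀).re)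
    (hb0 : -N < (b p₀).re)
    (h : ∀ v ∈ Icc (0 : ℝ) 1, AnalyticAt ℂ (fun x : P × ℂ => g x.1 x.2) (p₀, v * t₀)) :
    ∀ᶠ x : P × ℂ in 𝓝 (p₀, t₀), betaOp (s x.1) (b x.1) (g x.1) x.2
      = betaLevel N (s x.1) (b x.1) (g x.1) x.2 := by
  obtain ⟨C, hC⟩ := eventually_analyticAt_segment h
  have e1 : ∀ᶠ p in 𝓝 p₀, -N < (s p).re ∧ -N < (b p).re :=
    ((Complex.continuous_re.continuousAt.comp hs.continuousAt).eventually
      (lt_mem_nhds hs0)).and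
    ((Complex.continuous_re.continuousAt.comp hb.continuousAt).eventually (lt_mem_nhds hb0))
  filter_upwards [hC, continuous_fst.continuousAt.eventually e1] with x hx hx2
  exact betaOp_eq_level hx2.1 hx2.2 fun v hv => AnalyticAt.slice (hx v hv).1

variable [FiniteDimensional ℂ P]

theorem analyticAt_betaInt {g : P → ℂ → ℂ} {s b : P → ℂ} {p₀ : P} {t₀ : ℂ}
    (hs : AnalyticAt ℂ s p₀) (hb : AnalyticAt ℂ b p₀) (hs0 : 0 < (s p₀).re)
    (hb0 : 0 < (b p₀).re)
    (h : ∀ v ∈ Icc (0 : ℝ) 1, AnalyticAt ℂ (fun x : P × ℂ => g x.1 x.2) (p₀, v * t₀)) :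
    AnalyticAt ℂ (fun x : P × ℂ => betaInt (s x.1) (b x.1) (g x.1) x.2) (p₀, t₀) := by
  simp only [betaInt_eq_setIntegral]
  obtain ⟨C, hC⟩ := eventually_analyticAt_segment h
  -- An `η` strictly below both real parts yields one integrable weight dominating all nearby
  -- exponents.
  obtain ⟨η, hη, hη'⟩ := exists_between (lt_min hs0 hb0)
  have e1 : ∀ᶠ p in 𝓝 p₀, AnalyticAt ℂ s p ∧ AnalyticAt ℂ b p ∧ η < (s p).re ∧ η < (b p).re := by
    refine hs.eventually_analyticAt.and (hb.eventually_analyticAt.and (Eventually.and ?_ ?_))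
    · exact (Complex.continuous_re.continuousAt.comp hs.continuousAt).eventually
        (lt_mem_nhds (hη'.trans_le (min_le_left _ _)))
    · exact (Complex.continuous_re.continuousAt.comp hb.continuousAt).eventually
        (lt_mem_nhds (hη'.trans_le (min_le_right _ _)))
  have e2 : ∀ᶠ x : P × ℂ in 𝓝 (p₀, t₀), AnalyticAt ℂ s x.1 ∧ AnalyticAt ℂ b x.1 ∧
      η < (s x.1).re ∧ η < (b x.1).re :=
    (continuous_fst.continuousAt (x := (p₀, t₀))).eventually e1
  refine analyticAt_integral (hC.and e2) ?_ ?_ ?_ (integrableOn_betaBound η C hη)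
  · intro x hx
    exact aestronglyMeasurable_betaIntegrand _ _ fun v hv => AnalyticAt.slice (hx.1 v hv).1
  · refine (ae_restrict_iff' measurableSet_Ioo).2 (Eventually.of_forall fun v hv => ?_)
    intro x hx
    have h1 : (v : ℂ) ≠ 0 := by exact_mod_cast hv.1.ne'
    have h2 : (1 - v : ℂ) ≠ 0 := by exact_mod_cast (sub_pos.2 hv.2).ne'
    have d1 : DifferentiableAt ℂ (fun x : P × ℂ => s x.1) x :=
      hx.2.1.differentiableAt.comp x differentiableAt_fst
    have d2 : DifferentiableAt ℂ (fun x : P × ℂ => b x.1) x :=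
      hx.2.2.1.differentiableAt.comp x differentiableAt_fst
    have d3 : DifferentiableAt ℂ (fun x : P × ℂ => g x.1 (v * x.2)) x :=
      DifferentiableAt.comp x (g := fun x : P × ℂ => g x.1 x.2)
        (f := fun x : P × ℂ => (x.1, (v : ℂ) * x.2))
        (hx.1 v ⟨hv.1.le, hv.2.le⟩).1.differentiableAt (by fun_prop)
    exact ((((d1.sub_const 1).const_cpow (Or.inl h2)).mul
      ((d2.sub_const 1).const_cpow (Or.inl h1))).mul d3).differentiableWithinAt
  · refine (ae_restrict_iff' measurableSet_Ioo).2 (Eventually.of_forall fun v hv => ?_)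
    intro x hx
    rw [norm_mul]
    have := norm_betaWeight_le hx.2.2.2.1.le hx.2.2.2.2.le hv
    have hw : 0 ≤ (1 - v) ^ (η - 1) * v ^ (η - 1) := (norm_nonneg _).trans this
    exact mul_le_mul this (hx.1 v ⟨hv.1.le, hv.2.le⟩).2 (norm_nonneg _) hw

theorem analyticAt_Gamma_inv (s : ℂ) : AnalyticAt ℂ (fun s => (Complex.Gamma s)⁻¹) s :=
  Complex.differentiable_one_div_Gamma.analyticAt s

theorem analyticAt_betaLevel (N : ℕ) {g : P → ℂ → ℂ} {s b : P → ℂ} {p₀ : P} {t₀ : ℂ}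
    (hs : AnalyticAt ℂ s p₀) (hb : AnalyticAt ℂ b p₀) (hs0 : -N < (s p₀).re)
    (hb0 : -N < (b p₀).re)
    (h : ∀ v ∈ Icc (0 : ℝ) 1, AnalyticAt ℂ (fun x : P × ℂ => g x.1 x.2) (p₀, v * t₀)) :
    AnalyticAt ℂ (fun x : P × ℂ => betaLevel N (s x.1) (b x.1) (g x.1) x.2) (p₀, t₀) := by
  induction N generalizing g s b with
  | zero =>
    simp only [betaLevel, betaBase]
    have hs' : AnalyticAt ℂ (fun x : P × ℂ => s x.1) (p₀, t₀) :=
      hs.comp_of_eq analyticAt_fst rfl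
    have hb' : AnalyticAt ℂ (fun x : P × ℂ => b x.1) (p₀, t₀) :=
      hb.comp_of_eq analyticAt_fst rfl
    refine (((analyticAt_Gamma_inv _).comp hs').mul ((analyticAt_Gamma_inv _).comp hb')).mul ?_
    exact analyticAt_betaInt hs hb (by simpa using hs0) (by simpa using hb0) h
  | succ N ih =>
    push_cast at hs0 hb0
    have hs' : AnalyticAt ℂ (fun x : P × ℂ => s x.1) (p₀, t₀) :=
      hs.comp_of_eq analyticAt_fst rfl
    have hb' : AnalyticAt ℂ (fun x : P × ℂ => b x.1) (p₀, t₀) :=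
      hb.comp_of_eq analyticAt_fst rfl
    have hd : ∀ v ∈ Icc (0 : ℝ) 1,
        AnalyticAt ℂ (fun x : P × ℂ => deriv (g x.1) x.2) (p₀, v * t₀) :=
      fun v hv => AnalyticAt.deriv_family (h v hv)
    have i1 := ih (s := fun p => s p + 1) (b := fun p => b p + 1) (hs.add analyticAt_const)
      (hb.add analyticAt_const) (by simp; linarith) (by simp; linarith) h
    have i2 := ih (s := fun p => s p + 2) (b := fun p => b p + 1) (hs.add analyticAt_const)
      (hb.add analyticAt_const) (by simp; linarith) (by simp; linarith) (g := fun p => deriv (g p)) hd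
    have i3 := ih (s := fun p => s p + 1) (b := fun p => b p + 1) (hs.add analyticAt_const)
      (hb.add analyticAt_const) (by simp; linarith) (by simp; linarith) (g := fun p => deriv (g p)) hd
    simp only [betaLevel]
    have c : ∀ c : ℂ, AnalyticAt ℂ (fun _ : P × ℂ => c) (p₀, t₀) := fun c => analyticAt_const
    exact ((((hs'.add hb').mul ((hs'.add hb').add (c 1))).mul i1).sub
      (((hs'.add hb').mul (hs'.add (c 1))).mul (analyticAt_snd.mul i2))).add
      (hb'.mul (analyticAt_snd.mul i3))

theorem exists_nat_lt_re (z w : ℂ) : ∃ N : ℕ, -(N : ℝ) < z.re ∧ -(N : ℝ) < w.re := by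
  obtain ⟨N, hN⟩ := exists_nat_gt (max (-z.re) (-w.re))
  exact ⟨N, by linarith [le_max_left (-z.re) (-w.re)], by linarith [le_max_right (-z.re) (-w.re)]⟩

theorem analyticAt_betaOp {g : P → ℂ → ℂ} {s b : P → ℂ} {p₀ : P} {t₀ : ℂ}
    (hs : AnalyticAt ℂ s p₀) (hb : AnalyticAt ℂ b p₀)
    (h : ∀ v ∈ Icc (0 : ℝ) 1, AnalyticAt ℂ (fun x : P × ℂ => g x.1 x.2) (p₀, v * t₀)) :
    AnalyticAt ℂ (fun x : P × ℂ => betaOp (s x.1) (b x.1) (g x.1) x.2) (p₀, t₀) := by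
  obtain ⟨N, h1, h2⟩ := exists_nat_lt_re (s p₀) (b p₀)
  exact (analyticAt_betaLevel N hs hb h1 h2 h).congr
    ((eventually_betaOp_eq_level hs hb h1 h2 h).mono fun _ h => h.symm)

end BetaAnalytic

/-! ### Identities for the Beta operator, continued from positive real parts. -/

section BetaIdentities

open MeasureTheory Set

variable {g : ℂ → ℂ} {t : ℂ}

/-- Entire functions of two variables which agree for positive real parts are equal. -/
theorem eq_of_eq_of_re_pos {f₁ f₂ : ℂ → ℂ → ℂ}
    (h₁ : ∀ x : ℂ × ℂ, AnalyticAt ℂ (fun x : ℂ × ℂ => f₁ x.1 x.2) x)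
    (h₂ : ∀ x : ℂ × ℂ, AnalyticAt ℂ (fun x : ℂ × ℂ => f₂ x.1 x.2) x)
    (h : ∀ s b : ℂ, 0 < s.re → 0 < b.re → f₁ s b = f₂ s b) (s b : ℂ) : f₁ s b = f₂ s b := by
  have h1 : AnalyticOnNhd ℂ (fun x : ℂ × ℂ => f₁ x.1 x.2) univ := fun x _ => h₁ x
  have h2 : AnalyticOnNhd ℂ (fun x : ℂ × ℂ => f₂ x.1 x.2) univ := fun x _ => h₂ x
  have hev : (fun x : ℂ × ℂ => f₁ x.1 x.2) =ᶠ[𝓝 ((1, 1) : ℂ × ℂ)] fun x => f₂ x.1 x.2 := by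
    have e1 : ∀ᶠ x : ℂ × ℂ in 𝓝 (1, 1), 0 < x.1.re :=
      ((Complex.continuous_re.comp continuous_fst).tendsto _).eventually
        (lt_mem_nhds (by simp))
    have e2 : ∀ᶠ x : ℂ × ℂ in 𝓝 (1, 1), 0 < x.2.re :=
      ((Complex.continuous_re.comp continuous_snd).tendsto _).eventually
        (lt_mem_nhds (by simp))
    filter_upwards [e1, e2] with x hx1 hx2 using h _ _ hx1 hx2
  exact h1.eqOn_of_preconnected_of_eventuallyEq h2 isPreconnected_univ (mem_univ _) hev
    (mem_univ (s, b))

theorem AnalyticOnSegment.family {P : Type*} [NormedAddCommGroup P] [NormedSpace ℂ P]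
    (hg : AnalyticOnSegment g t) (p : P) : ∀ v ∈ Icc (0 : ℝ) 1,
      AnalyticAt ℂ (fun x : P × ℂ => g x.2) (p, v * t) :=
  fun v hv => (hg v hv).comp_of_eq analyticAt_snd rfl

theorem analyticAt_betaOp_params {P : Type*} [NormedAddCommGroup P] [NormedSpace ℂ P]
    [FiniteDimensional ℂ P] (hg : AnalyticOnSegment g t) {s b : P → ℂ} {p : P}
    (hs : AnalyticAt ℂ s p) (hb : AnalyticAt ℂ b p) :
    AnalyticAt ℂ (fun p => betaOp (s p) (b p) g t) p :=
  (analyticAt_betaOp (g := fun _ => g) hs hb (hg.family p)).comp_of_eq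
    (f := fun p => (p, t)) (analyticAt_id.prod analyticAt_const) rfl

theorem betaOp_split (hg : AnalyticOnSegment g t) (s b : ℂ) :
    betaOp s b g t = s * betaOp (s + 1) b g t + b * betaOp s (b + 1) g t := by
  refine eq_of_eq_of_re_pos (f₁ := fun s b => betaOp s b g t)
    (f₂ := fun s b => s * betaOp (s + 1) b g t + b * betaOp s (b + 1) g t) ?_ ?_ ?_ s b
  · exact fun x => analyticAt_betaOp_params hg analyticAt_fst analyticAt_snd
  · exact fun x => (analyticAt_fst.mul (analyticAt_betaOp_params hg
      (analyticAt_fst.add analyticAt_const) analyticAt_snd)).add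
      (analyticAt_snd.mul (analyticAt_betaOp_params hg analyticAt_fst
      (analyticAt_snd.add analyticAt_const)))
  · intro s b hs hb
    have hs' : 0 < (s + 1).re := by simp; linarith
    have hb' : 0 < (b + 1).re := by simp; linarith
    simp only [betaOp_eq_base, *]
    exact betaBase_split hs hb hg

theorem betaOp_integral_by_parts (hg : AnalyticOnSegment g t) (s b : ℂ) :
    betaOp s (b + 1) g t = betaOp (s + 1) b g t + t * betaOp (s + 1) (b + 1) (deriv g) t := by
  refine eq_of_eq_of_re_pos (f₁ := fun s b => betaOp s (b + 1) g t)
    (f₂ := fun s b => betaOp (s + 1) b g t + t * betaOp (s + 1) (b + 1) (deriv g) t) ?_ ?_ ?_ s b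
  · exact fun x => analyticAt_betaOp_params hg analyticAt_fst (analyticAt_snd.add analyticAt_const)
  · exact fun x => (analyticAt_betaOp_params hg
      (analyticAt_fst.add analyticAt_const) analyticAt_snd).add
      (analyticAt_const.mul (analyticAt_betaOp_params hg.deriv
      (analyticAt_fst.add analyticAt_const) (analyticAt_snd.add analyticAt_const)))
  · intro s b hs hb
    have hs' : 0 < (s + 1).re := by simp; linarith
    have hb' : 0 < (b + 1).re := by simp; linarith
    have hg' := hg.deriv
    simp only [betaOp_eq_base, *]
    exact betaBase_integral_by_parts hs hb hg

/-- The Beta operator vanishes when both parameters are nonpositive integers. -/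
theorem betaOp_neg_nat (hg : AnalyticOnSegment g t) (l m : ℕ) :
    betaOp (-(l : ℂ)) (-(m : ℂ)) g t = 0 := by
  -- Splitting never leaves the nonpositive quadrant, since a zero exponent kills its own term. When
  -- both exponents are negative, the term with raised `b` is moved by parts to the first exponent
  -- `-l`, where the induction hypothesis covers it for `g` and for its derivative.
  induction l generalizing m g with
  | zero =>
    induction m generalizing g with
    | zero => simpa using betaOp_split hg 0 0
    | succ m ihm =>
      have h := betaOp_split hg (-((0 : ℕ) : ℂ)) (-((m + 1 : ℕ) : ℂ))
      have e : -((m + 1 : ℕ) : ℂ) + 1 = -(m : ℂ) := by push_cast; ring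
      rw [e, ihm hg] at h
      simpa using h
  | succ l ihl =>
    have e1 : -((l + 1 : ℕ) : ℂ) + 1 = -(l : ℂ) := by push_cast; ring
    rcases m with _ | m
    · have h := betaOp_split hg (-((l + 1 : ℕ) : ℂ)) (-((0 : ℕ) : ℂ))
      rw [e1, ihl hg] at h
      simpa using h
    · have e2 : -((m + 1 : ℕ) : ℂ) + 1 = -(m : ℂ) := by push_cast; ring
      have h := betaOp_split hg (-((l + 1 : ℕ) : ℂ)) (-((m + 1 : ℕ) : ℂ))
      have h' := betaOp_integral_by_parts hg (-((l + 1 : ℕ) : ℂ)) (-((m + 1 : ℕ) : ℂ))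
      rw [e1, e2, ihl hg] at h
      rw [e1, e2, ihl hg, ihl hg.deriv] at h'
      rw [h, h']
      ring

/-- At the origin the integral is Euler's Beta function times a constant, and the normalization
leaves the reciprocal of Γ(s + b). -/
theorem betaOp_zero_right (hg : AnalyticAt ℂ g 0) (s b : ℂ) :
    betaOp s b g 0 = (Complex.Gamma (s + b))⁻¹ * g 0 := by
  have hg' : AnalyticOnSegment g 0 := fun v _ => by simpa using hg
  refine eq_of_eq_of_re_pos (f₁ := fun s b => betaOp s b g 0)
    (f₂ := fun s b => (Complex.Gamma (s + b))⁻¹ * g 0) ?_ ?_ ?_ s b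
  · exact fun x => analyticAt_betaOp_params hg' analyticAt_fst analyticAt_snd
  · exact fun x => ((analyticAt_Gamma_inv _).comp (analyticAt_fst.add analyticAt_snd)).mul
      analyticAt_const
  · intro s b hs hb
    simp only [betaOp_eq_base hs hb hg', betaBase, betaInt, mul_zero]
    rw [intervalIntegral.integral_mul_const]
    have h1 : ∫ v in (0 : ℝ)..1, (1 - v : ℂ) ^ (s - 1) * (v : ℂ) ^ (b - 1)
        = Complex.betaIntegral b s := by
      rw [Complex.betaIntegral]
      exact intervalIntegral.integral_congr fun v _ => mul_comm _ _
    rw [h1, Complex.betaIntegral_eq_Gamma_mul_div b s hb hs]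
    have hs1 := Complex.Gamma_ne_zero_of_re_pos hs
    have hb1 := Complex.Gamma_ne_zero_of_re_pos hb
    rw [add_comm b s]
    field_simp

/-- Differentiating g(v t) in `t` produces a factor v, which raises `b` by one; the factor `b` comes
from renormalizing Γ(b)⁻¹. -/
theorem hasDerivAt_betaBase {s b : ℂ} (hs : 0 < s.re) (hb : 0 < b.re)
    (hg : AnalyticOnSegment g t) :
    HasDerivAt (betaBase s b g) (b * betaBase s (b + 1) (deriv g) t) t := by
  obtain ⟨C, hC⟩ := eventually_analyticAt_segment (g := fun _ : ℂ => g) (hg.family (0 : ℂ))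
  have hC' := (show ContinuousAt (fun u : ℂ => ((0 : ℂ), u)) t by fun_prop).eventually hC
  obtain ⟨η, hη, hη'⟩ := exists_between (lt_min hs hb)
  have h := hasDerivAt_integral_of_dominated_holomorphic (μ := volume.restrict (Ioo (0 : ℝ) 1))
    (F := fun v u => (1 - v : ℂ) ^ (s - 1) * (v : ℂ) ^ (b - 1) * g (v * u)) hC'
    (bound := fun v => (1 - v) ^ (η - 1) * v ^ (η - 1) * C) ?_ ?_ ?_
    (integrableOn_betaBound η C hη)
  · have h2 := h.const_mul ((Complex.Gamma s)⁻¹ * (Complex.Gamma b)⁻¹)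
    have e : betaBase s b g = fun u => (Complex.Gamma s)⁻¹ * (Complex.Gamma b)⁻¹ *
        ∫ v in Ioo (0 : ℝ) 1, (1 - v : ℂ) ^ (s - 1) * (v : ℂ) ^ (b - 1) * g (v * u) := by
      ext u; rw [betaBase, betaInt_eq_setIntegral]
    rw [e]
    refine h2.congr_deriv ?_
    rw [betaBase, betaInt_eq_setIntegral, Gamma_add_one_inv b]
    have e3 : ∫ v in Ioo (0 : ℝ) 1, deriv (fun u => (1 - v : ℂ) ^ (s - 1) * (v : ℂ) ^ (b - 1) *
          g (v * u)) t
        = ∫ v in Ioo (0 : ℝ) 1, (1 - v : ℂ) ^ (s - 1) * (v : ℂ) ^ (b + 1 - 1) *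
          deriv g (v * t) := by
      refine setIntegral_congr_fun measurableSet_Ioo fun v hv => ?_
      have h1 : (v : ℂ) ≠ 0 := by exact_mod_cast hv.1.ne'
      have d1 := (hg v ⟨hv.1.le, hv.2.le⟩).differentiableAt.hasDerivAt
      have d2 : HasDerivAt (fun u : ℂ => (v : ℂ) * u) v t := by
        simpa using (hasDerivAt_id t).const_mul (v : ℂ)
      have d3 := ((d1.comp t d2).const_mul ((1 - v : ℂ) ^ (s - 1) * (v : ℂ) ^ (b - 1))).deriv
      refine d3.trans ?_
      rw [show b + 1 - 1 = (b - 1) + 1 by ring, Complex.cpow_add _ _ h1, Complex.cpow_one]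
      ring
    rw [e3]; ring
  · intro u hu
    exact aestronglyMeasurable_betaIntegrand _ _
      fun v hv => AnalyticAt.slice (g := fun _ : ℂ => g) (hu v hv).1
  · refine (ae_restrict_iff' measurableSet_Ioo).2 (Eventually.of_forall fun v hv => ?_)
    intro u hu
    have d1 := (AnalyticAt.slice (g := fun _ : ℂ => g) (hu v ⟨hv.1.le, hv.2.le⟩).1).differentiableAt
    have d2 : DifferentiableAt ℂ (fun u : ℂ => g (v * u)) u :=
      DifferentiableAt.comp u (f := fun u : ℂ => (v : ℂ) * u) d1 (by fun_prop)
    exact (d2.const_mul _).differentiableWithinAt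
  · refine (ae_restrict_iff' measurableSet_Ioo).2 (Eventually.of_forall fun v hv => ?_)
    intro u hu
    rw [norm_mul]
    have := norm_betaWeight_le (hη'.trans_le (min_le_left _ _)).le
      (hη'.trans_le (min_le_right _ _)).le hv
    exact mul_le_mul this (hu v ⟨hv.1.le, hv.2.le⟩).2 (norm_nonneg _) ((norm_nonneg _).trans this)

theorem AnalyticOnSegment.eventually (hg : AnalyticOnSegment g t) :
    ∀ᶠ u in 𝓝 t, AnalyticOnSegment g u := by
  obtain ⟨C, hC⟩ := eventually_analyticAt_segment (g := fun _ : ℂ => g) (hg.family (0 : ℂ))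
  filter_upwards [(show ContinuousAt (fun u : ℂ => ((0 : ℂ), u)) t by fun_prop).eventually hC]
    with u hu
  exact fun v hv => AnalyticAt.slice (g := fun _ : ℂ => g) (hu v hv).1

theorem AnalyticOnSegment.analyticAt_betaOp (hg : AnalyticOnSegment g t) (s b : ℂ) :
    AnalyticAt ℂ (betaOp s b g) t :=
  AnalyticAt.slice (g := fun _ : ℂ => betaOp s b g) (p := 0)
    (HurwitzLerch.analyticAt_betaOp (s := fun _ => s) (b := fun _ => b) (g := fun _ => g)
      analyticAt_const analyticAt_const (hg.family (0 : ℂ)))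

theorem deriv_betaOp (hg : AnalyticOnSegment g t) (s b : ℂ) :
    deriv (betaOp s b g) t = b * betaOp s (b + 1) (deriv g) t := by
  refine eq_of_eq_of_re_pos (f₁ := fun s b => deriv (betaOp s b g) t)
    (f₂ := fun s b => b * betaOp s (b + 1) (deriv g) t) ?_ ?_ ?_ s b
  · intro x
    exact (AnalyticAt.deriv_family (g := fun x : ℂ × ℂ => betaOp x.1 x.2 g)
      (HurwitzLerch.analyticAt_betaOp (g := fun _ : ℂ × ℂ => g) analyticAt_fst analyticAt_snd
        (hg.family x))).comp_of_eq (f := fun x => (x, t))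
        (analyticAt_id.prod analyticAt_const) rfl
  · exact fun x => analyticAt_snd.mul (analyticAt_betaOp_params hg.deriv analyticAt_fst
      (analyticAt_snd.add analyticAt_const))
  · intro s b hs hb
    have hb' : 0 < (b + 1).re := by simp; linarith
    simp only [betaOp_eq_base hs hb' hg.deriv]
    refine HasDerivAt.deriv ?_
    refine (hasDerivAt_betaBase hs hb hg).congr_of_eventuallyEq ?_
    filter_upwards [hg.eventually] with u hu using betaOp_eq_base hs hb hu

/-- The weight (1 - v)^(s-1) / Γ(s) becomes a point mass at v = 1 when s = 0. Concretely, splitting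
and integrating by parts at s = 0 leave exponents (1, b) and (1, b + 1), where the claim is the
fundamental theorem of calculus for v^b g(v t). -/
theorem betaOp_zero_left (hg : AnalyticOnSegment g t) (b : ℂ) :
    betaOp 0 b g t = (Complex.Gamma b)⁻¹ * g t := by
  refine eq_of_eq_of_re_pos (f₁ := fun _ b => betaOp 0 b g t)
    (f₂ := fun _ b => (Complex.Gamma b)⁻¹ * g t) ?_ ?_ ?_ 0 b
  · exact fun x => analyticAt_betaOp_params hg analyticAt_const analyticAt_snd
  · exact fun x => ((analyticAt_Gamma_inv _).comp analyticAt_snd).mul analyticAt_const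
  · intro _ b _ hb
    have hb' : 0 < (b + 1).re := by simp; linarith
    have h1 := betaOp_split hg 0 b
    have h2 := betaOp_integral_by_parts hg 0 b
    simp only [zero_mul, zero_add] at h1 h2
    have i1 := (intervalIntegrable_betaInt (s := 1) (by simp) hb hg).const_mul b
    have i2 := (intervalIntegrable_betaInt (s := 1) (by simp) hb' hg.deriv).const_mul t
    have hftc := intervalIntegral.integral_eq_sub_of_hasDerivAt_of_le zero_le_one
      (f := fun v : ℝ => (v : ℂ) ^ b * g (v * t))
      (f' := fun v : ℝ => b * ((1 - v : ℂ) ^ (1 - 1 : ℂ) * (v : ℂ) ^ (b - 1) * g (v * t))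
        + t * ((1 - v : ℂ) ^ (1 - 1 : ℂ) * (v : ℂ) ^ (b + 1 - 1) * deriv g (v * t)))
      ((continuous_ofReal_cpow_of_re_pos hb).continuousOn.mul hg.continuousOn) ?_ (i1.add i2)
    · rw [intervalIntegral.integral_add i1 i2, intervalIntegral.integral_const_mul,
        intervalIntegral.integral_const_mul] at hftc
      have hb0 : b ≠ 0 := fun h => by simp [h] at hb
      change b * betaInt 1 b g t + t * betaInt 1 (b + 1) (deriv g) t = _ at hftc
      simp only [Complex.ofReal_one, Complex.one_cpow, Complex.ofReal_zero,
        Complex.zero_cpow hb0, one_mul, zero_mul, sub_zero] at hftc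
      have hG := Gamma_add_one_inv b
      simp only [h1, h2, betaOp_eq_base (s := 1) (by simp) hb hg,
        betaOp_eq_base (s := 1) (by simp) hb' hg.deriv, betaBase, Complex.Gamma_one, hG, ← hftc]
      ring
    · intro v hv
      have d2 := hasDerivAt_ofReal_cpow_const' hv.1 b
      have d3 : HasDerivAt (fun v : ℝ => g (v * t)) (deriv g (v * t) * t) v := by
        have h1 := (hg v ⟨hv.1.le, hv.2.le⟩).differentiableAt.hasDerivAt
        have h2 : HasDerivAt (fun u : ℂ => u * t) t (v : ℂ) := by
          simpa using (hasDerivAt_id (v : ℂ)).mul_const t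
        exact (h1.comp (v : ℂ) h2).comp_ofReal
      refine (d2.mul d3).congr_deriv ?_
      simp
      ring

/-- The distribution v^(b-1) / Γ(b) at b = -N is the N-th derivative of the point mass at 0. In the
induction, integration by parts at s = 0 has a left side proportional to 1/Γ(-N) = 0, so lowering
`b` by one costs a sign and a derivative. -/
theorem betaOp_one_neg_nat {g : ℂ → ℂ} (hg : AnalyticOnSegment g 1) (N : ℕ) :
    betaOp 1 (-(N : ℂ)) g 1 = (-1) ^ N * iteratedDeriv N g 0 := by
  induction N generalizing g with
  | zero =>
    have h2 := betaOp_integral_by_parts hg 0 0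
    rw [zero_add, betaOp_zero_left hg, betaOp_eq_base (s := 1) (by simp) (by simp) hg.deriv,
      betaBase, betaInt] at h2
    have h3 : ∫ v in (0 : ℝ)..1, (1 - v : ℂ) ^ ((1 : ℂ) - 1) * (v : ℂ) ^ ((1 : ℂ) - 1) *
        deriv g (v * 1) = g 1 - g 0 := by
      have hd : ∀ v ∈ Set.uIcc (0 : ℝ) 1, HasDerivAt (fun v : ℝ => g v) (deriv g v) v := by
        intro v hv
        rw [uIcc_of_le zero_le_one] at hv
        have := (hg v hv).differentiableAt.hasDerivAt
        rw [mul_one] at this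
        exact this.comp_ofReal
      have := intervalIntegral.integral_eq_sub_of_hasDerivAt hd (by
        refine ContinuousOn.intervalIntegrable ?_
        rw [uIcc_of_le zero_le_one]
        simpa using hg.deriv.continuousOn)
      simpa using this
    rw [h3] at h2
    simp only [Complex.Gamma_one] at h2
    simp only [Nat.cast_zero, neg_zero, pow_zero, iteratedDeriv_zero, one_mul]
    linear_combination -h2
  | succ N ih =>
    have h := betaOp_integral_by_parts hg 0 (-((N + 1 : ℕ) : ℂ))
    have e : -((N + 1 : ℕ) : ℂ) + 1 = -(N : ℂ) := by push_cast; ring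
    rw [zero_add, e, betaOp_zero_left hg, ih hg.deriv, Complex.Gamma_neg_nat_eq_zero,
      ← iteratedDeriv_succ'] at h
    rw [pow_succ]
    linear_combination -h

end BetaIdentities

/-! ### Families of functions of controlled growth near the half-line -/

section Tame

open Set

/-- The open `δ`-neighbourhood of `[0, ∞)` in `ℂ`. -/
def strip (δ : ℝ) : Set ℂ := {t | ∃ x : ℝ, 0 ≤ x ∧ ‖t - x‖ < δ}

theorem isOpen_strip (δ : ℝ) : IsOpen (strip δ) := by
  have : strip δ = ⋃ x ∈ Ici (0 : ℝ), Metric.ball (x : ℂ) δ := by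
    ext t
    simp [strip, dist_eq_norm]
  rw [this]
  exact isOpen_biUnion fun _ _ => Metric.isOpen_ball

theorem strip_mono {δ δ' : ℝ} (h : δ ≤ δ') : strip δ ⊆ strip δ' :=
  fun _ ⟨x, hx, hx'⟩ => ⟨x, hx, hx'.trans_le h⟩

theorem ofReal_mem_strip {δ x : ℝ} (hδ : 0 < δ) (hx : 0 ≤ x) : (x : ℂ) ∈ strip δ :=
  ⟨x, hx, by simpa⟩

theorem mul_mem_strip {δ v : ℝ} {t : ℂ} (ht : t ∈ strip δ) (hv : v ∈ Icc (0 : ℝ) 1) :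
    (v : ℂ) * t ∈ strip δ := by
  obtain ⟨x, hx, hxt⟩ := ht
  refine ⟨v * x, mul_nonneg hv.1 hx, ?_⟩
  have : (v : ℂ) * t - ((v * x : ℝ) : ℂ) = v * (t - x) := by push_cast; ring
  rw [this, norm_mul, Complex.norm_real, Real.norm_eq_abs, abs_of_nonneg hv.1]
  exact (mul_le_of_le_one_left (norm_nonneg _) hv.2).trans_lt hxt

theorem neg_lt_re_of_mem_strip {δ : ℝ} {t : ℂ} (ht : t ∈ strip δ) : -δ < t.re := by
  obtain ⟨x, hx, hxt⟩ := ht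
  have := (abs_le.1 (Complex.abs_re_le_norm (t - x))).1
  simp at this
  linarith

theorem abs_im_lt_of_mem_strip {δ : ℝ} {t : ℂ} (ht : t ∈ strip δ) : |t.im| < δ := by
  obtain ⟨x, hx, hxt⟩ := ht
  have := Complex.abs_im_le_norm (t - x)
  simp at this
  linarith

theorem mem_strip_of_dist_le {δ : ℝ} {t u : ℂ} (ht : t ∈ strip (δ / 2)) (hu : ‖u - t‖ ≤ δ / 2) :
    u ∈ strip δ := by
  obtain ⟨x, hx, hxt⟩ := ht
  refine ⟨x, hx, ?_⟩
  calc ‖u - x‖ = ‖(u - t) + (t - x)‖ := by ring_nf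
    _ ≤ ‖u - t‖ + ‖t - x‖ := norm_add_le _ _
    _ < δ := by linarith

variable {P : Type*} [NormedAddCommGroup P] [NormedSpace ℂ P]

/-- Near the parameter `p₀` the functions `g p` are holomorphic in a fixed neighbourhood of
`[0, ∞)`, jointly in `p`, and grow at most like a power of `t` times `exp (ρ t)`. -/
def TameAt (ρ : ℝ) (g : P → ℂ → ℂ) (p₀ : P) : Prop :=
  ∃ δ > 0, ∃ (C : ℝ) (N : ℕ), ∀ᶠ p in 𝓝 p₀, ∀ t ∈ strip δ,
    AnalyticAt ℂ (fun x : P × ℂ => g x.1 x.2) (p, t) ∧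
      ‖g p t‖ ≤ C * (1 + ‖t‖) ^ N * Real.exp (ρ * t.re)

variable {ρ ρ' : ℝ} {f g : P → ℂ → ℂ} {p₀ : P}

theorem TameAt.mono (h : TameAt ρ g p₀) (hρ : ρ ≤ ρ') : TameAt ρ' g p₀ := by
  obtain ⟨δ, hδ, C, N, h⟩ := h
  -- Points of the strip may have real part down to `-δ`, where the larger rate gives the smaller
  -- exponential; this is the constant that compensates.
  refine ⟨δ, hδ, |C| * Real.exp ((ρ' - ρ) * δ), N, h.mono fun p hp t ht => ⟨(hp t ht).1, ?_⟩⟩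
  refine (hp t ht).2.trans ?_
  have h1 := neg_lt_re_of_mem_strip ht
  have h2 : Real.exp (ρ * t.re) ≤ Real.exp ((ρ' - ρ) * δ) * Real.exp (ρ' * t.re) := by
    rw [← Real.exp_add, Real.exp_le_exp]
    nlinarith
  calc C * (1 + ‖t‖) ^ N * Real.exp (ρ * t.re)
      ≤ |C| * (1 + ‖t‖) ^ N * (Real.exp ((ρ' - ρ) * δ) * Real.exp (ρ' * t.re)) := by
        gcongr
        exact le_abs_self C
    _ = _ := by ring

theorem TameAt.mul (hf : TameAt ρ f p₀) (hg : TameAt ρ' g p₀) :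
    TameAt (ρ + ρ') (fun p t => f p t * g p t) p₀ := by
  obtain ⟨δ, hδ, C, N, h⟩ := hf
  obtain ⟨δ', hδ', C', N', h'⟩ := hg
  refine ⟨min δ δ', lt_min hδ hδ', C * C', N + N', ?_⟩
  filter_upwards [h, h'] with p hp hp' t ht
  have h1 := hp t (strip_mono (min_le_left _ _) ht)
  have h2 := hp' t (strip_mono (min_le_right _ _) ht)
  refine ⟨h1.1.mul h2.1, ?_⟩
  rw [norm_mul]
  refine (mul_le_mul h1.2 h2.2 (norm_nonneg _) ((norm_nonneg _).trans h1.2)).trans_eq ?_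
  rw [add_mul, Real.exp_add, pow_add]
  ring

theorem TameAt.add (hf : TameAt ρ f p₀) (hg : TameAt ρ g p₀) :
    TameAt ρ (fun p t => f p t + g p t) p₀ := by
  obtain ⟨δ, hδ, C, N, h⟩ := hf
  obtain ⟨δ', hδ', C', N', h'⟩ := hg
  refine ⟨min δ δ', lt_min hδ hδ', |C| + |C'|, N + N', ?_⟩
  filter_upwards [h, h'] with p hp hp' t ht
  have h1 := hp t (strip_mono (min_le_left _ _) ht)
  have h2 := hp' t (strip_mono (min_le_right _ _) ht)
  refine ⟨h1.1.add h2.1, (norm_add_le _ _).trans ?_⟩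
  have hn : 1 ≤ 1 + ‖t‖ := by linarith [norm_nonneg t]
  have k1 : C * (1 + ‖t‖) ^ N * Real.exp (ρ * t.re)
      ≤ |C| * (1 + ‖t‖) ^ (N + N') * Real.exp (ρ * t.re) := by
    gcongr
    · exact le_abs_self C
    · omega
  have k2 : C' * (1 + ‖t‖) ^ N' * Real.exp (ρ * t.re)
      ≤ |C'| * (1 + ‖t‖) ^ (N + N') * Real.exp (ρ * t.re) := by
    gcongr
    · exact le_abs_self C'
    · omega
  calc _ ≤ _ := add_le_add (h1.2.trans k1) (h2.2.trans k2)
    _ = _ := by ring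

theorem tameAt_param {c : P → ℂ} (hc : AnalyticAt ℂ c p₀) : TameAt 0 (fun p _ => c p) p₀ := by
  refine ⟨1, one_pos, ‖c p₀‖ + 1, 0, ?_⟩
  filter_upwards [hc.eventually_analyticAt,
    hc.continuousAt.norm.eventually (gt_mem_nhds (lt_add_one ‖c p₀‖))] with p h1 h2 t _
  exact ⟨h1.comp_of_eq analyticAt_fst rfl, by simpa using h2.le⟩

theorem tameAt_id : TameAt 0 (fun _ t => t) p₀ :=
  ⟨1, one_pos, 1, 1, Eventually.of_forall fun p t _ => ⟨analyticAt_snd, by simp⟩⟩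

theorem TameAt.param_mul {c : P → ℂ} (hg : TameAt ρ g p₀) (hc : AnalyticAt ℂ c p₀) :
    TameAt ρ (fun p t => c p * g p t) p₀ := by
  simpa using (tameAt_param hc).mul hg

theorem TameAt.id_mul (hg : TameAt ρ g p₀) : TameAt ρ (fun p t => t * g p t) p₀ := by
  simpa using tameAt_id.mul hg

theorem TameAt.congr (hg : TameAt ρ g p₀) {δ : ℝ} (hδ : 0 < δ)
    (h : ∀ᶠ p in 𝓝 p₀, ∀ t ∈ strip δ, f p t = g p t) : TameAt ρ f p₀ := by
  obtain ⟨δ', hδ', C, N, h'⟩ := hg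
  refine ⟨min δ δ', lt_min hδ hδ', C, N, ?_⟩
  filter_upwards [h.eventually_nhds, h'] with p hp hp' t ht
  have ht1 := strip_mono (min_le_left _ _) ht
  have h2 := hp' t (strip_mono (min_le_right _ _) ht)
  rw [hp.self_of_nhds t ht1]
  refine ⟨h2.1.congr ?_, h2.2⟩
  have e1 : ∀ᶠ x : P × ℂ in 𝓝 (p, t), ∀ t ∈ strip δ, f x.1 t = g x.1 t :=
    (continuous_fst.continuousAt (x := (p, t))).eventually hp
  have e2 : ∀ᶠ x : P × ℂ in 𝓝 (p, t), x.2 ∈ strip δ :=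
    (continuous_snd.continuousAt (x := (p, t))).eventually ((isOpen_strip δ).mem_nhds ht1)
  filter_upwards [e1, e2] with x h3 h4 using (h3 _ h4).symm

/-- Cauchy's estimate on discs of radius `δ / 2`, at the price of halving the strip. -/
theorem TameAt.deriv (hg : TameAt ρ g p₀) : TameAt ρ (fun p => deriv (g p)) p₀ := by
  obtain ⟨δ, hδ, C, N, h⟩ := hg
  have hδ2 : 0 < δ / 2 := half_pos hδ
  refine ⟨δ / 2, hδ2, |C| * (1 + δ / 2) ^ N * Real.exp (|ρ| * (δ / 2)) / (δ / 2), N, ?_⟩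
  filter_upwards [h] with p hp t ht
  have hball : ∀ u ∈ Metric.closedBall t (δ / 2), u ∈ strip δ := fun u hu =>
    mem_strip_of_dist_le ht (by simpa [dist_eq_norm] using hu)
  refine ⟨AnalyticAt.deriv_family (hp t (strip_mono (by linarith) ht)).1, ?_⟩
  have key := Complex.norm_deriv_le_of_forall_mem_sphere_norm_le (f := g p) (c := t) hδ2
    (C := |C| * ((1 + δ / 2) * (1 + ‖t‖)) ^ N *
      (Real.exp (|ρ| * (δ / 2)) * Real.exp (ρ * t.re))) ?_ ?_
  · refine key.trans_eq ?_
    rw [mul_pow]; ring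
  · refine DifferentiableOn.diffContOnCl fun u hu => ?_
    exact (AnalyticAt.slice (hp u (hball u
      (Metric.closure_ball_subset_closedBall hu))).1).differentiableAt.differentiableWithinAt
  · intro u hu
    have hu' := Metric.sphere_subset_closedBall hu
    refine (hp u (hball u hu')).2.trans ?_
    rw [Metric.mem_closedBall, dist_eq_norm] at hu'
    have h1 : 1 + ‖u‖ ≤ (1 + δ / 2) * (1 + ‖t‖) := by
      have : ‖u‖ ≤ ‖u - t‖ + ‖t‖ := by simpa using norm_add_le (u - t) t
      nlinarith [norm_nonneg t]
    have h2 : Real.exp (ρ * u.re) ≤ Real.exp (|ρ| * (δ / 2)) * Real.exp (ρ * t.re) := by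
      rw [← Real.exp_add, Real.exp_le_exp]
      have h3 : |u.re - t.re| ≤ δ / 2 := by
        simpa using (Complex.abs_re_le_norm (u - t)).trans hu'
      have h4 : ρ * (u.re - t.re) ≤ |ρ| * (δ / 2) := by
        refine (le_abs_self _).trans ?_
        rw [abs_mul]
        gcongr
      linarith
    gcongr
    exact le_abs_self C

theorem TameAt.segment (hg : TameAt ρ g p₀) : ∃ δ > 0, ∀ᶠ p in 𝓝 p₀, ∀ t ∈ strip δ,
    ∀ v ∈ Icc (0 : ℝ) 1, AnalyticAt ℂ (fun x : P × ℂ => g x.1 x.2) (p, v * t) := by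
  obtain ⟨δ, hδ, C, N, h⟩ := hg
  exact ⟨δ, hδ, h.mono fun p hp t ht v hv => (hp _ (mul_mem_strip ht hv)).1⟩

variable [FiniteDimensional ℂ P]

/-- The segment from 0 to t reaches back to the origin, so decay of `g` at infinity is lost under
the integral. Only nonnegative rates are preserved, whence `hρ`. -/
theorem TameAt.betaBase (hρ : 0 ≤ ρ) (hg : TameAt ρ g p₀) {s b : P → ℂ} (hs : AnalyticAt ℂ s p₀)
    (hb : AnalyticAt ℂ b p₀) (hs0 : 0 < (s p₀).re) (hb0 : 0 < (b p₀).re) :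
    TameAt ρ (fun p => betaBase (s p) (b p) (g p)) p₀ := by
  have hG : AnalyticAt ℂ (fun p => (Complex.Gamma (s p))⁻¹ * (Complex.Gamma (b p))⁻¹) p₀ :=
    ((analyticAt_Gamma_inv _).comp hs).mul ((analyticAt_Gamma_inv _).comp hb)
  suffices h : TameAt ρ (fun p => betaInt (s p) (b p) (g p)) p₀ from h.param_mul hG
  obtain ⟨δ, hδ, C, N, h⟩ := hg
  obtain ⟨η, hη, hη'⟩ := exists_between (lt_min hs0 hb0)
  have e1 : ∀ᶠ p in 𝓝 p₀, AnalyticAt ℂ s p ∧ AnalyticAt ℂ b p ∧ η < (s p).re ∧ η < (b p).re := by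
    refine hs.eventually_analyticAt.and (hb.eventually_analyticAt.and (Eventually.and ?_ ?_))
    · exact (Complex.continuous_re.continuousAt.comp hs.continuousAt).eventually
        (lt_mem_nhds (hη'.trans_le (min_le_left _ _)))
    · exact (Complex.continuous_re.continuousAt.comp hb.continuousAt).eventually
        (lt_mem_nhds (hη'.trans_le (min_le_right _ _)))
  let I : ℝ := ∫ v in Ioo (0 : ℝ) 1, (1 - v) ^ (η - 1) * v ^ (η - 1) * 1
  refine ⟨δ, hδ, I * (|C| * Real.exp (ρ * δ)), N, ?_⟩
  filter_upwards [h, e1] with p hp hp1 t ht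
  refine ⟨analyticAt_betaInt hp1.1 hp1.2.1 (hη.trans hp1.2.2.1) (hη.trans hp1.2.2.2)
    fun v hv => (hp _ (mul_mem_strip ht hv)).1, ?_⟩
  have hle : ∀ v ∈ Ioo (0 : ℝ) 1, ‖(1 - v : ℂ) ^ (s p - 1) * (v : ℂ) ^ (b p - 1) * g p (v * t)‖
      ≤ (1 - v) ^ (η - 1) * v ^ (η - 1) *
        (|C| * Real.exp (ρ * δ) * (1 + ‖t‖) ^ N * Real.exp (ρ * t.re)) := by
    intro v hv
    rw [norm_mul]
    have h1 := norm_betaWeight_le hp1.2.2.1.le hp1.2.2.2.le hv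
    refine mul_le_mul h1 ?_ (norm_nonneg _) ((norm_nonneg _).trans h1)
    refine (hp _ (mul_mem_strip ht ⟨hv.1.le, hv.2.le⟩)).2.trans ?_
    have h2 : ‖(v : ℂ) * t‖ ≤ ‖t‖ := by
      rw [norm_mul, Complex.norm_real, Real.norm_eq_abs, abs_of_pos hv.1]
      exact mul_le_of_le_one_left (norm_nonneg _) hv.2.le
    have h3 : Real.exp (ρ * ((v : ℂ) * t).re) ≤ Real.exp (ρ * δ) * Real.exp (ρ * t.re) := by
      rw [← Real.exp_add, Real.exp_le_exp, ← mul_add]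
      refine mul_le_mul_of_nonneg_left ?_ hρ
      have := neg_lt_re_of_mem_strip ht
      simp only [Complex.re_ofReal_mul]
      nlinarith [hv.1, hv.2]
    calc C * (1 + ‖(v : ℂ) * t‖) ^ N * Real.exp (ρ * ((v : ℂ) * t).re)
        ≤ |C| * (1 + ‖t‖) ^ N * (Real.exp (ρ * δ) * Real.exp (ρ * t.re)) := by
          gcongr
          exact le_abs_self C
      _ = _ := by ring
  rw [betaInt_eq_setIntegral]
  refine (MeasureTheory.norm_integral_le_of_norm_le
    (integrableOn_betaBound η _ hη) ((MeasureTheory.ae_restrict_iff' measurableSet_Ioo).2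
      (Eventually.of_forall hle))).trans_eq ?_
  simp only [I, mul_one]
  rw [MeasureTheory.integral_mul_const]
  ring

theorem TameAt.betaLevel (hρ : 0 ≤ ρ) (M : ℕ) (hg : TameAt ρ g p₀) {s b : P → ℂ}
    (hs : AnalyticAt ℂ s p₀) (hb : AnalyticAt ℂ b p₀) (hs0 : -M < (s p₀).re)
    (hb0 : -M < (b p₀).re) :
    TameAt ρ (fun p => betaLevel M (s p) (b p) (g p)) p₀ := by
  induction M generalizing g s b with
  | zero => exact hg.betaBase hρ hs hb (by simpa using hs0) (by simpa using hb0)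
  | succ M ih =>
    push_cast at hs0 hb0
    have c : ∀ c : ℂ, AnalyticAt ℂ (fun _ : P => c) p₀ := fun c => analyticAt_const
    have i1 := ih hg (s := fun p => s p + 1) (b := fun p => b p + 1) (hs.add (c 1))
      (hb.add (c 1)) (by simp; linarith) (by simp; linarith)
    have i2 := ih hg.deriv (s := fun p => s p + 2) (b := fun p => b p + 1) (hs.add (c 2))
      (hb.add (c 1)) (by simp; linarith) (by simp; linarith)
    have i3 := ih hg.deriv (s := fun p => s p + 1) (b := fun p => b p + 1) (hs.add (c 1))
      (hb.add (c 1)) (by simp; linarith) (by simp; linarith)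
    have j1 := i1.param_mul ((hs.add hb).mul ((hs.add hb).add (c 1)))
    have j2 := i2.id_mul.param_mul ((hs.add hb).mul (hs.add (c 1))).neg
    have j3 := i3.id_mul.param_mul hb
    refine ((j1.add j2).add j3).congr one_pos (Eventually.of_forall fun p t _ => ?_)
    simp only [HurwitzLerch.betaLevel, Pi.add_apply, Pi.mul_apply, Pi.neg_apply]
    ring

theorem TameAt.betaOp (hρ : 0 ≤ ρ) (hg : TameAt ρ g p₀) {s b : P → ℂ}
    (hs : AnalyticAt ℂ s p₀) (hb : AnalyticAt ℂ b p₀) :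
    TameAt ρ (fun p => betaOp (s p) (b p) (g p)) p₀ := by
  obtain ⟨M, h1, h2⟩ := exists_nat_lt_re (s p₀) (b p₀)
  obtain ⟨δ, hδ, h⟩ := hg.segment
  have e1 : ∀ᶠ p in 𝓝 p₀, -M < (s p).re ∧ -M < (b p).re :=
    ((Complex.continuous_re.continuousAt.comp hs.continuousAt).eventually
      (lt_mem_nhds h1)).and
    ((Complex.continuous_re.continuousAt.comp hb.continuousAt).eventually (lt_mem_nhds h2))
  refine (hg.betaLevel hρ M hs hb h1 h2).congr hδ ?_
  filter_upwards [h, e1] with p hp hp1 t ht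
  exact betaOp_eq_level hp1.1 hp1.2 fun v hv => AnalyticAt.slice (hp t ht v hv)

end Tame

/-! ### The kernels and the iterated integral -/

section Kernel

open Set

/-- The function `t / (1 - w exp (-t))`, with its singularity at `t = 0` removed if `w = 1`. -/
def kern (w t : ℂ) : ℂ :=
  if w = 1 then (dslope (fun u : ℂ => 1 - Complex.exp (-u)) 0 t)⁻¹
  else t / (1 - w * Complex.exp (-t))

/-- The kernel `t exp (-a t) / (1 - w exp (-t))`. -/
def ker (a w t : ℂ) : ℂ := Complex.exp (-a * t) * kern w t

/-- At a pole division by zero makes `kern` equal to 0 and the identity fails. The hypothesis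
excludes just the poles, while the removable point w = 1, t = 0 is admitted by its first
alternative. -/
theorem kern_mul (w t : ℂ) (h : kern w t ≠ 0 ∨ w * Complex.exp (-t) ≠ 1) :
    kern w t * (1 - w * Complex.exp (-t)) = t := by
  unfold kern at h ⊢
  split_ifs with hw
  · subst hw
    rw [if_pos rfl] at h
    by_cases ht : t = 0
    · simp [ht]
    · have h2 : dslope (fun u : ℂ => 1 - Complex.exp (-u)) 0 t = t⁻¹ * (1 - Complex.exp (-t)) := by
        rw [dslope_of_ne _ ht, slope_def_field]
        simp [div_eq_inv_mul]
      rw [h2] at h ⊢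
      have h3 : 1 - Complex.exp (-t) ≠ 0 := by
        rcases h with h | h
        · intro h0; simp [h0] at h
        · intro h0; exact h (by linear_combination -h0)
      field_simp
  · rw [if_neg hw] at h
    have h3 : 1 - w * Complex.exp (-t) ≠ 0 := by
      rcases h with h | h
      · intro h0; simp [h0] at h
      · intro h0; exact h (by linear_combination -h0)
    field_simp

theorem analyticAt_dslope_exp (t : ℂ) :
    AnalyticAt ℂ (dslope (fun u : ℂ => 1 - Complex.exp (-u)) 0) t := by
  have h1 : DifferentiableOn ℂ (dslope (fun u : ℂ => 1 - Complex.exp (-u)) 0) univ :=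
    (Complex.differentiableOn_dslope univ_mem).2 (by fun_prop)
  exact h1.analyticAt univ_mem

theorem dslope_exp_zero : dslope (fun u : ℂ => 1 - Complex.exp (-u)) 0 0 = 1 := by
  rw [dslope_same]
  have h1 : HasDerivAt (fun u : ℂ => Complex.exp (-u)) (Complex.exp (-0) * -1) 0 :=
    (hasDerivAt_id (0 : ℂ)).neg.cexp
  have h2 : HasDerivAt (fun u : ℂ => 1 - Complex.exp (-u)) (-(Complex.exp (-0) * -1)) 0 :=
    h1.const_sub 1
  rw [h2.deriv]
  simp

theorem dslope_exp_ne_zero {t : ℂ} (ht : |t.im| < 2 * Real.pi) :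
    dslope (fun u : ℂ => 1 - Complex.exp (-u)) 0 t ≠ 0 := by
  by_cases h0 : t = 0
  · rw [h0, dslope_exp_zero]; exact one_ne_zero
  · rw [dslope_of_ne _ h0, slope_def_field]
    simp only [neg_zero, Complex.exp_zero, sub_self, sub_zero]
    refine div_ne_zero (fun h => ?_) h0
    have h1 : Complex.exp (-t) = 1 := by linear_combination -h
    obtain ⟨n, hn⟩ := Complex.exp_eq_one_iff.1 h1
    have him : t.im = -(n * (2 * Real.pi)) := by
      have := congrArg Complex.im hn
      simp at this
      linarith
    have hre : t.re = 0 := by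
      have := congrArg Complex.re hn
      simpa using this
    have hn0 : n = 0 := by
      by_contra hne
      have h2 : (1 : ℝ) ≤ |(n : ℝ)| := by exact_mod_cast Int.one_le_abs hne
      rw [him, abs_neg, abs_mul, abs_of_pos Real.two_pi_pos] at ht
      nlinarith [Real.two_pi_pos]
    refine h0 (Complex.ext hre ?_)
    rw [him, hn0]; simp

variable {P : Type*} [NormedAddCommGroup P] [NormedSpace ℂ P] {p₀ : P}

/-- For Re t ≥ 1 the denominator is at least 1 - 1/e, so growth is linear. The rest of the unit
strip lies in a compact rectangle that avoids the nonzero multiples of 2πi. -/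
theorem tameAt_kern_one : TameAt 0 (fun _ : P => kern 1) p₀ := by
  have hk : kern 1 = fun t => (dslope (fun u : ℂ => 1 - Complex.exp (-u)) 0 t)⁻¹ := by
    ext t; simp [kern]
  have hπ : (1 : ℝ) < 2 * Real.pi := by linarith [Real.pi_gt_three]
  have han : ∀ t : ℂ, |t.im| ≤ 1 → AnalyticAt ℂ (kern 1) t := by
    intro t ht
    rw [hk]
    exact (analyticAt_dslope_exp t).inv (dslope_exp_ne_zero (ht.trans_lt hπ))
  let K : Set ℂ := Icc (-1 : ℝ) 1 ×ℂ Icc (-1 : ℝ) 1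
  have hK : IsCompact K := isCompact_Icc.reProdIm isCompact_Icc
  obtain ⟨M, hM⟩ := hK.bddAbove_image (f := fun t => ‖kern 1 t‖) fun t ht =>
    (han t (abs_le.2 ht.2)).continuousAt.norm.continuousWithinAt
  let c : ℝ := 1 - Real.exp (-1)
  have hc : 0 < c := by
    have : Real.exp (-1) < Real.exp 0 := Real.exp_lt_exp.2 (by norm_num)
    rw [Real.exp_zero] at this
    simp only [c]; linarith
  refine ⟨1, one_pos, |M| + c⁻¹, 1, Eventually.of_forall fun p t ht => ?_⟩
  have him := (abs_im_lt_of_mem_strip ht).le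
  refine ⟨(han t him).comp_of_eq analyticAt_snd rfl, ?_⟩
  simp only [zero_mul, Real.exp_zero, mul_one, pow_one]
  rcases le_total t.re 1 with h1 | h1
  · have h2 : ‖kern 1 t‖ ≤ M :=
      hM ⟨t, ⟨⟨(neg_lt_re_of_mem_strip ht).le, h1⟩, abs_le.1 him⟩, rfl⟩
    calc ‖kern 1 t‖ ≤ |M| * 1 := by rw [mul_one]; exact h2.trans (le_abs_self M)
      _ ≤ (|M| + c⁻¹) * (1 + ‖t‖) := by
        gcongr
        · linarith [inv_pos.2 hc]
        · linarith [norm_nonneg t]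
  · have h2 : c ≤ ‖1 - 1 * Complex.exp (-t)‖ := by
      have h3 := norm_sub_norm_le (1 : ℂ) (1 * Complex.exp (-t))
      rw [one_mul, Complex.norm_exp, norm_one] at h3
      have h4 : Real.exp (-t).re ≤ Real.exp (-1) := Real.exp_le_exp.2 (by simpa using h1)
      simp only [c]
      rw [one_mul]
      linarith
    have h5 := kern_mul 1 t (Or.inr (by
      intro h; rw [h, sub_self, norm_zero] at h2; linarith))
    have h6 : ‖kern 1 t‖ * c ≤ ‖t‖ := by
      nth_rewrite 2 [← h5]
      rw [norm_mul]
      gcongr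
    have h7 : ‖kern 1 t‖ ≤ c⁻¹ * ‖t‖ := by
      rw [inv_mul_eq_div, le_div_iff₀ hc]; exact h6
    calc ‖kern 1 t‖ ≤ c⁻¹ * ‖t‖ := h7
      _ ≤ (|M| + c⁻¹) * (1 + ‖t‖) := by
        gcongr
        · linarith [abs_nonneg M]
        · linarith

/-- A zero would give w₀ = 1/y with 0 < y ≤ 1, a point of [1, ∞); compactness does the rest. Here y
plays the role of exp(-x) for x ≥ 0. -/
theorem exists_lower_bound_one_sub {w₀ : ℂ} (hw : w₀ ∉ Complex.ofReal '' Ici 1) :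
    ∃ m > 0, ∀ y ∈ Icc (0 : ℝ) 1, m ≤ ‖1 - w₀ * y‖ := by
  obtain ⟨y₀, hy₀, hmin⟩ := (isCompact_Icc (a := (0 : ℝ)) (b := 1)).exists_isMinOn
    ⟨0, by simp⟩ (f := fun y : ℝ => ‖1 - w₀ * y‖) (by fun_prop)
  refine ⟨‖1 - w₀ * y₀‖, norm_pos_iff.2 fun h => hw ?_, fun y hy => hmin hy⟩
  have h1 : w₀ * y₀ = 1 := by linear_combination -h
  have hy0 : y₀ ≠ 0 := fun h0 => by simp [h0] at h1
  have hpos : 0 < y₀ := lt_of_le_of_ne hy₀.1 (Ne.symm hy0)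
  refine ⟨y₀⁻¹, (one_le_inv₀ hpos).2 hy₀.2, ?_⟩
  have : (y₀ : ℂ) ≠ 0 := by exact_mod_cast hy0
  push_cast
  field_simp
  rw [mul_comm, h1]

theorem tameAt_kern {w : P → ℂ} (hw : AnalyticAt ℂ w p₀) (hw0 : w p₀ ∉ Complex.ofReal '' Ici 1) :
    TameAt 0 (fun p => kern (w p)) p₀ := by
  obtain ⟨m, hm, hmin⟩ := exists_lower_bound_one_sub hw0
  have hw1 : w p₀ ≠ 1 := fun h => hw0 ⟨1, by simp, by simp [h]⟩
  -- The quantity w₀ exp(-x) is perturbed by moving w₀, costing at most (m/12)·3, and by moving t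
  -- away from x, costing at most ‖w₀‖·2δ. Each is allowed m/4, so half of the lower bound m
  -- survives.
  obtain ⟨δ, hδ, hδ'⟩ : ∃ δ > 0, δ ≤ 1 ∧ ‖w p₀‖ * (2 * δ) ≤ m / 4 := by
    refine ⟨min 1 (m / 4 / (2 * (‖w p₀‖ + 1))), lt_min one_pos (by positivity),
      min_le_left _ _, ?_⟩
    have h1 : min 1 (m / 4 / (2 * (‖w p₀‖ + 1))) ≤ m / 4 / (2 * (‖w p₀‖ + 1)) := min_le_right _ _
    calc ‖w p₀‖ * (2 * min 1 (m / 4 / (2 * (‖w p₀‖ + 1))))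
        ≤ (‖w p₀‖ + 1) * (2 * (m / 4 / (2 * (‖w p₀‖ + 1)))) := by gcongr; linarith
      _ = m / 4 := by field_simp
  have hev : ∀ᶠ p in 𝓝 p₀, ‖w p - w p₀‖ < m / 12 := by
    have := hw.continuousAt.eventually (Metric.ball_mem_nhds (w p₀) (by positivity : 0 < m / 12))
    simpa [dist_eq_norm] using this
  have hlow : ∀ p, ‖w p - w p₀‖ < m / 12 → ∀ t ∈ strip δ,
      m / 2 ≤ ‖1 - w p * Complex.exp (-t)‖ := by
    rintro p hp t ⟨x, hx, hxt⟩
    have hy : Real.exp (-x) ∈ Icc (0 : ℝ) 1 :=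
      ⟨(Real.exp_pos _).le, Real.exp_le_one_iff.2 (by linarith)⟩
    have h1 := hmin _ hy
    have h2 : ‖Complex.exp (-(t - x)) - 1‖ ≤ 2 * δ := by
      have := Complex.norm_exp_sub_one_le (x := -(t - x)) (by rw [norm_neg]; linarith [hδ'.1])
      rw [norm_neg] at this
      linarith
    have h3 : ‖Complex.exp (-(t - x))‖ ≤ 3 := by
      have := norm_add_le (Complex.exp (-(t - x)) - 1) 1
      rw [sub_add_cancel, norm_one] at this
      linarith [hδ'.1]
    have he : Complex.exp (-t) = (Real.exp (-x) : ℝ) * Complex.exp (-(t - x)) := by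
      push_cast
      rw [← Complex.exp_add]
      congr 1; ring
    have h4 : ‖w p * Complex.exp (-t) - w p₀ * (Real.exp (-x) : ℝ)‖ ≤ m / 2 := by
      have e : w p * Complex.exp (-t) - w p₀ * (Real.exp (-x) : ℝ)
          = (Real.exp (-x) : ℝ) * ((w p - w p₀) * Complex.exp (-(t - x))
            + w p₀ * (Complex.exp (-(t - x)) - 1)) := by
        rw [he]; ring
      rw [e, norm_mul, Complex.norm_real, Real.norm_eq_abs, abs_of_nonneg hy.1]
      refine (mul_le_of_le_one_left (norm_nonneg _) hy.2).trans ((norm_add_le _ _).trans ?_)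
      rw [norm_mul, norm_mul]
      have k1 : ‖w p - w p₀‖ * ‖Complex.exp (-(t - x))‖ ≤ m / 12 * 3 := by gcongr
      have k2 : ‖w p₀‖ * ‖Complex.exp (-(t - x)) - 1‖ ≤ ‖w p₀‖ * (2 * δ) := by gcongr
      linarith [hδ'.2]
    have h5 := norm_sub_norm_le (1 - w p₀ * (Real.exp (-x) : ℝ))
      (w p * Complex.exp (-t) - w p₀ * (Real.exp (-x) : ℝ))
    have e2 : 1 - w p₀ * (Real.exp (-x) : ℝ) - (w p * Complex.exp (-t) - w p₀ * (Real.exp (-x) : ℝ))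
        = 1 - w p * Complex.exp (-t) := by ring
    rw [e2] at h5
    linarith
  have htame : TameAt 0 (fun p t => t / (1 - w p * Complex.exp (-t))) p₀ := by
    refine ⟨δ, hδ, (m / 2)⁻¹, 1, ?_⟩
    filter_upwards [hev, hw.eventually_analyticAt] with p hp hpa t ht
    have hl := hlow p hp t ht
    have hne : 1 - w p * Complex.exp (-t) ≠ 0 := norm_pos_iff.1 (lt_of_lt_of_le (half_pos hm) hl)
    constructor
    · have a1 : AnalyticAt ℂ (fun x : P × ℂ => w x.1) (p, t) := hpa.comp_of_eq analyticAt_fst rfl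
      exact analyticAt_snd.div (analyticAt_const.sub (a1.mul analyticAt_snd.neg.cexp)) hne
    · rw [norm_div, div_eq_inv_mul]
      simp only [zero_mul, Real.exp_zero, mul_one, pow_one]
      gcongr
      linarith
  refine htame.congr one_pos ?_
  filter_upwards [hw.continuousAt.eventually_ne hw1] with p hp t _
  rw [kern, if_neg hp]

theorem tameAt_exp (a : ℂ) : TameAt (-a.re) (fun (_ : P) t => Complex.exp (-a * t)) p₀ := by
  refine ⟨1, one_pos, Real.exp |a.im|, 0, Eventually.of_forall fun p t ht => ⟨?_, ?_⟩⟩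
  · exact (analyticAt_const.mul analyticAt_snd).cexp
  · rw [Complex.norm_exp, pow_zero, mul_one, ← Real.exp_add, Real.exp_le_exp]
    have h1 := abs_im_lt_of_mem_strip ht
    have h2 : a.im * t.im ≤ |a.im| := by
      refine (le_abs_self _).trans ?_
      rw [abs_mul]
      exact mul_le_of_le_one_right (abs_nonneg _) h1.le
    simp
    linarith

/-- The parameter `w` is identically `1` or stays in `ℂ ∖ [1, ∞)`. -/
def AdmissibleAt (w : P → ℂ) (p₀ : P) : Prop :=
  w = (fun _ => 1) ∨ (AnalyticAt ℂ w p₀ ∧ w p₀ ∉ Complex.ofReal '' Ici 1)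

theorem tameAt_ker (a : ℂ) {w : P → ℂ} (hw : AdmissibleAt w p₀) :
    TameAt (-a.re) (fun p => ker a (w p)) p₀ := by
  have hk : TameAt 0 (fun p => kern (w p)) p₀ := by
    rcases hw with rfl | hw
    · exact tameAt_kern_one
    · exact tameAt_kern hw.1 hw.2
  exact ((tameAt_exp a).mul hk).mono (by simp)

end Kernel

/-! ### The iterated kernels and their exponential decay. -/

section Iterated

open Set

/-- The iterated Beta integral of the kernels. -/
def iterKer : (q : ℕ) → (a w : Fin (q + 1) → ℂ) → (σ b : Fin q → ℂ) → ℂ → ℂ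
  | 0, a, w, _, _ => ker (a 0) (w 0)
  | q + 1, a, w, σ, b => fun t =>
    ker (a 0) (w 0) t * betaOp (σ 0) (b 0)
      (iterKer q (fun i => a i.succ) (fun i => w i.succ) (fun i => σ i.succ)
        fun i => b i.succ) t

/-- The exponential rate of decay of `iterKer`: the least real part of a partial sum of `a`. -/
def decayRate : (q : ℕ) → (Fin (q + 1) → ℂ) → ℝ
  | 0, a => (a 0).re
  | q + 1, a => (a 0).re + min 0 (decayRate q fun i => a i.succ)

/-- Positivity of the partial sums of `a` enters here: with `y = 0` it makes the iterated kernel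
decay exponentially. The induction absorbs the real part of `a 0` into `y`. -/
theorem add_decayRate_pos {q : ℕ} {a : Fin (q + 1) → ℂ} {y : ℝ}
    (h : ∀ j, 0 < y + (∑ i ∈ Finset.Iic j, a i).re) : 0 < y + decayRate q a := by
  induction q generalizing y with
  | zero =>
    have := h 0
    rwa [show Finset.Iic (0 : Fin 1) = {0} by rfl, Finset.sum_singleton] at this
  | succ q ih =>
    have h0 : 0 < y + (a 0).re := by
      have := h 0
      rwa [show Finset.Iic (0 : Fin (q + 2)) = {0} by ext i; simp, Finset.sum_singleton] at this
    have h1 : 0 < (y + (a 0).re) + decayRate q fun i => a i.succ := by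
      refine ih fun j => ?_
      have := h j.succ
      rw [show Finset.Iic j.succ = Finset.cons 0 ((Finset.Iic j).map (Fin.succEmb _)) (by simp) by
        ext i; refine Fin.cases ?_ (fun k => ?_) i <;> simp, Finset.sum_cons, Finset.sum_map] at this
      simpa [add_assoc] using this
    rw [decayRate]
    rcases min_choice 0 (decayRate q fun i => a i.succ) with h2 | h2 <;> rw [h2] <;> linarith

variable {P : Type*} [NormedAddCommGroup P] [NormedSpace ℂ P] [FiniteDimensional ℂ P] {p₀ : P}

theorem tameAt_iterKer {q : ℕ} (a : Fin (q + 1) → ℂ) {w : P → Fin (q + 1) → ℂ}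
    {σ b : P → Fin q → ℂ} (hw : ∀ j, AdmissibleAt (fun p => w p j) p₀)
    (hσ : ∀ j, AnalyticAt ℂ (fun p => σ p j) p₀) (hb : ∀ j, AnalyticAt ℂ (fun p => b p j) p₀) :
    TameAt (-decayRate q a) (fun p => iterKer q a (w p) (σ p) (b p)) p₀ := by
  induction q with
  | zero => exact tameAt_ker (a 0) (hw 0)
  | succ q ih =>
    have h1 := ih (fun i => a i.succ) (w := fun p i => w p i.succ) (σ := fun p i => σ p i.succ)
      (b := fun p i => b p i.succ) (fun j => hw j.succ) (fun j => hσ j.succ) fun j => hb j.succ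
    -- The Beta operator needs a nonnegative rate, so the rate is first raised to the maximum with
    -- 0; this is the `min 0` in `decayRate`.
    have h2 := (h1.mono (le_max_right 0 _)).betaOp (le_max_left 0 _) (hσ 0) (hb 0)
    refine ((tameAt_ker (a 0) (hw 0)).mul h2).mono (le_of_eq ?_)
    rw [decayRate, neg_add]
    congr 1
    rw [← neg_zero, max_neg_neg, neg_zero]

end Iterated

/-! ### The regularized Mellin transform -/

section RegMellin

open Set MeasureTheory

theorem exists_pow_mul_exp_le (N : ℕ) {ρ ρ' : ℝ} (h : ρ < ρ') :
    ∃ C : ℝ, ∀ x : ℝ, 0 ≤ x → (1 + x) ^ N * Real.exp (ρ * x) ≤ C * Real.exp (ρ' * x) := by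
  have hc : 0 < ρ' - ρ := sub_pos.2 h
  refine ⟨N ! * ((ρ' - ρ)⁻¹) ^ N * Real.exp (ρ' - ρ), fun x hx => ?_⟩
  have h1 : ((ρ' - ρ) * (1 + x)) ^ N / N ! ≤ Real.exp ((ρ' - ρ) * (1 + x)) :=
    Real.pow_div_factorial_le_exp _ (by positivity) N
  have h2 : (1 + x) ^ N ≤ N ! * ((ρ' - ρ)⁻¹) ^ N * Real.exp ((ρ' - ρ) * (1 + x)) := by
    rw [div_le_iff₀ (by positivity), mul_pow] at h1
    have h3 : (ρ' - ρ)⁻¹ ^ N * ((ρ' - ρ) ^ N * (1 + x) ^ N) = (1 + x) ^ N := by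
      rw [← mul_assoc, ← mul_pow, inv_mul_cancel₀ hc.ne', one_pow, one_mul]
    calc (1 + x) ^ N = (ρ' - ρ)⁻¹ ^ N * ((ρ' - ρ) ^ N * (1 + x) ^ N) := h3.symm
      _ ≤ (ρ' - ρ)⁻¹ ^ N * (Real.exp ((ρ' - ρ) * (1 + x)) * N !) := by gcongr
      _ = _ := by ring
  calc (1 + x) ^ N * Real.exp (ρ * x)
      ≤ N ! * ((ρ' - ρ)⁻¹) ^ N * Real.exp ((ρ' - ρ) * (1 + x)) * Real.exp (ρ * x) := by gcongr
    _ = _ := by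
      rw [mul_assoc, mul_assoc _ (Real.exp (ρ' - ρ)), ← Real.exp_add, ← Real.exp_add]
      ring_nf

variable {P : Type*} [NormedAddCommGroup P] [NormedSpace ℂ P] {p₀ : P} {ρ ρ' : ℝ}
  {g : P → ℂ → ℂ}

theorem TameAt.exists_exp_bound (hg : TameAt ρ g p₀) (h : ρ < ρ') :
    ∃ C : ℝ, ∀ᶠ p in 𝓝 p₀, ∀ x : ℝ, 0 ≤ x →
      AnalyticAt ℂ (fun x : P × ℂ => g x.1 x.2) (p, x) ∧ ‖g p x‖ ≤ C * Real.exp (ρ' * x) := by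
  obtain ⟨δ, hδ, C, N, hC⟩ := hg
  obtain ⟨D, hD⟩ := exists_pow_mul_exp_le N h
  refine ⟨|C| * D, hC.mono fun p hp x hx => ?_⟩
  have h1 := hp x (ofReal_mem_strip hδ hx)
  refine ⟨h1.1, h1.2.trans ?_⟩
  rw [Complex.norm_real, Real.norm_eq_abs, abs_of_nonneg hx, Complex.ofReal_re]
  calc C * (1 + x) ^ N * Real.exp (ρ * x) ≤ |C| * ((1 + x) ^ N * Real.exp (ρ * x)) := by
        rw [mul_assoc]; gcongr; exact le_abs_self C
    _ ≤ |C| * (D * Real.exp (ρ' * x)) := mul_le_mul_of_nonneg_left (hD x hx) (abs_nonneg C)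
    _ = _ := by ring

theorem integrableOn_rpow_mul_exp {c B : ℝ} (hc : c < 0) (hB : 0 < B) (C : ℝ) :
    IntegrableOn (fun x : ℝ => x ^ (B - 1) * (C * Real.exp (c * x))) (Ioi 0) := by
  have := integrableOn_rpow_mul_exp_neg_mul_rpow (s := B - 1) (p := 1) (b := -c) (by linarith)
    one_pos (by linarith)
  simp only [Real.rpow_one, neg_neg] at this
  exact IntegrableOn.congr_fun (f := fun x : ℝ => x ^ (B - 1) * Real.exp (c * x) * C)
    (this.mul_const C) (fun x _ => by ring) measurableSet_Ioi

/-- The Mellin transform of `g`, divided by `Γ(b)`, continued to all `b`. -/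
def regMellin (b : ℂ) (g : ℂ → ℂ) : ℂ :=
  betaOp 1 b g 1 + (Complex.Gamma b)⁻¹ * ∫ t in Ioi (1 : ℝ), (t : ℂ) ^ (b - 1) * g t

theorem continuousOn_cpow_mul {g : ℂ → ℂ} (hg : ∀ x : ℝ, 0 ≤ x → AnalyticAt ℂ g x) (b : ℂ) :
    ContinuousOn (fun t : ℝ => (t : ℂ) ^ (b - 1) * g t) (Ioi 0) := fun t ht =>
  ((hasDerivAt_ofReal_cpow_const' ht _).continuousAt.mul
    (ContinuousAt.comp (f := fun t : ℝ => (t : ℂ)) (hg t (le_of_lt ht)).continuousAt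
      (by fun_prop))).continuousWithinAt

/-- The part over [0, 1] is a Beta operator with first exponent 1, hence entire in `b`; over (1, ∞)
the decay of `g` gives convergence for every `b`. -/
theorem analyticAt_regMellin [FiniteDimensional ℂ P] (hg : TameAt ρ g p₀) (hρ : ρ < 0)
    {b : P → ℂ} (hb : AnalyticAt ℂ b p₀) :
    AnalyticAt ℂ (fun p => regMellin (b p) (g p)) p₀ := by
  obtain ⟨ρ', h1, h2⟩ := exists_between hρ
  obtain ⟨C, hC⟩ := hg.exists_exp_bound h1
  obtain ⟨δ, hδ, hseg⟩ := hg.segment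
  have hone : (1 : ℂ) ∈ strip δ := by simpa using ofReal_mem_strip hδ zero_le_one
  refine AnalyticAt.add ?_ (((analyticAt_Gamma_inv _).comp hb).mul ?_)
  · exact (analyticAt_betaOp (s := fun _ => 1) analyticAt_const hb
      (hseg.self_of_nhds 1 hone)).comp_of_eq (f := fun p => (p, (1 : ℂ)))
      (analyticAt_id.prod analyticAt_const) rfl
  · obtain ⟨B, hB⟩ := exists_gt (max (b p₀).re 0)
    have hB0 : 0 < B := (le_max_right _ _).trans_lt hB
    have e1 : ∀ᶠ p in 𝓝 p₀, AnalyticAt ℂ b p ∧ (b p).re < B :=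
      hb.eventually_analyticAt.and
        ((Complex.continuous_re.continuousAt.comp hb.continuousAt).eventually
          (gt_mem_nhds ((le_max_left _ _).trans_lt hB)))
    refine analyticAt_integral (hC.and e1) ?_ ?_ ?_
      ((integrableOn_rpow_mul_exp h2 hB0 C).mono_set (Ioi_subset_Ioi zero_le_one))
    · intro p hp
      refine ContinuousOn.aestronglyMeasurable ?_ measurableSet_Ioi
      exact (continuousOn_cpow_mul (fun x hx => AnalyticAt.slice (hp.1 x hx).1) _).mono
        (Ioi_subset_Ioi zero_le_one)
    · refine (ae_restrict_iff' measurableSet_Ioi).2 (Eventually.of_forall fun t ht p hp => ?_)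
      have ht0 : (0 : ℝ) < t := zero_lt_one.trans ht
      have d1 : DifferentiableAt ℂ (fun p => g p t) p :=
        ((hp.1 t ht0.le).1.comp_of_eq (f := fun p => (p, (t : ℂ)))
          (analyticAt_id.prod analyticAt_const) rfl).differentiableAt
      refine DifferentiableAt.differentiableWithinAt ?_
      exact ((hp.2.1.differentiableAt.sub_const 1).const_cpow
        (Or.inl (by exact_mod_cast ht0.ne'))).mul d1
    · refine (ae_restrict_iff' measurableSet_Ioi).2 (Eventually.of_forall fun t ht p hp => ?_)
      have ht1 : (1 : ℝ) < t := ht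
      have ht0 : (0 : ℝ) < t := zero_lt_one.trans ht
      rw [norm_mul, Complex.norm_cpow_eq_rpow_re_of_pos ht0]
      refine mul_le_mul ?_ (hp.1 t ht0.le).2 (norm_nonneg _) (Real.rpow_nonneg ht0.le _)
      exact Real.rpow_le_rpow_of_exponent_le ht1.le (by simpa using hp.2.2.le)

theorem integrableOn_mellin {g : ℂ → ℂ} {c C : ℝ} (hc : c < 0)
    (hg : ∀ x : ℝ, 0 ≤ x → AnalyticAt ℂ g x ∧ ‖g x‖ ≤ C * Real.exp (c * x)) {b : ℂ}
    (hb : 0 < b.re) : IntegrableOn (fun t : ℝ => (t : ℂ) ^ (b - 1) * g t) (Ioi 0) := by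
  refine Integrable.mono' (integrableOn_rpow_mul_exp hc hb C)
    ((continuousOn_cpow_mul (fun x hx => (hg x hx).1) b).aestronglyMeasurable measurableSet_Ioi) ?_
  refine (ae_restrict_iff' measurableSet_Ioi).2 (Eventually.of_forall fun t ht => ?_)
  rw [norm_mul, Complex.norm_cpow_eq_rpow_re_of_pos ht]
  refine mul_le_mul (by simp) (hg t (le_of_lt ht)).2 (norm_nonneg _)
    (Real.rpow_nonneg (le_of_lt ht) _)

theorem regMellin_eq {g : ℂ → ℂ} {c C : ℝ} (hc : c < 0)
    (hg : ∀ x : ℝ, 0 ≤ x → AnalyticAt ℂ g x ∧ ‖g x‖ ≤ C * Real.exp (c * x)) {b : ℂ}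
    (hb : 0 < b.re) :
    regMellin b g = (Complex.Gamma b)⁻¹ * ∫ t in Ioi (0 : ℝ), (t : ℂ) ^ (b - 1) * g t := by
  have hseg : AnalyticOnSegment g 1 := fun v hv => by simpa using (hg v hv.1).1
  have hint := integrableOn_mellin hc hg hb
  rw [regMellin, betaOp_eq_base (by simp) hb hseg, betaBase, betaInt,
    ← Ioc_union_Ioi_eq_Ioi (zero_le_one' ℝ),
    setIntegral_union (Ioc_disjoint_Ioi le_rfl) measurableSet_Ioi
      (hint.mono_set Ioc_subset_Ioi_self) (hint.mono_set (Ioi_subset_Ioi zero_le_one)),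
    intervalIntegral.integral_of_le zero_le_one]
  simp [mul_add]

/-- The zero of 1/Γ at -N kills the integral over (1, ∞), so the value depends only on the germ of
`g` at 0. -/
theorem regMellin_neg_nat {g : ℂ → ℂ} (hg : ∀ x : ℝ, 0 ≤ x → AnalyticAt ℂ g x) (N : ℕ) :
    regMellin (-(N : ℂ)) g = (-1) ^ N * iteratedDeriv N g 0 := by
  have hseg : AnalyticOnSegment g 1 := fun v hv => by simpa using hg v hv.1
  rw [regMellin, betaOp_one_neg_nat hseg, Complex.Gamma_neg_nat_eq_zero]
  simp

theorem betaOp_eq_zero {g : ℂ → ℂ} {t : ℂ} (hg : AnalyticOnSegment g t)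
    (h : ∀ v ∈ Icc (0 : ℝ) 1, g (v * t) = 0) (s b : ℂ) : betaOp s b g t = 0 := by
  refine eq_of_eq_of_re_pos (f₁ := fun s b => betaOp s b g t) (f₂ := fun _ _ => 0) ?_ ?_ ?_ s b
  · exact fun x => analyticAt_betaOp_params hg analyticAt_fst analyticAt_snd
  · exact fun x => analyticAt_const
  · intro s b hs hb
    have : betaInt s b g t = 0 := by
      rw [betaInt_eq_setIntegral]
      refine setIntegral_eq_zero_of_forall_eq_zero fun v hv => ?_
      rw [h v ⟨hv.1.le, hv.2.le⟩, mul_zero]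
    simp [betaOp_eq_base hs hb hg, betaBase, this]

theorem regMellin_eq_zero {g : ℂ → ℂ} (hg : ∀ x : ℝ, 0 ≤ x → AnalyticAt ℂ g x)
    (h : ∀ x : ℝ, 0 ≤ x → g x = 0) (b : ℂ) : regMellin b g = 0 := by
  have hseg : AnalyticOnSegment g 1 := fun v hv => by simpa using hg v hv.1
  rw [regMellin, betaOp_eq_zero hseg (fun v hv => by simpa using h v hv.1)]
  have : ∫ t in Ioi (1 : ℝ), (t : ℂ) ^ (b - 1) * g t = 0 := by
    refine setIntegral_eq_zero_of_forall_eq_zero fun t ht => ?_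
    rw [h t (zero_le_one.trans (le_of_lt ht)), mul_zero]
  simp [this]

/-- Each `w j` is `1` or lies in `ℂ ∖ [1, ∞)`. -/
def Admissible {q : ℕ} (w : Fin q → ℂ) : Prop :=
  ∀ j, w j = 1 ∨ w j ∉ Complex.ofReal '' Ici 1

theorem Admissible.succ {q : ℕ} {w : Fin (q + 1) → ℂ} (hw : Admissible w) :
    Admissible fun i => w i.succ := fun j => hw j.succ

theorem Admissible.admissibleAt {q : ℕ} {w : Fin q → ℂ} (hw : Admissible w) (p : P) (j : Fin q) :
    AdmissibleAt (fun _ : P => w j) p :=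
  (hw j).imp (fun h => by rw [h]) fun h => ⟨analyticAt_const, h⟩

theorem exists_iterKer_bound {q : ℕ} (a : Fin (q + 1) → ℂ) {w : Fin (q + 1) → ℂ}
    (hw : Admissible w) (σ b : Fin q → ℂ) {c : ℝ} (hc : -decayRate q a < c) :
    ∃ C : ℝ, ∀ x : ℝ, 0 ≤ x → AnalyticAt ℂ (iterKer q a w σ b) x ∧
      ‖iterKer q a w σ b x‖ ≤ C * Real.exp (c * x) := by
  have h := tameAt_iterKer (P := ℂ) (p₀ := 0) a (w := fun _ => w) (σ := fun _ => σ)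
    (b := fun _ => b) (fun j => hw.admissibleAt 0 j) (fun _ => analyticAt_const)
    fun _ => analyticAt_const
  obtain ⟨C, hC⟩ := h.exists_exp_bound hc
  refine ⟨C, fun x hx => ?_⟩
  have h1 := hC.self_of_nhds x hx
  exact ⟨AnalyticAt.slice (g := fun _ : ℂ => iterKer q a w σ b) h1.1, h1.2⟩

theorem analyticAt_iterKer {q : ℕ} (a : Fin (q + 1) → ℂ) {w : Fin (q + 1) → ℂ}
    (hw : Admissible w) (σ b : Fin q → ℂ) {x : ℝ} (hx : 0 ≤ x) :
    AnalyticAt ℂ (iterKer q a w σ b) x := by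
  obtain ⟨C, hC⟩ := exists_iterKer_bound a hw σ b (lt_add_one _)
  exact (hC x hx).1

theorem analyticOnSegment_iterKer {q : ℕ} (a : Fin (q + 1) → ℂ) {w : Fin (q + 1) → ℂ}
    (hw : Admissible w) (σ b : Fin q → ℂ) {x : ℝ} (hx : 0 ≤ x) :
    AnalyticOnSegment (iterKer q a w σ b) x := fun v hv => by
  have := analyticAt_iterKer a hw σ b (mul_nonneg hv.1 hx)
  simpa using this

/-- The j-th Beta operator vanishes by `betaOp_neg_nat` at all points of the half-line, and
everything outside it is then applied to zero. This vanishing is the source of the error bound. -/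
theorem iterKer_eq_zero {q : ℕ} (a : Fin (q + 1) → ℂ) {w : Fin (q + 1) → ℂ}
    (hw : Admissible w) {σ b : Fin q → ℂ} {j : Fin q} {l m : ℕ} (hσ : σ j = -(l : ℂ))
    (hb : b j = -(m : ℂ)) {x : ℝ} (hx : 0 ≤ x) : iterKer q a w σ b x = 0 := by
  induction q generalizing x with
  | zero => exact j.elim0
  | succ q ih =>
    have hseg : AnalyticOnSegment (iterKer q (fun i => a i.succ) (fun i => w i.succ)
      (fun i => σ i.succ) fun i => b i.succ) x := analyticOnSegment_iterKer _ hw.succ _ _ hx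
    rw [iterKer]
    refine mul_eq_zero_of_right _ ?_
    revert hσ hb
    refine Fin.cases (fun hσ hb => ?_) (fun k hσ hb => ?_) j
    · rw [hσ, hb, betaOp_neg_nat hseg]
    · refine betaOp_eq_zero hseg (fun v hv => ?_) _ _
      have := ih (fun i => a i.succ) hw.succ (σ := fun i => σ i.succ) (b := fun i => b i.succ)
        (j := k) hσ hb (mul_nonneg hv.1 hx)
      simpa using this

end RegMellin

/-! ### The integral representation of the multiple series -/

section Series

open Set MeasureTheory

theorem integral_beta_scaled (s b : ℂ) (g : ℂ → ℂ) {x : ℝ} (hx : 0 < x) :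
    ∫ t in 0..x, (t : ℂ) ^ (b - 1) * g t * ((x : ℂ) - t) ^ (s - 1) =
      (x : ℂ) ^ (s + b - 1) * betaInt s b g x := by
  have hx' : (x : ℂ) ≠ 0 := Complex.ofReal_ne_zero.mpr hx.ne'
  rw [betaInt]
  have A : (x : ℂ) ^ (s + b - 1) = x * ((x : ℂ) ^ (s - 1) * (x : ℂ) ^ (b - 1)) := by
    rw [(by ring : s + b - 1 = 1 + (s - 1) + (b - 1)), Complex.cpow_add _ _ hx',
      Complex.cpow_add 1 _ hx', Complex.cpow_one, mul_assoc]
  rw [A, mul_assoc, ← intervalIntegral.integral_const_mul, ← Complex.real_smul, ← zero_div x, ←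
    div_self hx.ne', ← intervalIntegral.integral_comp_div _ hx.ne', zero_div]
  simp_rw [intervalIntegral.integral_of_le hx.le]
  refine setIntegral_congr_fun measurableSet_Ioc fun t ht => ?_
  have h1 : (x : ℂ) ^ (b - 1) * ((t / x : ℝ) : ℂ) ^ (b - 1) = (t : ℂ) ^ (b - 1) := by
    rw [← Complex.mul_cpow_ofReal_nonneg hx.le (div_pos ht.1 hx).le, Complex.ofReal_div,
      mul_div_cancel₀ _ hx']
  have h2 : (x : ℂ) ^ (s - 1) * (1 - ((t / x : ℝ) : ℂ)) ^ (s - 1) = ((x : ℂ) - t) ^ (s - 1) := by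
    rw [(by norm_cast : (1 : ℂ) - ↑(t / x) = ↑(1 - t / x)), ←
      Complex.mul_cpow_ofReal_nonneg hx.le (sub_nonneg.mpr <| (div_le_one hx).mpr ht.2)]
    push_cast
    rw [mul_sub, mul_one, mul_div_cancel₀ _ hx']
  have h3 : ((t / x : ℝ) : ℂ) * x = t := by
    push_cast; field_simp
  simp only [h3, ← h1, ← h2]
  ring

theorem integrableOn_cpow_mul_exp {s y : ℂ} (hs : 0 < s.re) (hy : 0 < y.re) :
    IntegrableOn (fun t : ℝ => (t : ℂ) ^ (s - 1) * Complex.exp (-y * t)) (Ioi 0) := by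
  refine integrableOn_mellin (g := fun t => Complex.exp (-y * t)) (c := -y.re) (C := 1)
    (by linarith) (fun x _ => ⟨(analyticAt_const.mul analyticAt_id).cexp, ?_⟩) hs
  rw [Complex.norm_exp, one_mul]
  simp

/-- For real positive `y` this is the Gamma integral; both sides are analytic in the right
half-plane, and the principal power is the right branch there. -/
theorem integral_cpow_mul_exp {s y : ℂ} (hs : 0 < s.re) (hy : 0 < y.re) :
    ∫ t in Ioi (0 : ℝ), (t : ℂ) ^ (s - 1) * Complex.exp (-y * t)
      = Complex.Gamma s * y ^ (-s) := by
  let U : Set ℂ := {y | 0 < y.re}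
  have hU : IsPreconnected U := (convex_halfSpace_re_gt 0).isPreconnected
  have h1 : AnalyticOnNhd ℂ
      (fun y : ℂ => ∫ t in Ioi (0 : ℝ), (t : ℂ) ^ (s - 1) * Complex.exp (-y * t)) U := by
    intro y (hy : 0 < y.re)
    have hV : {z : ℂ | y.re / 2 < z.re} ∈ 𝓝 y :=
      (isOpen_lt continuous_const Complex.continuous_re).mem_nhds (show y.re / 2 < y.re by linarith)
    refine analyticAt_integral hV ?_ ?_ ?_
      (integrableOn_rpow_mul_exp (c := -(y.re / 2)) (by linarith) hs 1)
    · intro z hz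
      exact (integrableOn_cpow_mul_exp hs (lt_trans (half_pos hy) hz)).1
    · exact Eventually.of_forall fun t => by fun_prop
    · refine (ae_restrict_iff' measurableSet_Ioi).2 (Eventually.of_forall fun t ht z hz => ?_)
      rw [norm_mul, Complex.norm_cpow_eq_rpow_re_of_pos ht, Complex.norm_exp, one_mul]
      have ht0 : (0 : ℝ) < t := ht
      have hz' : y.re / 2 < z.re := hz
      have : (-z * t).re ≤ -(y.re / 2) * t := by
        simp only [neg_mul, Complex.neg_re, Complex.re_mul_ofReal]
        nlinarith
      simp only [Complex.sub_re, Complex.one_re]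
      gcongr
  have h2 : AnalyticOnNhd ℂ (fun y : ℂ => Complex.Gamma s * y ^ (-s)) U := fun y hy =>
    analyticAt_const.mul (analyticAt_id.cpow analyticAt_const (Or.inl hy))
  refine h1.eqOn_of_preconnected_of_frequently_eq h2 hU (z₀ := 1) (by simp [U]) ?_ hy
  have hreal : ∀ r : ℝ, 0 < r → ∫ t in Ioi (0 : ℝ), (t : ℂ) ^ (s - 1) * Complex.exp (-(r : ℂ) * t)
      = Complex.Gamma s * (r : ℂ) ^ (-s) := by
    intro r hr
    simp_rw [neg_mul]
    rw [Complex.integral_cpow_mul_exp_neg_mul_Ioi hs hr, one_div, Complex.inv_cpow,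
      Complex.cpow_neg, mul_comm]
    rw [Complex.arg_ofReal_of_nonneg hr.le]
    exact Real.pi_pos.ne
  have hlim : Tendsto (fun r : ℝ => (r : ℂ)) (𝓝[≠] 1) (𝓝[≠] 1) := by
    refine tendsto_nhdsWithin_iff.2 ⟨?_, ?_⟩
    · have : Tendsto (fun r : ℝ => (r : ℂ)) (𝓝 1) (𝓝 ((1 : ℝ) : ℂ)) :=
        Complex.continuous_ofReal.tendsto 1
      simpa using this.mono_left nhdsWithin_le_nhds
    · filter_upwards [self_mem_nhdsWithin] with r hr
      exact fun h => hr (by simpa using h)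
  refine hlim.frequently (Eventually.frequently ?_)
  filter_upwards [nhdsWithin_le_nhds (lt_mem_nhds (zero_lt_one' ℝ))] with r hr using hreal r hr

/-- A product of Laplace transforms is the transform of a convolution, and convolving t^(b-1) g with
t^(s-1) is, after scaling, a Beta integral. Thus one denominator of the series becomes one Beta
operator. -/
theorem laplace_mul_laplace {s b y : ℂ} {g : ℂ → ℂ} (hs : 0 < s.re) (hy : 0 < y.re)
    (hg : IntegrableOn (fun t : ℝ => (t : ℂ) ^ (b - 1) * (Complex.exp (-y * t) * g t)) (Ioi 0)) :
    (∫ t in Ioi (0 : ℝ), (t : ℂ) ^ (b - 1) * (Complex.exp (-y * t) * g t)) *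
      (Complex.Gamma s * y ^ (-s)) =
      ∫ t in Ioi (0 : ℝ), (t : ℂ) ^ (s + b - 1) * (Complex.exp (-y * t) * betaInt s b g t) := by
  have hi := integrableOn_cpow_mul_exp hs hy
  have hconv := integral_posConvolution hg hi (ContinuousLinearMap.mul ℝ ℂ)
  simp_rw [ContinuousLinearMap.mul_apply'] at hconv
  have hG : ∫ t in Ioi (0 : ℝ), (t : ℂ) ^ (s - 1) * Complex.exp (-y * t)
      = Complex.Gamma s * y ^ (-s) :=
    integral_cpow_mul_exp hs hy
  rw [hG] at hconv
  rw [← hconv]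
  refine setIntegral_congr_fun measurableSet_Ioi fun x hx => ?_
  rw [mul_left_comm, ← integral_beta_scaled s b g hx, ← intervalIntegral.integral_const_mul]
  congr 1 with t : 1
  push_cast
  have : Complex.exp (-y * x) = Complex.exp (-y * t) * Complex.exp (-y * (x - t)) := by
    rw [← Complex.exp_add]; congr 1; ring
  rw [this]; ring

theorem hasSum_of_eq {α ι : Type*} [AddCommMonoid α] [TopologicalSpace α] {f g : ι → α} {x y : α}
    (h : HasSum f x) (hfg : ∀ i, g i = f i) (e : x = y) : HasSum g y := by
  rw [funext hfg, ← e]; exact h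

/-- Summation of a geometric series of exponentials under the integral sign. -/
theorem hasSum_integral_ker {a w y b : ℂ} {h : ℂ → ℂ} (hw : ‖w‖ ≤ 1)
    (hint : IntegrableOn (fun t : ℝ => (t : ℂ) ^ (b - 1) *
      (Complex.exp (-y * t) * (ker a 1 t * h t))) (Ioi 0))
    (hmeas : AEStronglyMeasurable (fun t : ℝ => h t) (volume.restrict (Ioi 0))) :
    HasSum (fun m : ℕ => w ^ m * ∫ t in Ioi (0 : ℝ), (t : ℂ) ^ b *
      (Complex.exp (-(y + (m + a)) * t) * h t))
      (∫ t in Ioi (0 : ℝ), (t : ℂ) ^ (b - 1) * (Complex.exp (-y * t) * (ker a w t * h t))) := by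
  have hexp : ∀ (t : ℝ) (m : ℕ), Complex.exp (-(y + (m + a)) * t)
      = Complex.exp (-y * t) * Complex.exp (-a * t) * Complex.exp (-t) ^ m := by
    intro t m
    rw [← Complex.exp_nat_mul, ← Complex.exp_add, ← Complex.exp_add]; congr 1; ring
  have hgeo : ∀ {v : ℂ}, ‖v‖ ≤ 1 → ∀ t : ℝ, 0 < t →
      HasSum (fun m : ℕ => v ^ m * ((t : ℂ) ^ b * (Complex.exp (-(y + (m + a)) * t) * h t)))
        ((t : ℂ) ^ (b - 1) * (Complex.exp (-y * t) * (ker a v t * h t))) := by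
    intro v hv t ht
    have ht' : (t : ℂ) ≠ 0 := by exact_mod_cast ht.ne'
    have hn : ‖v * Complex.exp (-t)‖ < 1 := by
      rw [norm_mul, Complex.norm_exp]
      refine (mul_le_of_le_one_left (Real.exp_pos _).le hv).trans_lt ?_
      rw [Real.exp_lt_one_iff]; simpa using ht
    have hne : 1 - v * Complex.exp (-t) ≠ 0 := by
      intro h0
      rw [show v * Complex.exp (-t) = 1 by linear_combination -h0, norm_one] at hn
      exact lt_irrefl _ hn
    have hk := kern_mul v t (Or.inr fun h0 => hne (by rw [h0, sub_self]))
    have := (hasSum_geometric_of_norm_lt_one hn).mul_left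
      ((t : ℂ) ^ b * (Complex.exp (-y * t) * Complex.exp (-a * t) * h t))
    refine hasSum_of_eq this (fun m => ?_) ?_
    · rw [hexp, mul_pow]; ring
    · have e : (t : ℂ) ^ b = (t : ℂ) ^ (b - 1) * t := by
        rw [Complex.cpow_sub _ _ ht', Complex.cpow_one]; field_simp
      rw [e, ker, mul_inv_eq_iff_eq_mul₀ hne]
      linear_combination -((t : ℂ) ^ (b - 1) * (Complex.exp (-y * t) * Complex.exp (-a * t) * h t)) * hk
  have hcont : ∀ m : ℕ, AEStronglyMeasurable (fun t : ℝ => (t : ℂ) ^ b *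
      (Complex.exp (-(y + (m + a)) * t) * h t)) (volume.restrict (Ioi 0)) := by
    intro m
    refine AEStronglyMeasurable.mul (ContinuousOn.aestronglyMeasurable (fun t ht =>
      (hasDerivAt_ofReal_cpow_const' ht _).continuousAt.continuousWithinAt) measurableSet_Ioi)
      (AEStronglyMeasurable.mul ?_ hmeas)
    exact (Continuous.aestronglyMeasurable (by fun_prop))
  -- The majorant is the case w = 1: for real t the norms form a geometric series in exp(-t), with
  -- sum the norm of the integrand for `ker a 1`. Integrability is therefore assumed for `ker a 1`,
  -- not `ker a w`.
  have hbd : ∀ t : ℝ, 0 < t → HasSum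
      (fun m : ℕ => ‖(t : ℂ) ^ b * (Complex.exp (-(y + (m + a)) * t) * h t)‖)
      ‖(t : ℂ) ^ (b - 1) * (Complex.exp (-y * t) * (ker a 1 t * h t))‖ := by
    intro t ht
    have ht' : (t : ℂ) ≠ 0 := by exact_mod_cast ht.ne'
    have hlt : Real.exp (-t) < 1 := by rw [Real.exp_lt_one_iff]; linarith
    have hne : 1 - Real.exp (-t) ≠ 0 := by linarith
    have := (hasSum_geometric_of_lt_one (Real.exp_pos (-t)).le hlt).mul_left
      ‖(t : ℂ) ^ b * (Complex.exp (-y * t) * Complex.exp (-a * t) * h t)‖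
    refine hasSum_of_eq this (fun m => ?_) ?_
    · rw [hexp]
      simp only [norm_mul, norm_pow]
      rw [show ‖Complex.exp (-(t : ℂ))‖ = Real.exp (-t) by
        rw [Complex.norm_exp]; simp]
      ring
    · have e : (t : ℂ) ^ b = (t : ℂ) ^ (b - 1) * t := by
        rw [Complex.cpow_sub _ _ ht', Complex.cpow_one]; field_simp
      have hne' : (1 : ℂ) - 1 * Complex.exp (-t) ≠ 0 := by
        have : ((1 - Real.exp (-t) : ℝ) : ℂ) ≠ 0 := by exact_mod_cast hne
        push_cast at this
        simpa using this
      have hk := kern_mul 1 t (Or.inr fun h0 => hne' (by rw [h0, sub_self]))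
      have hk2 : ‖kern 1 t‖ * (1 - Real.exp (-t)) = ‖(t : ℂ)‖ := by
        nth_rewrite 2 [← hk]
        rw [norm_mul]
        congr 1
        rw [show (1 : ℂ) - 1 * Complex.exp (-t) = ((1 - Real.exp (-t) : ℝ) : ℂ) by push_cast; ring,
          Complex.norm_real, Real.norm_eq_abs, abs_of_pos (by linarith)]
      rw [e, ker, mul_inv_eq_iff_eq_mul₀ hne]
      simp only [norm_mul]
      linear_combination -(‖(t : ℂ) ^ (b - 1)‖ * (‖Complex.exp (-y * t)‖ *
        ‖Complex.exp (-a * t)‖ * ‖h t‖)) * hk2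
  have hmain := hasSum_integral_of_dominated_convergence (μ := volume.restrict (Ioi (0 : ℝ)))
    (F := fun (m : ℕ) (t : ℝ) => w ^ m * ((t : ℂ) ^ b * (Complex.exp (-(y + (m + a)) * t) * h t)))
    (f := fun t : ℝ => (t : ℂ) ^ (b - 1) * (Complex.exp (-y * t) * (ker a w t * h t)))
    (fun m t => ‖(t : ℂ) ^ b * (Complex.exp (-(y + (m + a)) * t) * h t)‖)
    (fun m => (hcont m).const_mul _)
    (fun m => Eventually.of_forall fun t => by
      rw [norm_mul, norm_pow]
      exact mul_le_of_le_one_left (norm_nonneg _) (pow_le_one₀ (norm_nonneg _) hw))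
    ((ae_restrict_iff' measurableSet_Ioi).2 (Eventually.of_forall fun t ht => (hbd t ht).summable))
    (IntegrableOn.congr_fun (f := fun t : ℝ => ‖(t : ℂ) ^ (b - 1) *
        (Complex.exp (-y * t) * (ker a 1 t * h t))‖) hint.norm
      (fun t ht => (hbd t ht).tsum_eq.symm) measurableSet_Ioi)
    ((ae_restrict_iff' measurableSet_Ioi).2 (Eventually.of_forall fun t ht => hgeo hw t ht))
  simpa only [integral_const_mul] using hmain

theorem Iic_succ_eq_cons {q : ℕ} (j : Fin q) :
    Finset.Iic j.succ = Finset.cons 0 ((Finset.Iic j).map (Fin.succEmb _)) (by simp) := by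
  ext i; refine Fin.cases ?_ (fun k => ?_) i <;> simp

theorem sum_Iic_succ {M : Type*} [AddCommMonoid M] {q : ℕ} (v : Fin (q + 1) → M) (j : Fin q) :
    ∑ i ∈ Finset.Iic j.succ, v i = v 0 + ∑ i ∈ Finset.Iic j, v i.succ := by
  rw [Iic_succ_eq_cons, Finset.sum_cons, Finset.sum_map]; rfl

theorem sum_Iic_zero {M : Type*} [AddCommMonoid M] {q : ℕ} (v : Fin (q + 1) → M) :
    ∑ i ∈ Finset.Iic (0 : Fin (q + 1)), v i = v 0 := by
  rw [show Finset.Iic (0 : Fin (q + 1)) = {0} by ext i; simp, Finset.sum_singleton]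

theorem tail_succ {M : Type*} [AddCommMonoid M] {q : ℕ} (v : Fin (q + 1) → M) (j : Fin q) :
    tail v j.succ = tail (fun i => v i.succ) j := by
  rw [tail, tail, show Finset.Ici j.succ = (Finset.Ici j).map (Fin.succEmb _) by
    ext i; refine Fin.cases ?_ (fun k => ?_) i <;> simp, Finset.sum_map]; rfl

theorem tail_zero {M : Type*} [AddCommMonoid M] {q : ℕ} (v : Fin (q + 1) → M) :
    tail v 0 = ∑ i, v i := by
  rw [tail, show Finset.Ici (0 : Fin (q + 1)) = Finset.univ by ext i; simp]

theorem tail_castSucc {M : Type*} [AddCommMonoid M] {q : ℕ} (v : Fin (q + 1) → M) (j : Fin q) :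
    tail v j.castSucc = v j.castSucc + tail v j.succ := by
  rw [tail, tail, show Finset.Ici j.castSucc = Finset.cons j.castSucc (Finset.Ici j.succ)
    (by simp) by
      ext i
      simp only [Finset.mem_Ici, Finset.mem_cons, Fin.le_def, Fin.ext_iff, Fin.val_castSucc,
        Fin.val_succ]
      omega, Finset.sum_cons]

theorem tail_last {M : Type*} [AddCommMonoid M] {q : ℕ} (v : Fin (q + 1) → M) :
    tail v (Fin.last q) = v (Fin.last q) := by
  rw [tail, show Finset.Ici (Fin.last q) = {Fin.last q} by
    ext i; simp [Fin.last_le_iff], Finset.sum_singleton]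

/-- The exponents `s_j + ⋯ + s_q - (q + 1 - j)`. -/
def bpar {q : ℕ} (s : Fin (q + 1) → ℂ) (j : Fin (q + 1)) : ℂ :=
  tail s j - ((q + 1 - j : ℕ) : ℂ)

theorem bpar_succ {q : ℕ} (s : Fin (q + 2) → ℂ) (j : Fin (q + 1)) :
    bpar s j.succ = bpar (fun i => s i.succ) j := by
  rw [bpar, bpar, tail_succ, Fin.val_succ, Nat.add_sub_add_right]

/-- Merging two Laplace transforms yields the power t^(s_j + b_{j+1} - 1) = t^(b_j). One factor t is
then reserved for the kernel, leaving the Mellin weight t^(b_j - 1). -/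
theorem bpar_castSucc {q : ℕ} (s : Fin (q + 1) → ℂ) (j : Fin q) :
    bpar s j.castSucc = s j.castSucc + bpar s j.succ - 1 := by
  rw [bpar, bpar, tail_castSucc, Fin.val_succ, Fin.val_castSucc,
    show q + 1 - (j : ℕ) = q + 1 - (j + 1) + 1 by omega]
  push_cast; ring

theorem bpar_last {q : ℕ} (s : Fin (q + 1) → ℂ) : bpar s (Fin.last q) = s (Fin.last q) - 1 := by
  simp [bpar, tail_last]

theorem bpar_re_pos {q : ℕ} {s : Fin (q + 1) → ℂ} (hs : ∀ j, 1 < (s j).re) (j : Fin (q + 1)) :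
    0 < (bpar s j).re := by
  refine Fin.reverseInduction ?_ (fun i ih => ?_) j
  · rw [bpar_last]; simpa using hs _
  · rw [bpar_castSucc]
    have := hs i.castSucc
    simp only [Complex.sub_re, Complex.add_re, Complex.one_re]
    linarith

/-- The term of the multiple series with all denominators shifted by `y`. -/
def shiftTerm {q : ℕ} (y : ℂ) (s a w : Fin q → ℂ) (m : Fin q → ℕ) : ℂ :=
  ∏ j, w j ^ m j / (y + ∑ i ∈ Finset.Iic j, ((m i : ℂ) + a i)) ^ s j

/-- With the first summation index fixed, the others form a series of the same kind with `y`
increased by `k + a 0`; the shift `y` is carried for this induction. -/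
theorem shiftTerm_cons {q : ℕ} (y : ℂ) (s a w : Fin (q + 1) → ℂ) (k : ℕ) (m : Fin q → ℕ) :
    shiftTerm y s a w (Fin.cons k m : Fin (q + 1) → ℕ) = w 0 ^ k / (y + (k + a 0)) ^ s 0 *
      shiftTerm (y + (k + a 0)) (fun i => s i.succ) (fun i => a i.succ) (fun i => w i.succ) m := by
  rw [shiftTerm, Fin.prod_univ_succ, sum_Iic_zero, shiftTerm]
  simp only [Fin.cons_zero, Fin.cons_succ, sum_Iic_succ, add_assoc]

theorem summable_prod_fin {n : ℕ} (f : Fin n → ℕ → ℝ) (h0 : ∀ j k, 0 ≤ f j k)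
    (hf : ∀ j, Summable (f j)) : Summable fun m : Fin n → ℕ => ∏ j, f j (m j) := by
  induction n with
  | zero => exact Summable.of_finite
  | succ n ih =>
    rw [← (Fin.consEquiv fun _ : Fin (n + 1) => ℕ).summable_iff]
    refine Summable.congr (Summable.mul_of_nonneg (hf 0)
      (ih (fun j => f j.succ) (fun j k => h0 _ _) fun j => hf _) (h0 0)
      fun m => Finset.prod_nonneg fun j _ => h0 _ _) fun x => ?_
    simp [Fin.prod_univ_succ, Fin.consEquiv]

/-- The argument is at most π in absolute value, so the imaginary part of `s` costs only a constant.
-/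
theorem norm_inv_cpow_le {α : ℝ} (hα : 0 < α) {z s : ℂ} {k : ℕ} (hs : 0 < s.re)
    (hz : α + k ≤ z.re) :
    ‖(z ^ s)⁻¹‖ ≤ Real.exp (Real.pi * |s.im|) * (1 / |(k : ℝ) + α| ^ s.re) := by
  have hpos : 0 < α + k := by positivity
  have hz0 : z ≠ 0 := fun h => by rw [h, Complex.zero_re] at hz; linarith
  have hle : α + k ≤ ‖z‖ := hz.trans ((le_abs_self _).trans (Complex.abs_re_le_norm z))
  rw [norm_inv, Complex.norm_cpow_of_ne_zero hz0, inv_div, div_eq_mul_one_div,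
    abs_of_pos (show 0 < (k : ℝ) + α by linarith), add_comm (k : ℝ) α]
  have h1 : Real.exp (z.arg * s.im) ≤ Real.exp (Real.pi * |s.im|) := by
    refine Real.exp_le_exp.2 ((le_abs_self _).trans ?_)
    rw [abs_mul]
    exact mul_le_mul_of_nonneg_right (Complex.abs_arg_le_pi z) (abs_nonneg _)
  gcongr

theorem summable_shiftTerm {q : ℕ} {y : ℂ} {s a w : Fin q → ℂ} (hs : ∀ j, 1 < (s j).re)
    (hw : ∀ j, ‖w j‖ ≤ 1) (hy : ∀ j, 0 < y.re + (∑ i ∈ Finset.Iic j, a i).re) :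
    Summable (shiftTerm y s a w) := by
  refine Summable.of_norm_bounded (summable_prod_fin
    (fun j k => Real.exp (Real.pi * |(s j).im|) *
      (1 / |(k : ℝ) + (y.re + (∑ i ∈ Finset.Iic j, a i).re)| ^ (s j).re))
    (fun j k => by positivity)
    fun j => ((Real.summable_one_div_nat_add_rpow _ _).2 (hs j)).mul_left _) fun m => ?_
  rw [shiftTerm, norm_prod]
  refine Finset.prod_le_prod (fun _ _ => norm_nonneg _) fun j _ => ?_
  rw [div_eq_mul_inv, norm_mul, norm_pow]
  refine (mul_le_of_le_one_left (norm_nonneg _) (pow_le_one₀ (norm_nonneg _) (hw j))).trans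
    (norm_inv_cpow_le (hy j) (zero_lt_one.trans (hs j)) ?_)
  -- Keeping only `m j` in the j-th denominator decouples the variables, and the majorant is a
  -- product of convergent one-variable series.
  have : (m j : ℝ) ≤ ∑ i ∈ Finset.Iic j, (m i : ℝ) :=
    Finset.single_le_sum (f := fun i => (m i : ℝ)) (fun i _ => Nat.cast_nonneg _) (by simp)
  simp only [Complex.add_re, Complex.re_sum, Complex.natCast_re, Finset.sum_add_distrib]
  linarith

theorem integrableOn_iterKer {q : ℕ} {a w : Fin (q + 1) → ℂ} (hw : Admissible w) {σ b : Fin q → ℂ}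
    {y β : ℂ} (hy : ∀ j, 0 < y.re + (∑ i ∈ Finset.Iic j, a i).re) (hβ : 0 < β.re) :
    IntegrableOn (fun t : ℝ => (t : ℂ) ^ (β - 1) *
      (Complex.exp (-y * t) * iterKer q a w σ b t)) (Ioi 0) := by
  obtain ⟨c, hc1, hc2⟩ := exists_between (show -decayRate q a < y.re by
    linarith [add_decayRate_pos hy])
  obtain ⟨C, hC⟩ := exists_iterKer_bound a hw σ b hc1
  refine integrableOn_mellin (g := fun t => Complex.exp (-y * t) * iterKer q a w σ b t)
    (c := c - y.re) (C := C) (by linarith) (fun x hx => ⟨?_, ?_⟩) hβ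
  · exact (analyticAt_const.mul analyticAt_id).cexp.mul (hC x hx).1
  · rw [norm_mul, Complex.norm_exp]
    refine (mul_le_mul_of_nonneg_left (hC x hx).2 (Real.exp_pos _).le).trans (le_of_eq ?_)
    rw [mul_left_comm, ← Real.exp_add]
    congr 2
    simp; ring

theorem Admissible.cons_one {q : ℕ} {w : Fin (q + 1) → ℂ} (hw : Admissible w) :
    Admissible (Fin.cons 1 fun i => w i.succ : Fin (q + 1) → ℂ) := fun j => by
  refine Fin.cases (Or.inl rfl) (fun i => ?_) j
  simpa using hw i.succ

/-- By induction on the depth, the sum over all later indices is a Laplace integral for each value k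
of the first. Its product with (y + k + a_0)^(-s_0) merges into a Beta operator, and the geometric
sum over k creates the kernel. The Γ(s_j) of merged factors cancel against the normalizations;
Γ(s_r)⁻¹ and the later Γ(b_j) remain. -/
theorem hasSum_shiftTerm {q : ℕ} {y : ℂ} {s a w : Fin (q + 1) → ℂ} (hs : ∀ j, 1 < (s j).re)
    (hw : ∀ j, ‖w j‖ ≤ 1) (hw' : Admissible w)
    (hy : ∀ j, 0 < y.re + (∑ i ∈ Finset.Iic j, a i).re) :
    HasSum (shiftTerm y s a w) ((Complex.Gamma (s (Fin.last q)))⁻¹ *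
      (∏ j : Fin q, Complex.Gamma (bpar s j.succ)) *
      ∫ t in Ioi (0 : ℝ), (t : ℂ) ^ (bpar s 0 - 1) * (Complex.exp (-y * t) *
        iterKer q a w (fun j => s j.castSucc) (fun j => bpar s j.succ) t)) := by
  induction q generalizing y with
  | zero =>
    have hint := integrableOn_iterKer (a := a) hw'.cons_one (σ := fun j => s j.castSucc)
      (b := fun j => bpar s j.succ) hy (bpar_re_pos hs 0)
    have h1 := (hasSum_integral_ker (a := a 0) (h := fun _ => 1) (b := bpar s 0) (hw 0)
      (by simpa only [iterKer, Fin.cons_zero, mul_one] using hint)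
      aestronglyMeasurable_const).mul_left (Complex.Gamma (s 0))⁻¹
    rw [← (Equiv.funUnique (Fin 1) ℕ).symm.hasSum_iff]
    refine hasSum_of_eq h1 (fun m => ?_) ?_
    · have hre : 0 < (y + (m + a 0)).re := by
        have := hy 0
        rw [sum_Iic_zero] at this
        have h2 : (0 : ℝ) ≤ m := Nat.cast_nonneg m
        simp only [Complex.add_re, Complex.natCast_re]; linarith
      have h2 := integral_cpow_mul_exp (zero_lt_one.trans (hs 0)) hre
      have h3 : Complex.Gamma (s 0) ≠ 0 := Complex.Gamma_ne_zero_of_re_pos (zero_lt_one.trans (hs 0))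
      have h4 : bpar s 0 = s 0 - 1 := bpar_last s
      simp only [mul_one]
      rw [h4, h2, Complex.cpow_neg]
      simp [shiftTerm, sum_Iic_zero, Equiv.funUnique]
      field_simp
    · simp [iterKer]
  | succ q ih =>
    set s' : Fin (q + 1) → ℂ := fun i => s i.succ with hs'
    set a' : Fin (q + 1) → ℂ := fun i => a i.succ with ha'
    set w' : Fin (q + 1) → ℂ := fun i => w i.succ with hw''
    set g : ℂ → ℂ := iterKer q a' w' (fun j => s' j.castSucc) (fun j => bpar s' j.succ) with hg
    have hs0 : 0 < (s 0).re := zero_lt_one.trans (hs 0)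
    have hb1 : 0 < (bpar s' 0).re := bpar_re_pos (fun j => hs j.succ) 0
    have hb0 : bpar s 0 = s 0 + bpar s' 0 - 1 := by
      have := bpar_castSucc s 0
      rw [bpar_succ] at this
      exact this
    have hy' : ∀ (k : ℕ) j, 0 < (y + (k + a 0)).re + (∑ i ∈ Finset.Iic j, a' i).re := by
      intro k j
      have := hy j.succ
      rw [sum_Iic_succ] at this
      have h2 : (0 : ℝ) ≤ k := Nat.cast_nonneg k
      simp only [Complex.add_re, Complex.natCast_re] at this ⊢
      linarith
    have hy0 : ∀ k : ℕ, 0 < (y + (k + a 0)).re := by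
      intro k
      have := hy 0
      rw [sum_Iic_zero] at this
      have h2 : (0 : ℝ) ≤ k := Nat.cast_nonneg k
      simp only [Complex.add_re, Complex.natCast_re]; linarith
    have hseg : ∀ t : ℝ, 0 < t → AnalyticOnSegment g t := fun t ht =>
      analyticOnSegment_iterKer _ hw'.succ _ _ ht.le
    have hint := integrableOn_iterKer (a := a) hw'.cons_one (σ := fun j => s j.castSucc)
      (b := fun j => bpar s j.succ) hy (bpar_re_pos hs 0)
    have hker : ∀ v : Fin (q + 2) → ℂ, (fun i => v i.succ) = w' →
        iterKer (q + 1) a v (fun j => s j.castSucc) (fun j => bpar s j.succ)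
        = fun t => ker (a 0) (v 0) t * betaOp (s 0) (bpar s' 0) g t := by
      intro v hv
      ext t
      rw [iterKer, hv]
      simp only [hg, bpar_succ]
      rfl
    rw [hker _ (by ext i; rfl)] at hint ⊢
    have hmeas : AEStronglyMeasurable (fun t : ℝ => betaOp (s 0) (bpar s' 0) g t)
        (volume.restrict (Ioi 0)) := by
      refine ContinuousOn.aestronglyMeasurable (fun t ht => ?_) measurableSet_Ioi
      exact (ContinuousAt.comp (f := fun t : ℝ => (t : ℂ))
        ((hseg t ht).analyticAt_betaOp _ _).continuousAt (by fun_prop)).continuousWithinAt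
    have h1 := (hasSum_integral_ker (a := a 0) (h := betaOp (s 0) (bpar s' 0) g)
      (b := bpar s 0) (hw 0) hint hmeas).mul_left ((Complex.Gamma (s (Fin.last (q + 1))))⁻¹ *
      (∏ j : Fin (q + 1), Complex.Gamma (bpar s j.succ)))
    have hsum := (summable_shiftTerm hs hw hy).hasSum
    have h2 : HasSum (fun k : ℕ => w 0 ^ k / (y + (k + a 0)) ^ s 0 *
        ((Complex.Gamma (s' (Fin.last q)))⁻¹ * (∏ j : Fin q, Complex.Gamma (bpar s' j.succ)) *
        ∫ t in Ioi (0 : ℝ), (t : ℂ) ^ (bpar s' 0 - 1) *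
          (Complex.exp (-(y + (k + a 0)) * t) * g t)))
        (∑' m, shiftTerm y s a w m) := by
      refine HasSum.prod_fiberwise
        ((Fin.consEquiv fun _ : Fin (q + 2) => ℕ).hasSum_iff.2 hsum) fun k => ?_
      refine hasSum_of_eq ((ih (s := s') (a := a') (w := w') (fun j => hs _) (fun j => hw _)
        hw'.succ (hy' k)).mul_left (w 0 ^ k / (y + (k + a 0)) ^ s 0)) (fun m => ?_) rfl
      simp only [Function.comp, Fin.consEquiv, Equiv.coe_fn_mk]
      rw [shiftTerm_cons]
    refine hasSum_of_eq hsum (fun _ => rfl) (h2.unique (hasSum_of_eq h1 (fun k => ?_) rfl))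
    have hG0 : Complex.Gamma (s 0) ≠ 0 := Complex.Gamma_ne_zero_of_re_pos hs0
    have hG1 : Complex.Gamma (bpar s' 0) ≠ 0 := Complex.Gamma_ne_zero_of_re_pos hb1
    have h3 := laplace_mul_laplace hs0 (hy0 k)
      (integrableOn_iterKer (a := a') hw'.succ (σ := fun j => s' j.castSucc)
        (b := fun j => bpar s' j.succ) (hy' k) hb1)
    have h4 : ∫ t in Ioi (0 : ℝ), (t : ℂ) ^ bpar s 0 *
        (Complex.exp (-(y + (k + a 0)) * t) * betaOp (s 0) (bpar s' 0) g t) =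
        (Complex.Gamma (s 0))⁻¹ * (Complex.Gamma (bpar s' 0))⁻¹ *
        ∫ t in Ioi (0 : ℝ), (t : ℂ) ^ (s 0 + bpar s' 0 - 1) *
        (Complex.exp (-(y + (k + a 0)) * t) * betaInt (s 0) (bpar s' 0) g t) := by
      rw [← integral_const_mul]
      refine setIntegral_congr_fun measurableSet_Ioi fun t ht => ?_
      rw [hb0, betaOp_eq_base hs0 hb1 (hseg t ht), betaBase]
      ring
    rw [h4, ← h3, Fin.prod_univ_succ, Complex.cpow_neg]
    simp only [bpar_succ]
    rw [show s (Fin.last (q + 1)) = s' (Fin.last q) from rfl]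
    field_simp
    simp only [hg, hs', hw'']
    ring

theorem hasSum_zetaTerm {q : ℕ} {s a w : Fin (q + 1) → ℂ} (hs : ∀ j, 1 < (s j).re)
    (hw : ∀ j, ‖w j‖ ≤ 1) (hw' : Admissible w) (ha : ∀ j, 0 < (∑ i ∈ Finset.Iic j, a i).re) :
    HasSum (zetaTerm s a w) ((Complex.Gamma (s (Fin.last q)))⁻¹ *
      (∏ j, Complex.Gamma (bpar s j)) * regMellin (bpar s 0)
        (iterKer q a w (fun j => s j.castSucc) (fun j => bpar s j.succ))) := by
  have hy : ∀ j, 0 < (0 : ℂ).re + (∑ i ∈ Finset.Iic j, a i).re := fun j => by simpa using ha j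
  refine hasSum_of_eq (hasSum_shiftTerm hs hw hw' hy) (fun m => ?_) ?_
  · simp [zetaTerm, shiftTerm]
  · obtain ⟨c, hc1, hc2⟩ := exists_between (show -decayRate q a < 0 by
      have := add_decayRate_pos hy; simp at this; linarith)
    obtain ⟨C, hC⟩ := exists_iterKer_bound a hw' (fun j => s j.castSucc)
      (fun j => bpar s j.succ) hc1
    have hb0 := bpar_re_pos hs 0
    have hG : Complex.Gamma (bpar s 0) ≠ 0 := Complex.Gamma_ne_zero_of_re_pos hb0
    rw [regMellin_eq hc2 hC hb0, Fin.prod_univ_succ]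
    simp only [neg_zero, zero_mul, Complex.exp_zero, one_mul]
    field_simp

end Series

/-! ### Taylor coefficients -/

section Taylor


/-- The Taylor series of `g` at `0` as a formal power series. -/
def taylor (g : ℂ → ℂ) : PowerSeries ℂ := PowerSeries.mk fun n => iteratedDeriv n g 0 / (n ! : ℂ)

theorem coeff_taylor (g : ℂ → ℂ) (n : ℕ) :
    PowerSeries.coeff n (taylor g) = iteratedDeriv n g 0 / (n ! : ℂ) := PowerSeries.coeff_mk _ _

theorem taylor_mul {f g : ℂ → ℂ} (hf : AnalyticAt ℂ f 0) (hg : AnalyticAt ℂ g 0) :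
    taylor (fun t => f t * g t) = taylor f * taylor g := by
  ext n
  rw [PowerSeries.coeff_mul, coeff_taylor, iteratedDeriv_fun_mul hf.contDiffAt hg.contDiffAt,
    Finset.Nat.sum_antidiagonal_eq_sum_range_succ_mk, Finset.sum_div]
  refine Finset.sum_congr rfl fun i hi => ?_
  have hi' : i ≤ n := Nat.lt_succ_iff.1 (Finset.mem_range.1 hi)
  have h1 : (n ! : ℂ) = n.choose i * i ! * (n - i)! := by
    exact_mod_cast (Nat.choose_mul_factorial_mul_factorial hi').symm
  have h2 : (n.choose i : ℂ) ≠ 0 := by exact_mod_cast (Nat.choose_pos hi').ne'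
  have h3 : (i ! : ℂ) ≠ 0 := by exact_mod_cast i.factorial_ne_zero
  have h4 : ((n - i)! : ℂ) ≠ 0 := by exact_mod_cast (n - i).factorial_ne_zero
  rw [coeff_taylor, coeff_taylor, h1]
  field_simp

theorem taylor_congr {f g : ℂ → ℂ} (h : f =ᶠ[𝓝 0] g) : taylor f = taylor g := by
  ext n
  rw [coeff_taylor, coeff_taylor, h.iteratedDeriv_eq]

theorem taylor_exp (c : ℂ) : taylor (fun t => Complex.exp (c * t)) = expSeries c := by
  ext n
  rw [coeff_taylor, iteratedDeriv_cexp_const_mul, expSeries, PowerSeries.coeff_rescale,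
    PowerSeries.coeff_exp]
  simp [div_eq_mul_inv]

theorem taylor_one_sub_exp (w : ℂ) : taylor (fun t => 1 - w * Complex.exp (-t)) =
    1 - PowerSeries.C w * expSeries (-1) := by
  ext n
  have h0 : AnalyticAt ℂ (fun t : ℂ => w * Complex.exp (-t)) 0 :=
    analyticAt_const.mul analyticAt_id.neg.cexp
  have h1 := iteratedDeriv_fun_sub (n := n) (x := (0 : ℂ)) (f := fun _ : ℂ => (1 : ℂ))
    (g := fun t : ℂ => w * Complex.exp (-t)) contDiffAt_const h0.contDiffAt
  have h2 : iteratedDeriv n (fun t : ℂ => w * Complex.exp (-t)) 0 / (n ! : ℂ)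
      = w * PowerSeries.coeff n (expSeries (-1)) := by
    rw [iteratedDeriv_const_mul_field, ← taylor_exp, coeff_taylor]
    simp [mul_div_assoc]
  rw [coeff_taylor, h1, sub_div, h2, iteratedDeriv_const, map_sub, PowerSeries.coeff_C_mul,
    PowerSeries.coeff_one]
  congr 1
  split_ifs with hn
  · simp [hn]
  · simp

theorem taylor_id : taylor (fun t => t) = PowerSeries.X := by
  ext n
  rw [coeff_taylor, PowerSeries.coeff_X]
  match n with
  | 0 => simp
  | 1 => simp
  | n + 2 => simp [iteratedDeriv_succ']

theorem analyticAt_kern_zero {w : ℂ} (hw : w = 1 ∨ w ∉ Complex.ofReal '' Set.Ici 1) :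
    AnalyticAt ℂ (kern w) 0 := by
  have h := analyticAt_iterKer (q := 0) (fun _ => 0) (w := fun _ => w) (fun _ => hw)
    Fin.elim0 Fin.elim0 (x := 0) le_rfl
  have e : kern w = ker 0 w := by ext t; simp [ker]
  rw [e]
  simpa [iterKer] using h

theorem analyticAt_ker_zero (a : ℂ) {w : ℂ} (hw : w = 1 ∨ w ∉ Complex.ofReal '' Set.Ici 1) :
    AnalyticAt ℂ (ker a w) 0 :=
  (analyticAt_const.mul analyticAt_id).cexp.mul (analyticAt_kern_zero hw)

theorem eventually_kern_mul {w : ℂ} (hw : w = 1 ∨ w ∉ Complex.ofReal '' Set.Ici 1) :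
    ∀ᶠ t in 𝓝 (0 : ℂ), kern w t * (1 - w * Complex.exp (-t)) = t := by
  rcases eq_or_ne w 1 with h | h
  · subst h
    have : kern 1 0 ≠ 0 := by rw [kern, if_pos rfl, dslope_exp_zero]; simp
    filter_upwards [(analyticAt_kern_zero hw).continuousAt.eventually_ne this] with t ht
    exact kern_mul 1 t (Or.inl ht)
  · have hc : ContinuousAt (fun t : ℂ => w * Complex.exp (-t)) 0 := by fun_prop
    filter_upwards [hc.eventually_ne (show w * Complex.exp (-0) ≠ 1 by simpa using h)] with t ht
    exact kern_mul w t (Or.inr ht)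

theorem rescale_expSeries (c a : ℂ) :
    PowerSeries.rescale c (expSeries a) = expSeries (a * c) := by
  rw [expSeries, expSeries, PowerSeries.rescale_rescale]

/-- Substituting -t turns the kernel into t exp(a t) / (w exp t - 1), the Apostol-Bernoulli
generating function. The identity is multiplied out because the denominator is not an invertible
power series when w = 1. -/
theorem rescale_taylor_ker_mul (a : ℂ) {w : ℂ} (hw : w = 1 ∨ w ∉ Complex.ofReal '' Set.Ici 1) :
    PowerSeries.rescale (-1) (taylor (ker a w)) * (PowerSeries.C w * PowerSeries.exp ℂ - 1)
      = PowerSeries.X * expSeries a := by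
  have hk := analyticAt_kern_zero hw
  have h1 : taylor (ker a w) * (1 - PowerSeries.C w * expSeries (-1))
      = PowerSeries.X * expSeries (-a) := by
    have e1 : taylor (ker a w) = expSeries (-a) * taylor (kern w) := by
      rw [← taylor_exp]
      exact taylor_mul (analyticAt_const.mul analyticAt_id).cexp hk
    have e2 : taylor (kern w) * (1 - PowerSeries.C w * expSeries (-1)) = PowerSeries.X := by
      have h0 : AnalyticAt ℂ (fun t : ℂ => 1 - w * Complex.exp (-t)) 0 :=
        analyticAt_const.sub (analyticAt_const.mul analyticAt_id.neg.cexp)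
      rw [← taylor_one_sub_exp, ← taylor_mul hk h0, ← taylor_id]
      exact taylor_congr (eventually_kern_mul hw)
    rw [e1, mul_assoc, e2, mul_comm]
  have h2 := congrArg (PowerSeries.rescale (-1 : ℂ)) h1
  have h3 : PowerSeries.rescale (-1 : ℂ) (PowerSeries.C w) = PowerSeries.C w := by
    ext n
    rw [PowerSeries.coeff_rescale, PowerSeries.coeff_C]
    split_ifs with hn
    · simp [hn]
    · simp
  have h4 : expSeries 1 = PowerSeries.exp ℂ := by simp [expSeries]
  rw [map_mul, map_mul, map_sub, map_one, map_mul, h3, rescale_expSeries, rescale_expSeries,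
    PowerSeries.rescale_X] at h2
  simp only [neg_mul_neg, mul_one, h4, map_neg, map_one] at h2
  linear_combination -h2

theorem coeff_taylor_ker (a : ℂ) {w : ℂ} (hw : w = 1 ∨ w ∉ Complex.ofReal '' Set.Ici 1) (n : ℕ) :
    PowerSeries.coeff n (taylor (ker a w)) = (-1) ^ n * (apostolBernoulli n a w / (n ! : ℂ)) := by
  -- The two lowest coefficients are w - 1 and w, which are not both zero.
  have hne : (PowerSeries.C w * PowerSeries.exp ℂ - 1 : PowerSeries ℂ) ≠ 0 := by
    intro h0
    have c0 := congrArg (PowerSeries.coeff 0) h0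
    have c1 := congrArg (PowerSeries.coeff 1) h0
    simp [PowerSeries.coeff_one, PowerSeries.coeff_exp] at c0 c1
    simp [c1] at c0
  have hne' : ((PowerSeries.C w * PowerSeries.exp ℂ - 1 : PowerSeries ℂ) : LaurentSeries ℂ) ≠ 0 :=
    fun h0 => hne (HahnSeries.ofPowerSeries_injective (Γ := ℤ) (h0.trans (map_zero _).symm))
  have h1 : ((PowerSeries.X * expSeries a : PowerSeries ℂ) : LaurentSeries ℂ) /
      ((PowerSeries.C w * PowerSeries.exp ℂ - 1 : PowerSeries ℂ) : LaurentSeries ℂ)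
      = (PowerSeries.rescale (-1) (taylor (ker a w)) : PowerSeries ℂ) := by
    rw [div_eq_iff hne', ← rescale_taylor_ker_mul a hw]
    exact map_mul _ _ _
  have hn : (n ! : ℂ) ≠ 0 := by exact_mod_cast n.factorial_ne_zero
  rw [apostolBernoulli, h1, LaurentSeries.coeff_coe_powerSeries, PowerSeries.coeff_rescale,
    mul_div_cancel_left₀ _ hn, ← mul_assoc, ← mul_pow]
  simp

/-- The Beta operator is diagonal on monomials: on t^k it gives (Γ(s) Γ(b))⁻¹ times the Beta
function of s and b + k, and Γ(b + k)/Γ(b) is the rising product. -/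
theorem iteratedDeriv_betaOp_zero {g : ℂ → ℂ} (hg : AnalyticAt ℂ g 0) (s b : ℂ) (k : ℕ) :
    iteratedDeriv k (betaOp s b g) 0 =
      (∏ i ∈ Finset.range k, (b + i)) * (Complex.Gamma (s + b + k))⁻¹ * iteratedDeriv k g 0 := by
  induction k generalizing g b with
  | zero => simp [betaOp_zero_right hg]
  | succ k ih =>
    have hseg : AnalyticOnSegment g 0 := fun v _ => by simpa using hg
    have h1 : deriv (betaOp s b g) =ᶠ[𝓝 0] fun t => b * betaOp s (b + 1) (deriv g) t := by
      filter_upwards [hseg.eventually] with t ht using deriv_betaOp ht s b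
    rw [iteratedDeriv_succ', h1.iteratedDeriv_eq, iteratedDeriv_const_mul_field,
      ih hg.deriv, Finset.prod_range_succ', iteratedDeriv_succ']
    have e : s + (b + 1) + (k : ℂ) = s + b + ((k + 1 : ℕ) : ℂ) := by push_cast; ring
    rw [e]
    have : ∏ i ∈ Finset.range k, (b + ((i + 1 : ℕ) : ℂ)) = ∏ i ∈ Finset.range k, (b + 1 + i) :=
      Finset.prod_congr rfl fun i _ => by push_cast; ring
    rw [this]
    push_cast
    ring

theorem sum_piAntidiag_succ {M : Type*} [AddCommMonoid M] {q : ℕ} (N : ℕ)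
    (F : (Fin (q + 1) → ℕ) → M) :
    ∑ n ∈ Finset.piAntidiag Finset.univ N, F n = ∑ p ∈ Finset.HasAntidiagonal.antidiagonal N,
      ∑ m ∈ Finset.piAntidiag (Finset.univ : Finset (Fin q)) p.2, F (Fin.cons p.1 m) := by
  rw [Finset.sum_sigma']
  refine Finset.sum_bij' (fun n _ => ⟨(n 0, ∑ i : Fin q, n i.succ), fun i => n i.succ⟩)
    (fun x _ => Fin.cons x.1.1 x.2) ?_ ?_ ?_ ?_ ?_
  · intro n hn
    rw [Finset.mem_piAntidiag, Fin.sum_univ_succ] at hn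
    simp [hn.1]
  · rintro ⟨⟨i, k⟩, m⟩ h
    simp only [Finset.mem_sigma, Finset.HasAntidiagonal.mem_antidiagonal, Finset.mem_piAntidiag] at h ⊢
    simp [Fin.sum_univ_succ, h.2.1, h.1]
  · intro n _
    exact Fin.cons_self_tail n
  · rintro ⟨⟨i, k⟩, m⟩ h
    simp only [Finset.mem_sigma, Finset.HasAntidiagonal.mem_antidiagonal, Finset.mem_piAntidiag] at h
    obtain ⟨_, rfl, _⟩ := h
    simp
  · intro n _
    exact congrArg F (Fin.cons_self_tail n).symm

/-- The j-th Beta operator acts on the product of all kernels inside it, so its eigenvalue is taken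
at their total degree `tail n j.succ`. -/
theorem coeff_taylor_iterKer {q : ℕ} (a : Fin (q + 1) → ℂ) {w : Fin (q + 1) → ℂ}
    (hw : Admissible w) (σ b : Fin q → ℂ) (N : ℕ) :
    PowerSeries.coeff N (taylor (iterKer q a w σ b)) =
      ∑ n ∈ Finset.piAntidiag Finset.univ N,
        (∏ j, PowerSeries.coeff (n j) (taylor (ker (a j) (w j)))) *
        ∏ j : Fin q, (∏ i ∈ Finset.range (tail n j.succ), (b j + i)) *
          (Complex.Gamma (σ j + b j + (tail n j.succ : ℕ)))⁻¹ := by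
  induction q generalizing N with
  | zero =>
    rw [show Finset.piAntidiag (Finset.univ : Finset (Fin 1)) N = {fun _ => N} by
      ext n
      simp only [Finset.mem_piAntidiag, Finset.univ_unique, Fin.default_eq_zero, Fin.isValue,
        Finset.sum_singleton, Finset.mem_singleton, funext_iff, Fin.forall_fin_one]
      simp]
    simp [iterKer]
  | succ q ih =>
    set g := iterKer q (fun i => a i.succ) (fun i => w i.succ) (fun i => σ i.succ)
      fun i => b i.succ with hg
    have hga : AnalyticAt ℂ g 0 := by
      have := analyticAt_iterKer (fun i => a i.succ) hw.succ (fun i => σ i.succ)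
        (fun i => b i.succ) (x := 0) le_rfl
      simpa using this
    have hseg : AnalyticOnSegment g 0 := fun v _ => by simpa using hga
    have h1 : taylor (iterKer (q + 1) a w σ b)
        = taylor (ker (a 0) (w 0)) * taylor (betaOp (σ 0) (b 0) g) :=
      taylor_mul (analyticAt_ker_zero _ (hw 0)) (hseg.analyticAt_betaOp _ _)
    rw [h1, PowerSeries.coeff_mul, sum_piAntidiag_succ]
    refine Finset.sum_congr rfl fun p _ => ?_
    have h2 : PowerSeries.coeff p.2 (taylor (betaOp (σ 0) (b 0) g)) =
        (∏ i ∈ Finset.range p.2, (b 0 + i)) * (Complex.Gamma (σ 0 + b 0 + (p.2 : ℕ)))⁻¹ *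
          PowerSeries.coeff p.2 (taylor g) := by
      rw [coeff_taylor, coeff_taylor, iteratedDeriv_betaOp_zero hga, mul_div_assoc]
    rw [h2, ih (fun i => a i.succ) hw.succ, Finset.mul_sum, Finset.mul_sum]
    refine Finset.sum_congr rfl fun m hm => ?_
    have hm' : tail (Fin.cons p.1 m : Fin (q + 2) → ℕ) (Fin.succ 0) = p.2 := by
      rw [tail_succ, tail_zero]
      simpa using (Finset.mem_piAntidiag.1 hm).1
    have ht : ∀ j : Fin q, tail (Fin.cons p.1 m : Fin (q + 2) → ℕ) j.succ.succ = tail m j.succ := by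
      intro j
      rw [tail_succ]
      simp
    rw [Fin.prod_univ_succ (n := q + 1), Fin.prod_univ_succ (n := q) fun j =>
      (∏ i ∈ Finset.range (tail (Fin.cons p.1 m : Fin (q + 2) → ℕ) j.succ), (b j + i)) *
        (Complex.Gamma (σ j + b j +
          (tail (Fin.cons p.1 m : Fin (q + 2) → ℕ) j.succ : ℕ)))⁻¹, hm']
    simp only [ht, Fin.cons_zero, Fin.cons_succ]
    ring

end Taylor

/-! ### A Schwarz lemma for several blocks of variables -/

section Schwarz

open Metric

variable {ι E : Type*} [Fintype ι] [NormedAddCommGroup E] [NormedSpace ℂ E]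

/-- The Schwarz lemma is applied one block at a time with the other blocks held fixed; the bound
obtained from earlier blocks serves as the supremum for the next. -/
theorem norm_le_prod_of_eq_zero [DecidableEq ι] {f : (ι → E) → ℂ} {R M : ℝ} (hR : 0 < R)
    (hd : DifferentiableOn ℂ f (ball 0 R)) (hM : ∀ x ∈ ball 0 R, ‖f x‖ ≤ M) (s : Finset ι)
    (h0 : ∀ i ∈ s, ∀ x, x i = 0 → f x = 0) :
    ∀ x ∈ ball 0 R, ‖f x‖ ≤ M * ∏ i ∈ s, (‖x i‖ / R) := by
  induction s using Finset.induction_on with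
  | empty => simpa using hM
  | insert i s hi ih =>
    intro x hx
    have hx' : ∀ k, ‖x k‖ < R := (pi_norm_lt_iff hR).1 (mem_ball_zero_iff.1 hx)
    have hball : ∀ u ∈ ball (0 : E) R, Function.update x i u ∈ ball 0 R := by
      intro u hu
      rw [mem_ball_zero_iff] at hu ⊢
      refine (pi_norm_lt_iff hR).2 fun k => ?_
      rcases eq_or_ne k i with rfl | hk
      · simpa using hu
      · simpa [hk] using hx' k
    have h1 : DifferentiableOn ℂ (fun u => f (Function.update x i u)) (ball 0 R) := by
      refine hd.comp (fun u _ => ?_) hball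
      refine DifferentiableAt.differentiableWithinAt (differentiableAt_pi.2 fun k => ?_)
      rcases eq_or_ne k i with rfl | hk
      · simp
      · simp [hk]
    have hz : f (Function.update x i 0) = 0 := h0 i (Finset.mem_insert_self i s) _ (by simp)
    have h2 : Set.MapsTo (fun u => f (Function.update x i u)) (ball 0 R)
        (closedBall (f (Function.update x i 0)) (M * ∏ k ∈ s, (‖x k‖ / R))) := by
      intro u hu
      rw [hz, mem_closedBall_zero_iff]
      refine (ih (fun k hk => h0 k (Finset.mem_insert_of_mem hk)) _ (hball u hu)).trans
        (le_of_eq ?_)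
      congr 1
      refine Finset.prod_congr rfl fun k hk => ?_
      have : k ≠ i := fun h => hi (h ▸ hk)
      simp [this]
    have h3 := Complex.dist_le_div_mul_dist_of_mapsTo_ball h1 h2
      (z := x i) (mem_ball_zero_iff.2 (hx' i))
    simp only [Function.update_eq_self, hz, dist_zero_right] at h3
    refine h3.trans (le_of_eq ?_)
    rw [Finset.prod_insert hi]
    ring

theorem isBigO_prod_of_eq_zero {f : (ι → E) → ℂ} (hf : AnalyticAt ℂ f 0)
    (h0 : ∀ i x, x i = 0 → f x = 0) : f =O[𝓝 0] fun x => ∏ i, ‖x i‖ := by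
  classical
  have h1 : ∀ᶠ x in 𝓝 (0 : ι → E), AnalyticAt ℂ f x ∧ ‖f x‖ < ‖f 0‖ + 1 :=
    hf.eventually_analyticAt.and
      (hf.continuousAt.norm.eventually (gt_mem_nhds (lt_add_one ‖f 0‖)))
  obtain ⟨R, hR, hball⟩ := Metric.eventually_nhds_iff_ball.1 h1
  have h2 := norm_le_prod_of_eq_zero hR
    (fun x hx => (hball x hx).1.differentiableAt.differentiableWithinAt)
    (fun x hx => (hball x hx).2.le) Finset.univ fun i _ x => h0 i x
  refine Asymptotics.IsBigO.of_bound ((‖f 0‖ + 1) * ∏ _i : ι, R⁻¹) ?_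
  filter_upwards [ball_mem_nhds 0 hR] with x hx
  refine (h2 x hx).trans (le_of_eq ?_)
  rw [Real.norm_of_nonneg (Finset.prod_nonneg fun i _ => norm_nonneg _), mul_assoc,
    ← Finset.prod_mul_distrib]
  simp only [div_eq_mul_inv, mul_comm]

end Schwarz

/-! ### The reciprocal of the Gamma function at its zeros -/

section GammaFactor

/-- The quotient `Γ(e - m)⁻¹ / e`. -/
def gammaFactor (m : ℕ) (e : ℂ) : ℂ :=
  (∏ i ∈ Finset.range m, (e - (i + 1))) * (Complex.Gamma (e + 1))⁻¹

/-- This isolates the simple zero of 1/Γ at -m; the cofactor is analytic and nonzero at e = 0. -/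
theorem Gamma_inv_eq_gammaFactor (m : ℕ) (e : ℂ) :
    (Complex.Gamma (-(m : ℂ) + e))⁻¹ = e * gammaFactor m e := by
  induction m with
  | zero => simpa [gammaFactor] using Gamma_add_one_inv e
  | succ m ih =>
    rw [Gamma_add_one_inv, show -((m + 1 : ℕ) : ℂ) + e + 1 = -(m : ℂ) + e by push_cast; ring, ih,
      gammaFactor, gammaFactor, Finset.prod_range_succ]
    push_cast; ring

theorem gammaFactor_zero (m : ℕ) : gammaFactor m 0 = (-1) ^ m * (m ! : ℂ) := by
  rw [gammaFactor, zero_add, Complex.Gamma_one, inv_one, mul_one]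
  induction m with
  | zero => simp
  | succ m ih =>
    rw [Finset.prod_range_succ, ih, Nat.factorial_succ]
    push_cast; ring

theorem gammaFactor_zero_ne_zero (m : ℕ) : gammaFactor m 0 ≠ 0 := by
  rw [gammaFactor_zero]
  exact mul_ne_zero (pow_ne_zero _ (by norm_num)) (by exact_mod_cast m.factorial_ne_zero)

theorem analyticAt_gammaFactor (m : ℕ) (e : ℂ) : AnalyticAt ℂ (gammaFactor m) e := by
  refine AnalyticAt.mul (Finset.analyticAt_fun_prod _ fun i _ =>
    analyticAt_id.sub analyticAt_const) ?_
  exact (analyticAt_Gamma_inv (e + 1)).comp_of_eq (f := fun e => e + 1)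
    (analyticAt_id.add analyticAt_const) rfl

theorem mul_Gamma_eq_gammaFactor_inv (m : ℕ) {e : ℂ} (he : e ≠ 0) :
    e * Complex.Gamma (-(m : ℂ) + e) = (gammaFactor m e)⁻¹ := by
  rw [← inv_inv (Complex.Gamma (-(m : ℂ) + e)), Gamma_inv_eq_gammaFactor, mul_inv,
    mul_inv_cancel_left₀ he]

end GammaFactor

/-! ### Approximation up to a small error -/

section Approx

open Asymptotics

variable {α : Type*} {F : Filter α} {ρ : α → ℝ} {u v u' v' : α → ℂ}

/-- `v` is bounded and `u` equals `v` up to `O(ρ)`. -/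
def Approx (F : Filter α) (ρ : α → ℝ) (u v : α → ℂ) : Prop :=
  (fun x => u x - v x) =O[F] ρ ∧ v =O[F] fun _ => (1 : ℝ)

theorem Approx.bounded (hρ : Tendsto ρ F (𝓝 0)) (h : Approx F ρ u v) :
    u =O[F] fun _ => (1 : ℝ) := by
  have := (h.1.trans (hρ.isBigO_one ℝ)).add h.2
  simpa using this

/-- Boundedness of the approximants is what makes approximation up to O(ρ) stable under products. -/
theorem Approx.mul (hρ : Tendsto ρ F (𝓝 0)) (h : Approx F ρ u v) (h' : Approx F ρ u' v') :
    Approx F ρ (fun x => u x * u' x) fun x => v x * v' x := by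
  refine ⟨?_, by simpa using h.2.mul h'.2⟩
  have h1 := h.1.mul (h'.bounded hρ)
  have h2 := h.2.mul h'.1
  simp only [mul_one, one_mul] at h1 h2
  refine (h1.add h2).congr_left fun x => ?_
  ring

theorem Approx.prod {ι : Type*} (hρ : Tendsto ρ F (𝓝 0)) {u v : ι → α → ℂ} (s : Finset ι)
    (h : ∀ i ∈ s, Approx F ρ (u i) (v i)) :
    Approx F ρ (fun x => ∏ i ∈ s, u i x) fun x => ∏ i ∈ s, v i x := by
  classical
  induction s using Finset.induction_on with
  | empty => exact ⟨by simpa using isBigO_zero ρ F, by simpa using isBigO_refl (fun _ => (1 : ℂ)) F⟩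
  | insert i s hi ih =>
    simp only [Finset.prod_insert hi]
    exact (h i (Finset.mem_insert_self i s)).mul hρ
      (ih fun k hk => h k (Finset.mem_insert_of_mem hk))

theorem Approx.congr' (h : Approx F ρ u v) (hu : u =ᶠ[F] u') : Approx F ρ u' v :=
  ⟨h.1.congr' (hu.mono fun x hx => by simp only [hx]) EventuallyEq.rfl, h.2⟩

theorem Approx.const_mul (c : ℂ) (h : Approx F ρ u v) :
    Approx F ρ (fun x => c * u x) fun x => c * v x :=
  ⟨(h.1.const_mul_left c).congr_left fun x => by ring, h.2.const_mul_left c⟩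

/-- A function differentiable at `0`, evaluated at a small quantity. -/
theorem Approx.of_differentiableAt {c : ℂ → ℂ} (hc : DifferentiableAt ℂ c 0) {e : α → ℂ}
    (he : Tendsto e F (𝓝 0)) (heρ : e =O[F] ρ) : Approx F ρ (fun x => c (e x)) fun _ => c 0 := by
  refine ⟨?_, isBigO_const_const _ one_ne_zero _⟩
  have := hc.isBigO_sub.comp_tendsto he
  simp only [Function.comp_def, sub_zero] at this
  exact this.trans heρ

end Approx

/-! ### The asymptotic expansion -/

section Asymptotic

open Asymptotics

variable {q : ℕ}

/-- The continued zeta function, as a Gamma factor times a regularized Mellin transform. -/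
def zetaCont (a s w : Fin (q + 1) → ℂ) : ℂ :=
  (Complex.Gamma (s (Fin.last q)))⁻¹ * (∏ j, Complex.Gamma (bpar s j)) * regMellin (bpar s 0)
    (iterKer q a w (fun j => s j.castSucc) (fun j => bpar s j.succ))

/-- The order of the pole of the Gamma factors: `bpar (-l) j = -lpar l j`. -/
def lpar (l : Fin (q + 1) → ℕ) (j : Fin (q + 1)) : ℕ := tail l j + (q + 1 - j)

theorem lpar_succ (l : Fin (q + 1) → ℕ) (j : Fin q) :
    lpar l j.succ = tail l j.succ + (q - j) := by
  rw [lpar, Fin.val_succ, Nat.add_sub_add_right]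

theorem lpar_zero (l : Fin (q + 1) → ℕ) : lpar l 0 = (∑ i, l i) + (q + 1) := by
  rw [lpar, tail_zero]; simp

theorem bpar_neg_add (l : Fin (q + 1) → ℕ) (ε : Fin (q + 1) → ℂ) (j : Fin (q + 1)) :
    bpar (fun i => -(l i : ℂ) + ε i) j = -(lpar l j : ℂ) + tail ε j := by
  rw [bpar, lpar, tail, tail, tail, Finset.sum_add_distrib, Finset.sum_neg_distrib]
  push_cast
  ring

/-- The admissible perturbations: no partial sum vanishes, and all quotients are bounded. -/
def perturbations (q : ℕ) (K : ℝ) : Set (Fin (q + 1) → ℂ) :=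
  {ε | (∀ j, ε j ≠ 0) ∧ (∀ j, tail ε j ≠ 0) ∧ ∀ j k, j ≤ k → ‖ε k / tail ε j‖ ≤ K}

/-- Admissible perturbations tending to `0`. -/
def pertFilter (q : ℕ) (K : ℝ) : Filter (Fin (q + 1) → ℂ) := 𝓝 0 ⊓ 𝓟 (perturbations q K)

/-- The `ℓ¹` norm. -/
def pertNorm (ε : Fin (q + 1) → ℂ) : ℝ := ∑ j, ‖ε j‖

variable {K : ℝ}

theorem eventually_mem_perturbations : ∀ᶠ ε in pertFilter q K, ε ∈ perturbations q K :=
  mem_inf_of_right (mem_principal_self _)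

theorem tendsto_pertFilter {f : (Fin (q + 1) → ℂ) → ℂ} (hf : Continuous f) (h0 : f 0 = 0) :
    Tendsto f (pertFilter q K) (𝓝 0) := by
  have : Tendsto f (𝓝 0) (𝓝 0) := by simpa [h0] using hf.tendsto 0
  exact this.mono_left inf_le_left

theorem continuous_tail (j : Fin (q + 1)) : Continuous fun ε : Fin (q + 1) → ℂ => tail ε j := by
  unfold tail; fun_prop

theorem tendsto_tail (j : Fin (q + 1)) :
    Tendsto (fun ε : Fin (q + 1) → ℂ => tail ε j) (pertFilter q K) (𝓝 0) :=
  tendsto_pertFilter (continuous_tail j) (by simp [tail])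

theorem tendsto_pertNorm : Tendsto (pertNorm (q := q)) (pertFilter q K) (𝓝 0) := by
  have h : Continuous (pertNorm (q := q)) := by unfold pertNorm; fun_prop
  have : Tendsto (pertNorm (q := q)) (𝓝 0) (𝓝 0) := by
    simpa [pertNorm] using h.tendsto 0
  exact this.mono_left inf_le_left

theorem pertNorm_nonneg (ε : Fin (q + 1) → ℂ) : 0 ≤ pertNorm ε :=
  Finset.sum_nonneg fun _ _ => norm_nonneg _

theorem norm_tail_le (ε : Fin (q + 1) → ℂ) (j : Fin (q + 1)) : ‖tail ε j‖ ≤ pertNorm ε :=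
  (norm_sum_le _ _).trans
    (Finset.sum_le_sum_of_subset_of_nonneg (Finset.subset_univ _) fun _ _ _ => norm_nonneg _)

theorem tail_isBigO (F : Filter (Fin (q + 1) → ℂ)) (j : Fin (q + 1)) :
    (fun ε : Fin (q + 1) → ℂ => tail ε j) =O[F] pertNorm :=
  IsBigO.of_norm_le fun ε => norm_tail_le ε j

theorem norm_le_mul_tail {ε : Fin (q + 1) → ℂ} (hε : ε ∈ perturbations q K) {j k : Fin (q + 1)}
    (h : j ≤ k) : ‖ε k‖ ≤ K * ‖tail ε j‖ := by
  have := hε.2.2 j k h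
  rwa [norm_div, div_le_iff₀ (norm_pos_iff.2 (hε.2.1 j))] at this

theorem norm_tail_le_mul_tail {ε : Fin (q + 1) → ℂ} (hε : ε ∈ perturbations q K)
    {j k : Fin (q + 1)} (h : j ≤ k) : ‖tail ε k‖ ≤ (q + 1) * K * ‖tail ε j‖ := by
  have hK : 0 ≤ K := (norm_nonneg _).trans (hε.2.2 j j le_rfl)
  have h1 : ‖tail ε k‖ ≤ ∑ i ∈ Finset.Ici k, K * ‖tail ε j‖ :=
    (norm_sum_le _ _).trans (Finset.sum_le_sum fun i hi =>
      norm_le_mul_tail hε (h.trans (Finset.mem_Ici.1 hi)))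
  have h2 : ((Finset.Ici k).card : ℝ) ≤ q + 1 := by
    have := Finset.card_le_univ (Finset.Ici k)
    rw [Fintype.card_fin] at this
    exact_mod_cast this
  rw [Finset.sum_const, nsmul_eq_mul] at h1
  refine h1.trans ?_
  rw [mul_assoc]
  exact mul_le_mul_of_nonneg_right h2 (by positivity)

theorem tail_ratio_isBigO (j : Fin q) :
    (fun ε : Fin (q + 1) → ℂ => tail ε j.succ / tail ε j.castSucc) =O[pertFilter q K]
      fun _ => (1 : ℝ) := by
  refine IsBigO.of_bound ((q + 1) * K) ?_
  filter_upwards [eventually_mem_perturbations] with ε hε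
  rw [norm_div, div_le_iff₀ (norm_pos_iff.2 (hε.2.1 _)), norm_one, mul_one]
  exact norm_tail_le_mul_tail hε (Fin.castSucc_le_succ j)

/-- If τ ≤ L, both Gamma functions are at poles, and e₁/e₀ cancels the quotient of the polar
factors. If L < τ ≤ l + L, only the second is at a pole; its reciprocal supplies a factor e₀, and
the whole is O(e₁). If τ > l + L, both are regular and e₁/e₀ remains. -/
theorem approx_gamma_ratio {α : Type*} {F : Filter α} {ρ : α → ℝ} (hρ : Tendsto ρ F (𝓝 0))
    {e₀ e₁ : α → ℂ} (h₀ : Tendsto e₀ F (𝓝 0)) (h₁ : Tendsto e₁ F (𝓝 0)) (hO₀ : e₀ =O[F] ρ)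
    (hO₁ : e₁ =O[F] ρ) (hr : (fun x => e₁ x / e₀ x) =O[F] fun _ => (1 : ℝ))
    (hne₀ : ∀ᶠ x in F, e₀ x ≠ 0) (hne₁ : ∀ᶠ x in F, e₁ x ≠ 0) (l L τ : ℕ) :
    Approx F ρ (fun x => e₁ x / e₀ x * (Complex.Gamma (-(L : ℂ) + e₁ x + τ) *
        (Complex.Gamma (-((l + L : ℕ) : ℂ) + e₀ x + τ))⁻¹))
      (fun x => if τ ≤ L then (-1) ^ l * ((l + L - τ)! : ℂ) / ((L - τ)! : ℂ)
        else if l + L < τ then e₁ x / e₀ x * (((τ - L - 1)! : ℂ) / ((τ - (l + L) - 1)! : ℂ))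
        else 0) := by
  have gam : ∀ (k : ℕ) {e : α → ℂ}, Tendsto e F (𝓝 0) → e =O[F] ρ →
      Approx F ρ (fun x => Complex.Gamma ((k : ℂ) + 1 + e x)) fun _ => (k ! : ℂ) := by
    intro k e he heO
    have hd : DifferentiableAt ℂ (fun e : ℂ => Complex.Gamma ((k : ℂ) + 1 + e)) 0 := by
      refine DifferentiableAt.comp (0 : ℂ) (g := Complex.Gamma)
        (f := fun e : ℂ => (k : ℂ) + 1 + e) (Complex.differentiableAt_Gamma _ fun m h => ?_)
        (by fun_prop)
      have := congrArg Complex.re h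
      simp at this
      have h1 : (0 : ℝ) ≤ k := Nat.cast_nonneg k
      have h2 : (0 : ℝ) ≤ m := Nat.cast_nonneg m
      linarith
    simpa [Complex.Gamma_nat_eq_factorial] using Approx.of_differentiableAt hd he heO
  have gaminv : ∀ (k : ℕ) {e : α → ℂ}, Tendsto e F (𝓝 0) → e =O[F] ρ →
      Approx F ρ (fun x => (Complex.Gamma ((k : ℂ) + 1 + e x))⁻¹) fun _ => ((k ! : ℂ))⁻¹ := by
    intro k e he heO
    have hd : DifferentiableAt ℂ (fun e : ℂ => (Complex.Gamma ((k : ℂ) + 1 + e))⁻¹) 0 :=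
      DifferentiableAt.comp (0 : ℂ) (g := fun z => (Complex.Gamma z)⁻¹)
        (f := fun e : ℂ => (k : ℂ) + 1 + e) (analyticAt_Gamma_inv _).differentiableAt (by fun_prop)
    simpa [Complex.Gamma_nat_eq_factorial] using Approx.of_differentiableAt hd he heO
  have fac : ∀ (m : ℕ) {e : α → ℂ}, Tendsto e F (𝓝 0) → e =O[F] ρ →
      Approx F ρ (fun x => gammaFactor m (e x)) fun _ => (-1) ^ m * (m ! : ℂ) := by
    intro m e he heO
    have := Approx.of_differentiableAt (analyticAt_gammaFactor m 0).differentiableAt he heO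
    rwa [gammaFactor_zero] at this
  by_cases hτ : τ ≤ L
  · simp only [if_pos hτ]
    have hinv : Approx F ρ (fun x => (gammaFactor (L - τ) (e₁ x))⁻¹)
        fun _ => ((-1) ^ (L - τ) * ((L - τ)! : ℂ))⁻¹ := by
      have := Approx.of_differentiableAt (((analyticAt_gammaFactor (L - τ) 0).inv
        (gammaFactor_zero_ne_zero _)).differentiableAt) h₁ hO₁
      simpa [gammaFactor_zero] using this
    have key := hinv.mul hρ (fac (l + L - τ) h₀ hO₀)
    have hval : ((-1) ^ (L - τ) * ((L - τ)! : ℂ))⁻¹ * ((-1) ^ (l + L - τ) * ((l + L - τ)! : ℂ))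
        = (-1) ^ l * ((l + L - τ)! : ℂ) / ((L - τ)! : ℂ) := by
      rw [show l + L - τ = l + (L - τ) by omega, pow_add, mul_inv]
      have h1 : ((-1 : ℂ) ^ (L - τ)) ≠ 0 := pow_ne_zero _ (by norm_num)
      field_simp
    rw [hval] at key
    refine key.congr' ?_
    filter_upwards [hne₀, hne₁] with x hx₀ hx₁
    have e1 : -(L : ℂ) + e₁ x + τ = -((L - τ : ℕ) : ℂ) + e₁ x := by
      rw [Nat.cast_sub hτ]; ring
    have e0 : -((l + L : ℕ) : ℂ) + e₀ x + τ = -((l + L - τ : ℕ) : ℂ) + e₀ x := by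
      rw [Nat.cast_sub (show τ ≤ l + L by omega)]; ring
    rw [e1, e0, Gamma_inv_eq_gammaFactor, ← mul_Gamma_eq_gammaFactor_inv _ hx₁]
    field_simp
  · simp only [if_neg hτ]
    have e1 : ∀ x, -(L : ℂ) + e₁ x + τ = ((τ - L - 1 : ℕ) : ℂ) + 1 + e₁ x := by
      intro x
      rw [Nat.cast_sub (show 1 ≤ τ - L by omega), Nat.cast_sub (show L ≤ τ by omega)]
      push_cast; ring
    by_cases hτ' : l + L < τ
    · simp only [if_pos hτ']
      have e0 : ∀ x, -((l + L : ℕ) : ℂ) + e₀ x + τ = ((τ - (l + L) - 1 : ℕ) : ℂ) + 1 + e₀ x := by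
        intro x
        rw [Nat.cast_sub (show 1 ≤ τ - (l + L) by omega), Nat.cast_sub (show l + L ≤ τ by omega)]
        push_cast; ring
      simp only [e1, e0]
      have hrr : Approx F ρ (fun x => e₁ x / e₀ x) fun x => e₁ x / e₀ x :=
        ⟨by simpa using isBigO_zero ρ F, hr⟩
      simpa only [div_eq_mul_inv] using
        hrr.mul hρ ((gam (τ - L - 1) h₁ hO₁).mul hρ (gaminv (τ - (l + L) - 1) h₀ hO₀))
    · simp only [if_neg hτ']
      have hz : Approx F ρ e₁ fun _ => 0 := ⟨by simpa using hO₁, isBigO_zero _ _⟩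
      have key := hz.mul hρ ((gam (τ - L - 1) h₁ hO₁).mul hρ (fac (l + L - τ) h₀ hO₀))
      simp only [zero_mul] at key
      refine key.congr' ?_
      filter_upwards [hne₀] with x hx₀
      have e0 : -((l + L : ℕ) : ℂ) + e₀ x + τ = -((l + L - τ : ℕ) : ℂ) + e₀ x := by
        rw [Nat.cast_sub (show τ ≤ l + L by omega)]; ring
      rw [e1, e0, Gamma_inv_eq_gammaFactor]
      field_simp

/-- The product of Gamma factors that belongs to the index `n`. -/
def gammaWeight (l n : Fin (q + 1) → ℕ) (ε : Fin (q + 1) → ℂ) : ℂ :=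
  (lpar l 0)! * gammaFactor (l (Fin.last q)) (ε (Fin.last q)) *
    (gammaFactor (lpar l 0) (tail ε 0))⁻¹ *
    ∏ j : Fin q, (tail ε j.succ / tail ε j.castSucc *
      (Complex.Gamma (-(lpar l j.succ : ℂ) + tail ε j.succ + tail n j.succ) *
        (Complex.Gamma (-((l j.castSucc + lpar l j.succ : ℕ) : ℂ) + tail ε j.castSucc
          + tail n j.succ))⁻¹))

/-- The condition on `n` at the index `j` in the definition of the index set. -/
def indexCond (l n : Fin (q + 1) → ℕ) (j : Fin q) (dj : Fin 2) : Prop :=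
  if dj = 0 then tail n j.succ ≤ tail l j.succ + (q - j)
  else tail l j.castSucc + (q - j) < tail n j.succ

instance (l n : Fin (q + 1) → ℕ) (j : Fin q) (dj : Fin 2) : Decidable (indexCond l n j dj) := by
  unfold indexCond; infer_instance

theorem approx_gammaWeight (l n : Fin (q + 1) → ℕ) :
    Approx (pertFilter q K) pertNorm (gammaWeight l n) fun ε =>
      (-1) ^ lpar l 0 * ((-1) ^ l (Fin.last q) * ((l (Fin.last q))! : ℂ) *
        ∏ j, ∑ dj : Fin 2, if indexCond l n j dj then hFactor l n ε j dj else 0) := by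
  have hρ := tendsto_pertNorm (q := q) (K := K)
  have htail := fun j => tendsto_tail (q := q) (K := K) j
  have hO := fun j => tail_isBigO (pertFilter q K) j
  have h1 : Approx (pertFilter q K) pertNorm
      (fun ε => gammaFactor (l (Fin.last q)) (ε (Fin.last q)))
      fun _ => (-1) ^ l (Fin.last q) * ((l (Fin.last q))! : ℂ) := by
    have := Approx.of_differentiableAt
      (analyticAt_gammaFactor (l (Fin.last q)) 0).differentiableAt
      (htail (Fin.last q)) (hO (Fin.last q))
    simpa only [gammaFactor_zero, tail_last] using this
  have h2 : Approx (pertFilter q K) pertNorm (fun ε => (gammaFactor (lpar l 0) (tail ε 0))⁻¹)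
      fun _ => ((-1) ^ lpar l 0 * ((lpar l 0)! : ℂ))⁻¹ := by
    have := Approx.of_differentiableAt (((analyticAt_gammaFactor (lpar l 0) 0).inv
      (gammaFactor_zero_ne_zero _)).differentiableAt) (htail 0) (hO 0)
    simpa [gammaFactor_zero] using this
  have h3 := Approx.prod hρ (Finset.univ : Finset (Fin q)) fun j _ =>
    approx_gamma_ratio hρ (htail j.castSucc) (htail j.succ) (hO _) (hO _)
      (tail_ratio_isBigO j) (eventually_mem_perturbations.mono fun ε hε => hε.2.1 _)
      (eventually_mem_perturbations.mono fun ε hε => hε.2.1 _)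
      (l j.castSucc) (lpar l j.succ) (tail n j.succ)
  have h4 := ((h1.const_mul ((lpar l 0)! : ℂ)).mul hρ h2).mul hρ h3
  convert h4 using 2 with ε ε
  · rfl
  have hN : ((lpar l 0)! : ℂ) ≠ 0 := by exact_mod_cast (lpar l 0).factorial_ne_zero
  have hs : ((-1 : ℂ) ^ lpar l 0)⁻¹ = (-1) ^ lpar l 0 := by
    rw [← inv_pow]; norm_num
  rw [mul_inv, hs]
  -- The two index conditions exclude each other, so at most one summand survives; between the two
  -- ranges neither holds and the limit is 0.
  have hprod : ∀ j : Fin q, (∑ dj : Fin 2, if indexCond l n j dj then hFactor l n ε j dj else 0)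
      = if tail n j.succ ≤ lpar l j.succ then
        (-1) ^ l j.castSucc * ((l j.castSucc + lpar l j.succ - tail n j.succ)! : ℂ) /
          ((lpar l j.succ - tail n j.succ)! : ℂ)
        else if l j.castSucc + lpar l j.succ < tail n j.succ then
          tail ε j.succ / tail ε j.castSucc * (((tail n j.succ - lpar l j.succ - 1)! : ℂ) /
            ((tail n j.succ - (l j.castSucc + lpar l j.succ) - 1)! : ℂ))
        else 0 := by
    intro j
    have hl : tail l j.castSucc + (q - j) = l j.castSucc + lpar l j.succ := by
      rw [lpar_succ, tail_castSucc, add_assoc]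
    rw [Fin.sum_univ_two]
    simp only [indexCond, hFactor, hl, ← lpar_succ, one_ne_zero, if_false, if_true]
    by_cases h : tail n j.succ ≤ lpar l j.succ
    · rw [if_pos h, if_pos h, if_neg (by omega), add_zero]
    · rw [if_neg h, if_neg h, zero_add]
  rw [Finset.prod_congr rfl fun j _ => hprod j]
  field_simp

/-- For fixed `n` the conditions on `d` are independent in `j`, so the sum over `d` is the expansion
of a product of two-term sums. -/
theorem mainTerm_eq (a z : Fin (q + 1) → ℂ) (l : Fin (q + 1) → ℕ) (ε : Fin (q + 1) → ℂ) :
    mainTerm a z l ε = ∑ n ∈ Finset.piAntidiag Finset.univ (lpar l 0),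
      (∏ j, apostolBernoulli (n j) (a j) (z j) / ((n j)! : ℂ)) *
      ((-1) ^ lpar l 0 * ((-1) ^ l (Fin.last q) * ((l (Fin.last q))! : ℂ) *
        ∏ j, ∑ dj : Fin 2, if indexCond l n j dj then hFactor l n ε j dj else 0)) := by
  have h1 : ∀ n : Fin (q + 1) → ℕ,
      (∏ j, ∑ dj : Fin 2, if indexCond l n j dj then hFactor l n ε j dj else 0)
      = ∑ d : Fin q → Fin 2, if ∀ j, indexCond l n j (d j) then ∏ j, hFactor l n ε j (d j)
        else 0 := by
    intro n
    rw [Finset.prod_univ_sum, Fintype.piFinset_univ]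
    refine Finset.sum_congr rfl fun d _ => ?_
    rw [Finset.prod_ite_zero]
    simp
  simp only [h1, Finset.mul_sum]
  rw [Finset.sum_comm, mainTerm, Finset.mul_sum, ← lpar_zero]
  refine Finset.sum_congr rfl fun d _ => ?_
  rw [indexSet, ← lpar_zero, Finset.sum_filter, Finset.mul_sum]
  refine Finset.sum_congr rfl fun n _ => ?_
  by_cases h : ∀ j, indexCond l n j (d j)
  · rw [if_pos h, if_pos (by simpa only [indexCond] using h), hWeight]; ring
  · rw [if_neg h, if_neg (by simpa only [indexCond] using h)]; ring

theorem Gamma_mul_prod_range {b : ℂ} (hb : ∀ i : ℕ, b + i ≠ 0) (k : ℕ) :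
    Complex.Gamma b * ∏ i ∈ Finset.range k, (b + i) = Complex.Gamma (b + k) := by
  induction k with
  | zero => simp
  | succ k ih =>
    rw [Finset.prod_range_succ, ← mul_assoc, ih, mul_comm, ← Complex.Gamma_add_one _ (hb k)]
    push_cast; ring_nf

theorem neg_nat_add_ne_zero {e : ℂ} (he : e ≠ 0) (he' : ‖e‖ < 1) (L i : ℕ) :
    -(L : ℂ) + e + i ≠ 0 := by
  intro h
  have h1 : e = ((L - i : ℤ) : ℂ) := by push_cast; linear_combination h
  rw [h1, Complex.norm_intCast] at he'
  have h2 : |(L - i : ℤ)| < 1 := by exact_mod_cast he'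
  rw [Int.abs_lt_one_iff] at h2
  rw [h1, h2] at he
  simp at he

/-- With the first exponent frozen at a nonpositive integer the formula is exact: a Taylor
coefficient of the iterated kernel, with the poles of the prefactor distributed over the Gamma
quotients. -/
theorem regMellin_main {a z : Fin (q + 1) → ℂ} (hz : Admissible z) (l : Fin (q + 1) → ℕ)
    {ε : Fin (q + 1) → ℂ} (hε : ∀ j, tail ε j ≠ 0) (hε1 : ∀ j, ‖tail ε j‖ < 1) :
    (Complex.Gamma (-(l (Fin.last q) : ℂ) + ε (Fin.last q)))⁻¹ *
      (∏ j, Complex.Gamma (-(lpar l j : ℂ) + tail ε j)) * regMellin (-(lpar l 0 : ℂ))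
      (iterKer q a z (fun j => -(l j.castSucc : ℂ) + ε j.castSucc)
        (fun j => -(lpar l j.succ : ℂ) + tail ε j.succ)) =
    ∑ n ∈ Finset.piAntidiag Finset.univ (lpar l 0),
      (∏ j, apostolBernoulli (n j) (a j) (z j) / ((n j)! : ℂ)) * gammaWeight l n ε := by
  have hN : ((lpar l 0)! : ℂ) ≠ 0 := by exact_mod_cast (lpar l 0).factorial_ne_zero
  rw [regMellin_neg_nat (fun x hx => analyticAt_iterKer a hz _ _ hx)]
  have h1 := coeff_taylor_iterKer a hz (fun j => -(l j.castSucc : ℂ) + ε j.castSucc)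
    (fun j => -(lpar l j.succ : ℂ) + tail ε j.succ) (lpar l 0)
  rw [coeff_taylor, div_eq_iff hN] at h1
  rw [h1, Finset.sum_mul, Finset.mul_sum, Finset.mul_sum]
  refine Finset.sum_congr rfl fun n hn => ?_
  have hsum : ∑ j, n j = lpar l 0 := (Finset.mem_piAntidiag.1 hn).1
  have h2 : ∏ j, PowerSeries.coeff (n j) (taylor (ker (a j) (z j))) =
      (-1) ^ lpar l 0 * ∏ j, apostolBernoulli (n j) (a j) (z j) / ((n j)! : ℂ) := by
    rw [← hsum, ← Finset.prod_pow_eq_pow_sum, ← Finset.prod_mul_distrib]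
    exact Finset.prod_congr rfl fun j _ => coeff_taylor_ker _ (hz j) _
  have hlast : ε (Fin.last q) = tail ε (Fin.last q) := (tail_last ε).symm
  -- The zero ε_r of 1/Γ(s_r) telescopes as ε(1, r) ∏ ε(j+1, r)/ε(j, r). The first factor cancels
  -- the pole of Γ(b_1); the others are the ratios in `gammaWeight`.
  have htel : tail ε 0 * ∏ j : Fin q, (tail ε j.succ / tail ε j.castSucc) = ε (Fin.last q) := by
    rw [Finset.prod_div_distrib, hlast]
    have e1 := Fin.prod_univ_succ fun j => tail ε j
    have e2 := Fin.prod_univ_castSucc fun j => tail ε j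
    have hne : ∏ j : Fin q, tail ε j.castSucc ≠ 0 := Finset.prod_ne_zero_iff.2 fun j _ => hε _
    rw [mul_div_assoc', div_eq_iff hne, ← e1, e2, mul_comm]
  have h3 : (∏ j : Fin q, Complex.Gamma (-(lpar l j.succ : ℂ) + tail ε j.succ)) *
      ∏ j : Fin q, ((∏ i ∈ Finset.range (tail n j.succ), (-(lpar l j.succ : ℂ) + tail ε j.succ + i)) *
        (Complex.Gamma (-(l j.castSucc : ℂ) + ε j.castSucc +
          (-(lpar l j.succ : ℂ) + tail ε j.succ) + (tail n j.succ : ℕ)))⁻¹) =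
      ∏ j : Fin q, (Complex.Gamma (-(lpar l j.succ : ℂ) + tail ε j.succ + tail n j.succ) *
        (Complex.Gamma (-((l j.castSucc + lpar l j.succ : ℕ) : ℂ) + tail ε j.castSucc
          + tail n j.succ))⁻¹) := by
    rw [← Finset.prod_mul_distrib]
    refine Finset.prod_congr rfl fun j _ => ?_
    rw [← mul_assoc, Gamma_mul_prod_range
      (fun i => neg_nat_add_ne_zero (hε j.succ) (hε1 j.succ) _ i), tail_castSucc ε]
    congr 3
    push_cast; ring
  have hG0 := mul_Gamma_eq_gammaFactor_inv (lpar l 0) (hε 0)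
  have hw : gammaWeight l n ε = (lpar l 0)! * gammaFactor (l (Fin.last q)) (ε (Fin.last q)) *
      (gammaFactor (lpar l 0) (tail ε 0))⁻¹ *
      ((∏ j : Fin q, (tail ε j.succ / tail ε j.castSucc)) *
      ((∏ j : Fin q, Complex.Gamma (-(lpar l j.succ : ℂ) + tail ε j.succ)) *
      ∏ j : Fin q, ((∏ i ∈ Finset.range (tail n j.succ),
        (-(lpar l j.succ : ℂ) + tail ε j.succ + i)) *
        (Complex.Gamma (-(l j.castSucc : ℂ) + ε j.castSucc +
          (-(lpar l j.succ : ℂ) + tail ε j.succ) + (tail n j.succ : ℕ)))⁻¹))) := by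
    rw [h3, gammaWeight, Finset.prod_mul_distrib]
  rw [hw, h2, Fin.prod_univ_succ, Gamma_inv_eq_gammaFactor, ← hG0]
  -- The sign from the derivative formula for the Mellin transform cancels the signs of the kernel
  -- coefficients.
  have hsq : ((-1 : ℂ) ^ lpar l 0) * (-1) ^ lpar l 0 = 1 := by
    rw [← mul_pow]; norm_num
  nth_rewrite 1 [← htel]
  linear_combination (tail ε 0 * (∏ j : Fin q, (tail ε j.succ / tail ε j.castSucc)) *
    gammaFactor (l (Fin.last q)) (ε (Fin.last q)) *
    Complex.Gamma (-(lpar l 0 : ℂ) + tail ε 0) *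
    (∏ j : Fin q, Complex.Gamma (-(lpar l j.succ : ℂ) + tail ε j.succ)) *
    (∏ j, apostolBernoulli (n j) (a j) (z j) / ((n j)! : ℂ)) *
    (∏ j : Fin q, ((∏ i ∈ Finset.range (tail n j.succ),
      (-(lpar l j.succ : ℂ) + tail ε j.succ + i)) *
        (Complex.Gamma (-(l j.castSucc : ℂ) + ε j.castSucc +
          (-(lpar l j.succ : ℂ) + tail ε j.succ) + (tail n j.succ : ℕ)))⁻¹)) *
    ((lpar l 0)! : ℂ)) * hsq

/-- The error in replacing the first exponent by its limit, as a function of independent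
perturbations of the first exponent and of the pairs of parameters of the iterated kernel. -/
def mellinError (a z : Fin (q + 1) → ℂ) (l : Fin (q + 1) → ℕ) (x : Fin (q + 1) → ℂ × ℂ) : ℂ :=
  regMellin (-(lpar l 0 : ℂ) + (x 0).1)
    (iterKer q a z (fun j => -(l j.castSucc : ℂ) + (x j.succ).1)
      (fun j => -(lpar l j.succ : ℂ) + (x j.succ).2)) -
  regMellin (-(lpar l 0 : ℂ))
    (iterKer q a z (fun j => -(l j.castSucc : ℂ) + (x j.succ).1)
      (fun j => -(lpar l j.succ : ℂ) + (x j.succ).2))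

theorem analyticAt_mellinError {a z : Fin (q + 1) → ℂ} (hz : Admissible z)
    (ha : ∀ j, 0 < (∑ i ∈ Finset.Iic j, a i).re) (l : Fin (q + 1) → ℕ) :
    AnalyticAt ℂ (mellinError a z l) 0 := by
  have hρ : -decayRate q a < 0 := by
    have := add_decayRate_pos (a := a) (y := 0) fun j => by simpa using ha j
    linarith
  have hfst : ∀ i, AnalyticAt ℂ (fun x : Fin (q + 1) → ℂ × ℂ => (x i).1) 0 := fun i =>
    ((ContinuousLinearMap.fst ℂ ℂ ℂ).comp
      (ContinuousLinearMap.proj i : (Fin (q + 1) → ℂ × ℂ) →L[ℂ] ℂ × ℂ)).analyticAt 0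
  have hsnd : ∀ i, AnalyticAt ℂ (fun x : Fin (q + 1) → ℂ × ℂ => (x i).2) 0 := fun i =>
    ((ContinuousLinearMap.snd ℂ ℂ ℂ).comp
      (ContinuousLinearMap.proj i : (Fin (q + 1) → ℂ × ℂ) →L[ℂ] ℂ × ℂ)).analyticAt 0
  have htame := tameAt_iterKer (p₀ := (0 : Fin (q + 1) → ℂ × ℂ)) a (w := fun _ => z)
    (σ := fun x j => -(l j.castSucc : ℂ) + (x j.succ).1)
    (b := fun x j => -(lpar l j.succ : ℂ) + (x j.succ).2) (fun j => hz.admissibleAt _ j)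
    (fun j => analyticAt_const.add (hfst j.succ)) fun j => analyticAt_const.add (hsnd j.succ)
  exact (analyticAt_regMellin htame hρ (analyticAt_const.add (hfst 0))).sub
    (analyticAt_regMellin htame hρ analyticAt_const)

/-- For the first block the two Mellin transforms coincide; for a later one a Beta operator has two
nonpositive integer exponents, so the iterated kernel is zero on the half-line. -/
theorem mellinError_eq_zero (a : Fin (q + 1) → ℂ) {z : Fin (q + 1) → ℂ} (hz : Admissible z)
    (l : Fin (q + 1) → ℕ) (i : Fin (q + 1)) (x : Fin (q + 1) → ℂ × ℂ) (hx : x i = 0) :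
    mellinError a z l x = 0 := by
  revert hx
  refine Fin.cases (fun hx => ?_) (fun j hx => ?_) i
  · simp [mellinError, hx]
  · have h := fun b => regMellin_eq_zero
      (fun t ht => analyticAt_iterKer a hz (fun j => -(l j.castSucc : ℂ) + (x j.succ).1)
        (fun j => -(lpar l j.succ : ℂ) + (x j.succ).2) ht)
      (fun t ht => iterKer_eq_zero a hz (j := j) (l := l j.castSucc) (m := lpar l j.succ)
        (by simp [hx]) (by simp [hx]) ht) b
    rw [mellinError, h, h, sub_zero]

/-- Each Γ(b_j) contributes a simple pole in ε(j, r); the one for j = r is cancelled by the zero of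
1/Γ(s_r), since ε(r, r) = ε_r. -/
theorem gammaPrefactor_isBigO (l : Fin (q + 1) → ℕ) :
    (fun ε : Fin (q + 1) → ℂ => (Complex.Gamma (-(l (Fin.last q) : ℂ) + ε (Fin.last q)))⁻¹ *
      (∏ j, Complex.Gamma (-(lpar l j : ℂ) + tail ε j))) =O[pertFilter q K]
      fun ε => ∏ j : Fin q, ‖tail ε j.castSucc‖⁻¹ := by
  have hρ := tendsto_pertNorm (q := q) (K := K)
  have h1 : Approx (pertFilter q K) pertNorm
      (fun ε => gammaFactor (l (Fin.last q)) (tail ε (Fin.last q)) *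
        ∏ j, (gammaFactor (lpar l j) (tail ε j))⁻¹)
      fun _ => gammaFactor (l (Fin.last q)) 0 * ∏ j, (gammaFactor (lpar l j) 0)⁻¹ :=
    (Approx.of_differentiableAt (analyticAt_gammaFactor _ 0).differentiableAt
      (tendsto_tail _) (tail_isBigO _ _)).mul hρ (Approx.prod hρ _ fun j _ =>
        Approx.of_differentiableAt (c := fun e => (gammaFactor (lpar l j) e)⁻¹)
          ((analyticAt_gammaFactor _ 0).inv (gammaFactor_zero_ne_zero _)).differentiableAt
          (tendsto_tail _) (tail_isBigO _ _))
  have h2 := (h1.bounded hρ).norm_left.mul (isBigO_refl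
    (fun ε : Fin (q + 1) → ℂ => ∏ j : Fin q, ‖tail ε j.castSucc‖⁻¹) (pertFilter q K))
  simp only [one_mul] at h2
  refine IsBigO.trans (IsBigO.of_norm_eventuallyLE ?_) h2
  filter_upwards [eventually_mem_perturbations] with ε hε
  refine le_of_eq ?_
  have h3 : ∀ j, Complex.Gamma (-(lpar l j : ℂ) + tail ε j)
      = (tail ε j)⁻¹ * (gammaFactor (lpar l j) (tail ε j))⁻¹ := fun j => by
    rw [← mul_Gamma_eq_gammaFactor_inv _ (hε.2.1 j), inv_mul_cancel_left₀ (hε.2.1 j)]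
  rw [Gamma_inv_eq_gammaFactor, Finset.prod_congr rfl fun j _ => h3 j, Finset.prod_mul_distrib,
    Fin.prod_univ_castSucc (fun j => (tail ε j)⁻¹), tail_last]
  have h4 := hε.1 (Fin.last q)
  have h5 : ‖ε (Fin.last q)‖ ≠ 0 := norm_ne_zero_iff.2 h4
  simp only [norm_mul, norm_prod, norm_inv]
  field_simp

theorem mellinError_isBigO {a z : Fin (q + 1) → ℂ} (hz : Admissible z)
    (ha : ∀ j, 0 < (∑ i ∈ Finset.Iic j, a i).re) (l : Fin (q + 1) → ℕ) :
    (fun ε : Fin (q + 1) → ℂ => (Complex.Gamma (-(l (Fin.last q) : ℂ) + ε (Fin.last q)))⁻¹ *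
      (∏ j, Complex.Gamma (-(lpar l j : ℂ) + tail ε j)) * mellinError a z l
        (Fin.cons (tail ε 0, 0) fun j : Fin q => (ε j.castSucc, tail ε j.succ)))
      =O[pertFilter q K] pertNorm := by
  -- The second entry of block 0 is a dummy: the outer Mellin transform has only one exponent to
  -- perturb.
  let X : (Fin (q + 1) → ℂ) → Fin (q + 1) → ℂ × ℂ := fun ε =>
    Fin.cons (tail ε 0, 0) fun j : Fin q => (ε j.castSucc, tail ε j.succ)
  have hX : Tendsto X (pertFilter q K) (𝓝 0) := by
    have hc : Continuous X := by
      refine continuous_pi fun i => ?_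
      refine Fin.cases ?_ (fun j => ?_) i
      · exact (continuous_tail 0).prodMk continuous_const
      · exact (continuous_apply _).prodMk (continuous_tail _)
    have h0 : X 0 = 0 := by
      ext1 i
      refine Fin.cases ?_ (fun j => ?_) i
      · simp [X, tail]
      · simp [X, tail]
    have : Tendsto X (𝓝 0) (𝓝 0) := by simpa [h0] using hc.tendsto 0
    exact this.mono_left inf_le_left
  have h1 := (isBigO_prod_of_eq_zero (analyticAt_mellinError hz ha l)
    (mellinError_eq_zero a hz l)).comp_tendsto hX
  refine ((gammaPrefactor_isBigO l).mul h1).trans ?_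
  -- Block j + 1 holds ε_j and ε(j+1, r), at most K and (q + 1) K times |ε(j, r)|. So it absorbs the
  -- j-th pole, and only block 0 is left to give the rate.
  refine IsBigO.of_bound (∏ _j : Fin q, (K + (q + 1) * K)) ?_
  filter_upwards [eventually_mem_perturbations] with ε hε
  have hK : 0 ≤ K := (norm_nonneg _).trans (hε.2.2 0 0 le_rfl)
  have hb : ∀ j : Fin q, ‖tail ε j.castSucc‖⁻¹ * ‖X ε j.succ‖ ≤ K + (q + 1) * K := by
    intro j
    have h2 := norm_pos_iff.2 (hε.2.1 j.castSucc)
    rw [inv_mul_le_iff₀ h2]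
    simp only [X, Fin.cons_succ, Prod.norm_mk]
    refine (max_le_add_of_nonneg (norm_nonneg _) (norm_nonneg _)).trans ?_
    have h3 := norm_le_mul_tail hε (le_refl j.castSucc)
    have h4 := norm_tail_le_mul_tail hε (Fin.castSucc_le_succ j)
    nlinarith
  have h0 : ‖X ε 0‖ ≤ pertNorm ε := by
    simpa [X] using norm_tail_le ε 0
  rw [Function.comp, Fin.prod_univ_succ, mul_left_comm, ← Finset.prod_mul_distrib, norm_mul,
    norm_norm, mul_comm]
  rw [Real.norm_of_nonneg (Finset.prod_nonneg fun j _ => by positivity),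
    Real.norm_of_nonneg (pertNorm_nonneg ε)]
  refine mul_le_mul (Finset.prod_le_prod (fun j _ => by positivity) fun j _ => hb j) h0
    (norm_nonneg _) (Finset.prod_nonneg fun j _ => by positivity)

theorem zetaCont_sub_mainTerm_isBigO {a z : Fin (q + 1) → ℂ} (hz : Admissible z)
    (ha : ∀ j, 0 < (∑ i ∈ Finset.Iic j, a i).re) (l : Fin (q + 1) → ℕ) :
    (fun ε => zetaCont a (fun j => -(l j : ℂ) + ε j) z - mainTerm a z l ε)
      =O[pertFilter q K] pertNorm := by
  have h1 : (fun ε => ∑ n ∈ Finset.piAntidiag Finset.univ (lpar l 0),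
      (∏ j, apostolBernoulli (n j) (a j) (z j) / ((n j)! : ℂ)) * (gammaWeight l n ε -
      ((-1) ^ lpar l 0 * ((-1) ^ l (Fin.last q) * ((l (Fin.last q))! : ℂ) *
        ∏ j, ∑ dj : Fin 2, if indexCond l n j dj then hFactor l n ε j dj else 0))))
      =O[pertFilter q K] pertNorm :=
    IsBigO.fun_sum fun n _ => (approx_gammaWeight l n).1.const_mul_left _
  have hsmall : ∀ᶠ ε in pertFilter q K, ∀ j : Fin (q + 1), ‖tail ε j‖ < 1 := by
    refine eventually_all.2 fun j => ?_
    have := (tendsto_tail (q := q) (K := K) j).norm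
    rw [norm_zero] at this
    exact this.eventually (gt_mem_nhds one_pos)
  refine ((mellinError_isBigO hz ha l).add h1).congr' ?_ EventuallyEq.rfl
  filter_upwards [eventually_mem_perturbations, hsmall] with ε hε hε1
  have hmain := regMellin_main (a := a) hz l hε.2.1 hε1
  rw [mainTerm_eq]
  simp only [mul_sub, Finset.sum_sub_distrib]
  rw [← hmain, zetaCont, mellinError]
  simp only [bpar_neg_add, Fin.cons_zero, Fin.cons_succ]
  ring

end Asymptotic

/-! ### The meromorphic continuation -/

section Continuation

variable {q : ℕ} {Q : Finset (Fin (q + 1))}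

theorem isClosed_ofReal_Ici_one : IsClosed (Complex.ofReal '' Set.Ici 1) :=
  Complex.isometry_ofReal.isClosedEmbedding.isClosedMap _ isClosed_Ici

theorem isOpen_contDomain : IsOpen (contDomain Q) := by
  have : contDomain Q = ⋂ j, {x | x.2 j ∈ (Complex.ofReal '' Set.Ici 1)ᶜ} := by
    ext x; simp [contDomain]
  rw [this]
  exact isOpen_iInter_of_finite fun j =>
    isClosed_ofReal_Ici_one.isOpen_compl.preimage (by fun_prop)

/-- The domain is star-shaped about 0: if t w lies in [1, ∞) with 0 < t ≤ 1, then so does w. -/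
theorem isPreconnected_contDomain : IsPreconnected (contDomain Q) := by
  have hstar : StarConvex ℝ 0 (contDomain Q) := by
    rw [starConvex_zero_iff]
    rintro x hx t ht0 ht1 j ⟨r, hr, hrt⟩
    have hr1 : (1 : ℝ) ≤ r := hr
    have ht : t ≠ 0 := by
      rintro rfl
      simp at hrt
      linarith
    have htpos : 0 < t := lt_of_le_of_ne ht0 (Ne.symm ht)
    refine hx j ⟨r / t, ?_, ?_⟩
    · rw [Set.mem_Ici, le_div_iff₀ htpos]; linarith
    · have h1 : (r : ℂ) = t * x.2 j := by simpa using hrt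
      have h2 : (t : ℂ) ≠ 0 := by exact_mod_cast ht
      rw [Complex.ofReal_div, h1, mul_div_cancel_left₀ _ h2]
  have h0 : (0 : Vars Q) ∈ contDomain Q := fun j => by
    rintro ⟨r, hr, h⟩
    simp only [Prod.snd_zero, Pi.zero_apply, Complex.ofReal_eq_zero] at h
    rw [h] at hr
    exact absurd hr (by simp)
  exact (hstar.isPathConnected h0).isConnected.isPreconnected

theorem admissible_fillOne {x : Vars Q} (hx : x ∈ contDomain Q) : Admissible (fillOne Q x.2) := by
  intro j
  by_cases hj : j ∈ Q
  · exact Or.inl (by simp [fillOne, hj])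
  · exact Or.inr (by simpa [fillOne, hj] using hx ⟨j, hj⟩)

theorem admissibleAt_fillOne {x : Vars Q} (hx : x ∈ contDomain Q) (j : Fin (q + 1)) :
    AdmissibleAt (fun y : Vars Q => fillOne Q y.2 j) x := by
  by_cases hj : j ∈ Q
  · exact Or.inl (by ext y; simp [fillOne, hj])
  · refine Or.inr ⟨?_, by simpa [fillOne, hj] using hx ⟨j, hj⟩⟩
    have e : (fun y : Vars Q => fillOne Q y.2 j) = fun y => y.2 ⟨j, hj⟩ := by
      ext y; simp [fillOne, hj]
    rw [e]
    exact ((ContinuousLinearMap.proj (⟨j, hj⟩ : {j // j ∉ Q}) :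
      ({j // j ∉ Q} → ℂ) →L[ℂ] ℂ).comp (ContinuousLinearMap.snd ℂ _ _)).analyticAt x

theorem analyticAt_fst_apply (j : Fin (q + 1)) (x : Vars Q) :
    AnalyticAt ℂ (fun y : Vars Q => y.1 j) x :=
  ((ContinuousLinearMap.proj j : (Fin (q + 1) → ℂ) →L[ℂ] ℂ).comp
    (ContinuousLinearMap.fst ℂ _ _)).analyticAt x

theorem analyticAt_bpar (j : Fin (q + 1)) (x : Vars Q) :
    AnalyticAt ℂ (fun y : Vars Q => bpar y.1 j) x :=
  (Finset.analyticAt_fun_sum _ fun i _ => analyticAt_fst_apply i x).sub analyticAt_const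

/-- The numerator of the continued zeta function. -/
def contNum (a : Fin (q + 1) → ℂ) (x : Vars Q) : ℂ :=
  (Complex.Gamma (x.1 (Fin.last q)))⁻¹ * regMellin (bpar x.1 0)
    (iterKer q a (fillOne Q x.2) (fun j => x.1 j.castSucc) (fun j => bpar x.1 j.succ))

/-- The denominator of the continued zeta function. -/
def contDen (x : Vars Q) : ℂ := ∏ j, (Complex.Gamma (bpar x.1 j))⁻¹

theorem zetaCont_eq_div (a : Fin (q + 1) → ℂ) (x : Vars Q) :
    zetaCont a x.1 (fillOne Q x.2) = contNum a x / contDen x := by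
  rw [zetaCont, contNum, contDen, Finset.prod_inv_distrib, div_inv_eq_mul]
  ring

theorem analyticAt_contDen (x : Vars Q) : AnalyticAt ℂ (contDen (Q := Q)) x :=
  Finset.analyticAt_fun_prod _ fun j _ =>
    (analyticAt_Gamma_inv _).comp_of_eq (f := fun y : Vars Q => bpar y.1 j) (analyticAt_bpar j x) rfl

theorem analyticAt_contNum {a : Fin (q + 1) → ℂ}
    (ha : ∀ j, 0 < (∑ i ∈ Finset.Iic j, a i).re) {x : Vars Q} (hx : x ∈ contDomain Q) :
    AnalyticAt ℂ (contNum (Q := Q) a) x := by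
  have hρ : -decayRate q a < 0 := by
    have := add_decayRate_pos (a := a) (y := 0) fun j => by simpa using ha j
    linarith
  have htame := tameAt_iterKer (p₀ := x) a (w := fun y => fillOne Q y.2)
    (σ := fun y j => y.1 j.castSucc) (b := fun y j => bpar y.1 j.succ)
    (fun j => admissibleAt_fillOne hx j) (fun j => analyticAt_fst_apply _ x)
    fun j => analyticAt_bpar _ x
  exact ((analyticAt_Gamma_inv _).comp_of_eq (f := fun y : Vars Q => y.1 (Fin.last q))
    (analyticAt_fst_apply _ x) rfl).mul (analyticAt_regMellin htame hρ (analyticAt_bpar 0 x))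

theorem contDen_ne_zero_of_re {x : Vars Q} (hx : ∀ j, 1 < (x.1 j).re) : contDen x ≠ 0 :=
  Finset.prod_ne_zero_iff.2 fun j _ =>
    inv_ne_zero (Complex.Gamma_ne_zero_of_re_pos (bpar_re_pos hx j))

theorem frequently_contDen_ne_zero (x : Vars Q) : ∃ᶠ y in 𝓝 x, contDen y ≠ 0 := by
  intro h
  simp only [not_not] at h
  -- A locally vanishing denominator would vanish everywhere, but at s = (2, …, 2) it does not.
  have h0 := AnalyticOnNhd.eqOn_zero_of_preconnected_of_eventuallyEq_zero
    (fun y _ => analyticAt_contDen y) isPreconnected_univ (Set.mem_univ x) h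
    (Set.mem_univ ((fun _ => 2, 0) : Vars Q))
  exact contDen_ne_zero_of_re (fun j => by simp) h0

theorem isMeromorphicAt_zetaCont {a : Fin (q + 1) → ℂ}
    (ha : ∀ j, 0 < (∑ i ∈ Finset.Iic j, a i).re) {x : Vars Q} (hx : x ∈ contDomain Q) :
    IsMeromorphicAt (fun y : Vars Q => zetaCont a y.1 (fillOne Q y.2)) x :=
  ⟨contNum a, contDen, analyticAt_contNum ha hx, analyticAt_contDen x,
    frequently_contDen_ne_zero x, Eventually.of_forall fun y _ => zetaCont_eq_div a y⟩

theorem analyticAt_zetaCont {a : Fin (q + 1) → ℂ}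
    (ha : ∀ j, 0 < (∑ i ∈ Finset.Iic j, a i).re) {x : Vars Q} (hx : x ∈ contDomain Q)
    (h0 : contDen x ≠ 0) :
    AnalyticAt ℂ (fun y : Vars Q => zetaCont a y.1 (fillOne Q y.2)) x := by
  simp only [zetaCont_eq_div]
  exact (analyticAt_contNum ha hx).div (analyticAt_contDen x) h0

theorem hasSum_zetaCont {a : Fin (q + 1) → ℂ}
    (ha : ∀ j, 0 < (∑ i ∈ Finset.Iic j, a i).re) {x : Vars Q} (hx : x ∈ contDomain Q)
    (hs : ∀ j, 1 < (x.1 j).re) (hw : ∀ j, ‖x.2 j‖ ≤ 1) :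
    HasSum (zetaTerm x.1 a (fillOne Q x.2)) (zetaCont a x.1 (fillOne Q x.2)) := by
  refine hasSum_zetaTerm hs (fun j => ?_) (admissible_fillOne hx) ha
  by_cases hj : j ∈ Q
  · simp [fillOne, hj]
  · simpa [fillOne, hj] using hw ⟨j, hj⟩

theorem isZetaContinuation_corrected {a : Fin (q + 1) → ℂ}
    (ha : ∀ j, 0 < (∑ i ∈ Finset.Iic j, a i).re) :
    IsZetaContinuation a Q (corrected fun y : Vars Q => zetaCont a y.1 (fillOne Q y.2)) where
  meromorphic := isMeromorphicOn_corrected fun _ hx => isMeromorphicAt_zetaCont ha hx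
  hasSum := fun x hx hs hw => by
    rw [corrected_eq_self (analyticAt_zetaCont ha hx (contDen_ne_zero_of_re hs))]
    exact hasSum_zetaCont ha hx hs fun j => (hw j).2

theorem notMem_ofReal_Ici_of_norm_lt_one {w : ℂ} (hw : ‖w‖ < 1) :
    w ∉ Complex.ofReal '' Set.Ici 1 := by
  rintro ⟨r, hr, rfl⟩
  have hr1 : (1 : ℝ) ≤ r := hr
  rw [Complex.norm_real, Real.norm_eq_abs, abs_of_nonneg (by linarith)] at hw
  linarith

/-- Both functions are the sum of the series near one point, so they agree generically on the
connected domain. Where the denominator is nonzero the explicit one is analytic, and the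
removable-value convention makes the agreement exact. -/
theorem IsZetaContinuation.eventuallyEq {a : Fin (q + 1) → ℂ}
    (ha : ∀ j, 0 < (∑ i ∈ Finset.Iic j, a i).re) {Z : Vars Q → ℂ}
    (hZ : IsZetaContinuation a Q Z) {x : Vars Q} (hx : x ∈ contDomain Q) (h0 : contDen x ≠ 0) :
    Z =ᶠ[𝓝 x] fun y => zetaCont a y.1 (fillOne Q y.2) := by
  -- The base point must be interior to the region of convergence, with all free w_j nonzero and of
  -- norm strictly below 1.
  let x₀ : Vars Q := (fun _ => 2, fun _ => 1 / 2)
  have hnear : ∀ᶠ y : Vars Q in 𝓝 x₀, (∀ j, 1 < (y.1 j).re) ∧ ∀ j, y.2 j ≠ 0 ∧ ‖y.2 j‖ < 1 := by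
    refine (eventually_all.2 fun j => ?_).and (eventually_all.2 fun j => ?_)
    · have hc : Continuous fun y : Vars Q => (y.1 j).re := by fun_prop
      exact hc.continuousAt.eventually (lt_mem_nhds (by simp [x₀]))
    · have hc : Continuous fun y : Vars Q => y.2 j := by fun_prop
      exact (hc.continuousAt.eventually_ne (by simp [x₀])).and
        (hc.norm.continuousAt.eventually (gt_mem_nhds (by simp [x₀]; norm_num)))
  have hdom : ∀ y : Vars Q, (∀ j, y.2 j ≠ 0 ∧ ‖y.2 j‖ < 1) → y ∈ contDomain Q := fun y hy j =>
    notMem_ofReal_Ici_of_norm_lt_one (hy j).2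
  have h1 : Z =ᶠ[𝓝 x₀] fun y => zetaCont a y.1 (fillOne Q y.2) := by
    filter_upwards [hnear] with y hy
    have hyd := hdom y hy.2
    exact (hZ.hasSum y hyd hy.1 fun j => ⟨(hy.2 j).1, (hy.2 j).2.le⟩).unique
      (hasSum_zetaCont ha hyd hy.1 fun j => (hy.2 j).2.le)
  exact hZ.meromorphic.eventuallyEq isOpen_contDomain hx (analyticAt_zetaCont ha hx h0)
    (genericallyEqAt_of_isPreconnected isPreconnected_contDomain hZ.meromorphic.meromorphicAt
      (fun y hy => isMeromorphicAt_zetaCont ha hy) (hdom x₀ hnear.self_of_nhds.2)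
      (genericallyEqAt_of_eventuallyEq h1) x hx)

theorem fillOne_oneSet (z : Fin (q + 1) → ℂ) : fillOne (oneSet z) (fun j => z j) = z := by
  ext j
  by_cases hj : j ∈ oneSet z
  · have : z j = 1 := by simpa [oneSet] using hj
    simp [fillOne, hj, this]
  · simp [fillOne, hj]

theorem mem_contDomain_oneSet {z : Fin (q + 1) → ℂ}
    (hz : ∀ j, z j ∉ Complex.ofReal '' Set.Ioi 1) (s : Fin (q + 1) → ℂ) :
    ((s, fun j => z j) : Vars (oneSet z)) ∈ contDomain (oneSet z) := by
  rintro ⟨j, hj⟩ ⟨r, hr, hrz⟩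
  have hr1 : (1 : ℝ) ≤ r := hr
  rcases hr1.eq_or_lt with h | h
  · refine hj ?_
    simp only [oneSet, Finset.mem_filter, Finset.mem_univ, true_and]
    rw [← h, Complex.ofReal_one] at hrz
    exact hrz.symm
  · exact hz j ⟨r, h, hrz⟩

theorem contDen_neg_add_ne_zero (l : Fin (q + 1) → ℕ) {ε : Fin (q + 1) → ℂ}
    (hε : ∀ j, tail ε j ≠ 0) (hε1 : ∀ j, ‖tail ε j‖ < 1) (w : {j // j ∉ Q} → ℂ) :
    contDen ((fun j => -(l j : ℂ) + ε j, w) : Vars Q) ≠ 0 := by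
  refine Finset.prod_ne_zero_iff.2 fun j _ => inv_ne_zero (Complex.Gamma_ne_zero fun m h => ?_)
  rw [bpar_neg_add] at h
  exact neg_nat_add_ne_zero (hε j) (hε1 j) (lpar l j) m (by rw [h]; ring)

end Continuation

end HurwitzLerch

end

/-! ### Existence of the continuation and the asymptotic formula near nonpositive integer points. -/

theorem theorem1 {q : ℕ} (hq : 2 ≤ q + 1) (a z : Fin (q + 1) → ℂ)
    (ha : ∀ j, 0 < (∑ i ∈ Finset.Iic j, a i).re)
    (hz : ∀ j, z j ∉ Complex.ofReal '' Set.Ioi 1) :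
    (∃ Z : HurwitzLerch.Vars (HurwitzLerch.oneSet z) → ℂ,
      HurwitzLerch.IsZetaContinuation a (HurwitzLerch.oneSet z) Z) ∧
    ∀ Z : HurwitzLerch.Vars (HurwitzLerch.oneSet z) → ℂ,
      HurwitzLerch.IsZetaContinuation a (HurwitzLerch.oneSet z) Z →
      ∀ (l : Fin (q + 1) → ℕ) (K : ℝ), ∃ C δ : ℝ, 0 < δ ∧
        ∀ ε : Fin (q + 1) → ℂ,
          (∀ j, ‖ε j‖ < δ) →
          (∀ j, ε j ≠ 0) →
          (∀ j, HurwitzLerch.tail ε j ≠ 0) →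
          (∀ j k, j ≤ k → ‖ε k / HurwitzLerch.tail ε j‖ ≤ K) →
          AnalyticAt ℂ Z (fun j => -(l j : ℂ) + ε j, fun j => z j) ∧
          ‖Z (fun j => -(l j : ℂ) + ε j, fun j => z j) - HurwitzLerch.mainTerm a z l ε‖
            ≤ C * ∑ j, ‖ε j‖ := by
  refine ⟨⟨_, HurwitzLerch.isZetaContinuation_corrected ha⟩, fun Z hZ l K => ?_⟩
  have hadm : HurwitzLerch.Admissible z := by
    have := HurwitzLerch.admissible_fillOne (HurwitzLerch.mem_contDomain_oneSet hz 0)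
    rwa [HurwitzLerch.fillOne_oneSet] at this
  obtain ⟨C, hC⟩ :=
    (HurwitzLerch.zetaCont_sub_mainTerm_isBigO (K := K) hadm ha l).bound
  rw [HurwitzLerch.pertFilter, eventually_inf_principal] at hC
  -- Partial sums that are nonzero and of modulus below 1 keep every b_j away from the poles of Γ,
  -- which gives holomorphy at the point.
  have hsmall : ∀ᶠ ε : Fin (q + 1) → ℂ in 𝓝 0, ∀ j, ‖HurwitzLerch.tail ε j‖ < 1 := by
    refine eventually_all.2 fun j => ?_
    exact (HurwitzLerch.continuous_tail j).norm.continuousAt.eventually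
      (gt_mem_nhds (by simp [HurwitzLerch.tail]))
  obtain ⟨δ, hδ, hball⟩ := Metric.eventually_nhds_iff_ball.1 (hC.and hsmall)
  refine ⟨C, δ, hδ, fun ε h1 h2 h3 h4 => ?_⟩
  obtain ⟨h5, h6⟩ := hball ε (mem_ball_zero_iff.2 ((pi_norm_lt_iff hδ).2 h1))
  have hx := HurwitzLerch.mem_contDomain_oneSet hz fun j => -(l j : ℂ) + ε j
  have hden := HurwitzLerch.contDen_neg_add_ne_zero l h3 h6
    (fun j : {j // j ∉ HurwitzLerch.oneSet z} => z j)
  have heq := hZ.eventuallyEq ha hx hden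
  refine ⟨(HurwitzLerch.analyticAt_zetaCont ha hx hden).congr heq.symm, ?_⟩
  have h7 := h5 ⟨h2, h3, h4⟩
  rw [Real.norm_of_nonneg (HurwitzLerch.pertNorm_nonneg ε)] at h7
  rw [heq.eq_of_nhds, HurwitzLerch.fillOne_oneSet]
  exact h7
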